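/- **Function classes.** Let $a<0<b$. A function on the compactified real line is Hölder if for some $C$ and $\lambda\in(0,1]$ one has $|F(x)-F(y)|\le C|x-y|^\lambda$ for all real $x,y$ and $|F(x)-F(y)|\le C|1/x-1/y|^\lambda$ for $|x|,|y|>1$. Let $D_{a,\infty}$ be the class of functions $F(z)=\int_0^\infty f(x)e^{izx}\,dx$ with $e^{-ax}f\in L_2(0,\infty)$, continuous up to $\operatorname{Im}z=a$, whose values on the line $\operatorname{Im}z=a$ are in $L_2\cap\text{Hölder}$. Let $D_{-\infty,b}$ be the class of functions $F(z)=\int_{-\infty}^0 f(x)e^{izx}\,dx$ with $e^{-bx}f\in L_2(-\infty,0)$, continuous up to $\operatorname{Im}z=b$, whose values on the line $\operatorname{Im}z=b$ are in $L_2\cap\text{Hölder}$. Let $D_{a,b}=D_{a,\infty}+D_{-\infty,b}$ on the closed strip $S=\{a\le\operatorname{Im}z\le b\}$. For $F\in D_{a,b}$ write $F=F^++F^-$ for its additive splitting, $F^+\in D_{a,\infty}$, $F^-\in D_{-\infty,b}$. If $K-1\in D_{a,b}$, then $K=K_+K_-$ on $S$ denotes its factorisation with zero-free factors, $K_+-1\in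 D_{a,\infty}$, $K_--1\in D_{-\infty,b}$. Put $\|F\|_2^c=\big(\int_{\mathbb R}|F(x+ic)|^2dx\big)^{1/2}$. **Problem.** Let $A-1,B-1,C-1\in D_{a,b}$, where $A,B,C$ have no zeros on $S$ and have index (winding number) zero on the real line. For $L>0$ and $f_1,f_2\in D_{a,b}$ consider $$\begin{pmatrix}\Phi_-^{(0)}\\ \Phi_-^{(L)}\end{pmatrix}=\begin{pmatrix}A& Be^{i\alpha L}\\ Ce^{-i\alpha L}&0\end{pmatrix}\begin{pmatrix}\Psi_+^{(0)}\\ \Psi_+^{(L)}\end{pmatrix}+\begin{pmatrix}f_1\\ f_2\end{pmatrix}\quad\text{on } S,$$ with unknowns $\Phi_-^{(0)},\Phi_-^{(L)}\in D_{-\infty,b}$ and $\Psi_+^{(0)},\Psi_+^{(L)}\in D_{a,\infty}$. Put $$K_1=\frac{A}{CB_-},\quad K_3=\frac{A}{B_-},\quad f_3=-\frac{e^{-i\alpha L}}{B_-}f_1+\frac{A}{CB_-}f_2,\quad f_4=\frac{f_1}{B_-}.$$ The factorisations of $B,K_1,K_3$ and the additive splittings of $K_1,K_3,f_3,f_4$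 exist; in the splittings of $K_1$ and $K_3$ the constant $1$ is attributed to $K_1^-$ and to $K_3^+$. **Scheme.** Starting from any $\Phi_-^{(L)0}\in D_{-\infty,b}$, for $n\ge1$ solve for $\Psi_+^{(0)n}\in D_{a,\infty}$ on the line $\operatorname{Im}\alpha=b$ $$K_3^+\Psi_+^{(0)n}=-f_4^+-\big(K_3^-\Psi_+^{(0)n}\big)^++e^{i\alpha L}\Big(\big(K_1^+\Phi_-^{(L)n-1}\big)^+-f_3^+\Big),$$ and then for $\Phi_-^{(L)n}\in D_{-\infty,b}$ on the line $\operatorname{Im}\alpha=a$ $$K_1^-\Phi_-^{(L)n}=f_3^--\big(K_1^+\Phi_-^{(L)n}\big)^-+e^{-i\alpha L}\Big(\big(K_3^-\Psi_+^{(0)n}\big)^-+f_4^-\Big).$$ One possible starting function, which exists, is the solution of $K_1^-\Phi_-^{(L)0}=f_3^--(K_1^+\Phi_-^{(L)0})^-$ on $\operatorname{Im}\alpha=a$. Let $q=d_1d_2\varepsilon_1\varepsilon_2$, where $$d_1=\sup_{\operatorname{Im}\alpha=a}|(K_1)_+|,\quad \varepsilon_1=\sup_{\operatorname{Im}\alpha=a}|(K_1)_+^{-1}e^{-i\alpha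 L}|,\quad d_2=\sup_{\operatorname{Im}\alpha=b}|(K_3)_-|,\quad \varepsilon_2=\sup_{\operatorname{Im}\alpha=b}|e^{i\alpha L}(K_3)_-^{-1}|.$$ **Theorem.** There is $L_0>0$, depending only on $a,b,A,B,C$, such that for all $L\ge L_0$ one has $q<1$ and, for all $f_1,f_2\in D_{a,b}$, the matrix equation has a solution, the scheme can be carried out from every starting function, and for all its iterates $$\|\Phi_-^{(L)n+1}-\Phi_-^{(L)n}\|_2^a\le q\,\|\Phi_-^{(L)n}-\Phi_-^{(L)n-1}\|_2^a\quad(n\ge1).$$ Hence the iterates converge to the exact solution, $\|\Phi_-^{(L)n}-\Phi_-^{(L)}\|_2^a\to0$, with $$\|\Phi_-^{(L)n}-\Phi_-^{(L)}\|_2^a\le\frac{q^n}{1-q}\,\|\Phi_-^{(L)0}-\Phi_-^{(L)1}\|_2^a\quad(n\ge0).$$ Likewise $\|\Psi_+^{(0)n+1}-\Psi_+^{(0)n}\|_2^b\le q\,\|\Psi_+^{(0)n}-\Psi_+^{(0)n-1}\|_2^b$ for $n\ge2$, $\|\Psi_+^{(0)n}-\Psi_+^{(0)}\|_2^b\to0$,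 and $\|\Psi_+^{(0)n}-\Psi_+^{(0)}\|_2^b\le\frac{q^{n-1}}{1-q}\|\Psi_+^{(0)1}-\Psi_+^{(0)2}\|_2^b$ for $n\ge1$. -/

import Mathlib

open MeasureTheory Filter Topology

noncomputable section

namespace WienerHopf

/-! ## Function classes -/

/-- Hölder continuity on the compactified real line. -/
def HolderCompactified (F : ℝ → ℂ) : Prop :=
  ∃ C r : ℝ, 0 < r ∧ r ≤ 1 ∧
    (∀ x y : ℝ, ‖F x - F y‖ ≤ C * |x - y| ^ r) ∧
    (∀ x y : ℝ, 1 < |x| → 1 < |y| → ‖F x - F y‖ ≤ C * |1 / x - 1 / y| ^ r)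

/-- The class `L₂(ℝ) ∩ Hölder`. -/
def ClassZero (F : ℝ → ℂ) : Prop :=
  MemLp F 2 volume ∧ HolderCompactified F

/-- The restriction of `F` to the horizontal line `Im z = c`, as a function of the real part. -/
def onLine (c : ℝ) (F : ℂ → ℂ) : ℝ → ℂ := fun x => F ((x : ℂ) + (c : ℂ) * Complex.I)

/-- The class of plus functions with lower edge `a`: Fourier transforms
`F z = ∫ₓ f x e^{i z x}` of functions `f` supported on `x > 0` with `e^{-a x} f ∈ L₂`, whose values
on the edge `Im z = a` (the Fourier transform of `e^{-a x} f`) are in `L₂ ∩ Hölder`.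
For `Im z > a` the integral converges absolutely; continuity up to the edge says that the values on
the edge are the Fourier transform, in the `L₂` sense, of `e^{-a x} f`.
Only the values on `a ≤ Im z` matter. -/
structure PlusClass (a : ℝ) (F : ℂ → ℂ) : Prop where
  edge : ClassZero (onLine a F)
  cont : ContinuousOn F {z : ℂ | a ≤ z.im}
  fourier : ∃ f : ℝ → ℂ,
    MemLp (fun x : ℝ => (Real.exp (-a * x) : ℂ) * f x) 2 (volume.restrict (Set.Ioi 0)) ∧
    ∀ z : ℂ, a < z.im → F z = ∫ x in Set.Ioi (0 : ℝ), f x * Complex.exp (Complex.I * z * x)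

/-- The class of minus functions with upper edge `b`: the same with functions supported on `x < 0`,
on `Im z ≤ b`. -/
structure MinusClass (b : ℝ) (F : ℂ → ℂ) : Prop where
  edge : ClassZero (onLine b F)
  cont : ContinuousOn F {z : ℂ | z.im ≤ b}
  fourier : ∃ f : ℝ → ℂ,
    MemLp (fun x : ℝ => (Real.exp (-b * x) : ℂ) * f x) 2 (volume.restrict (Set.Iio 0)) ∧
    ∀ z : ℂ, z.im < b → F z = ∫ x in Set.Iio (0 : ℝ), f x * Complex.exp (Complex.I * z * x)

/-- Additive splitting `F = F⁺ + F⁻` on the closed strip `a ≤ Im z ≤ b`. -/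
structure IsAddSplit (a b : ℝ) (F Fp Fm : ℂ → ℂ) : Prop where
  plus : PlusClass a Fp
  minus : MinusClass b Fm
  eq : ∀ z : ℂ, a ≤ z.im → z.im ≤ b → F z = Fp z + Fm z

/-- The class of functions on the strip: sums of a plus function with edge `a` and a minus
function with edge `b`. -/
def StripClass (a b : ℝ) (F : ℂ → ℂ) : Prop :=
  ∃ Fp Fm : ℂ → ℂ, IsAddSplit a b F Fp Fm

/-- Multiplicative splitting (factorisation) `K = K₊ K₋` on the closed strip, with zero-free
factors that tend to `1` at infinity. -/
structure IsMulSplit (a b : ℝ) (K Kp Km : ℂ → ℂ) : Prop where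
  plus : PlusClass a (fun z => Kp z - 1)
  minus : MinusClass b (fun z => Km z - 1)
  plus_ne : ∀ z : ℂ, a ≤ z.im → Kp z ≠ 0
  minus_ne : ∀ z : ℂ, z.im ≤ b → Km z ≠ 0
  eq : ∀ z : ℂ, a ≤ z.im → z.im ≤ b → K z = Kp z * Km z

/-- The winding number about `0` of the curve `t ↦ K t`, `t` in the compactified real line, is `n`:
the total increment of a continuous argument is `2 π n`. -/
def HasIndex (K : ℝ → ℂ) (n : ℤ) : Prop :=
  ∃ θ : ℝ → ℝ, Continuous θ ∧
    (∀ t : ℝ, K t = (‖K t‖ : ℂ) * Complex.exp ((θ t : ℂ) * Complex.I)) ∧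
    ∃ θm θp : ℝ, Tendsto θ atBot (𝓝 θm) ∧ Tendsto θ atTop (𝓝 θp) ∧
      θp - θm = 2 * Real.pi * n

/-- The conditions on a coefficient of the matrix: `K - 1` is in the class of the strip, `K` has no
zeros on the closed strip, and `K` has index zero on the real line. -/
structure Coefficient (a b : ℝ) (K : ℂ → ℂ) : Prop where
  mem : StripClass a b (fun z => K z - 1)
  ne : ∀ z : ℂ, a ≤ z.im → z.im ≤ b → K z ≠ 0
  index : HasIndex (fun t : ℝ => K (t : ℂ)) 0

/-- The norm `‖F‖₂ᶜ`: the `L₂` norm on the line `Im z = c`. -/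
def lineNorm (c : ℝ) (F : ℂ → ℂ) : ENNReal := eLpNorm (onLine c F) 2 volume

/-- The supremum of `|F|` on the line `Im z = c`. -/
def lineSup (c : ℝ) (F : ℂ → ℂ) : ℝ := ⨆ x : ℝ, ‖onLine c F x‖

/-! ## The matrix equation -/

/-- `(Φ0, ΦL, Ψ0, ΨL)` solves the matrix Wiener-Hopf equation on the strip, in the required
classes. -/
structure IsExactSolution (a b L : ℝ) (A B C f1 f2 Φ0 ΦL Ψ0 ΨL : ℂ → ℂ) : Prop where
  Φ0_mem : MinusClass b Φ0
  ΦL_mem : MinusClass b ΦL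
  Ψ0_mem : PlusClass a Ψ0
  ΨL_mem : PlusClass a ΨL
  row1 : ∀ z : ℂ, a ≤ z.im → z.im ≤ b →
    Φ0 z = A z * Ψ0 z + B z * Complex.exp (Complex.I * z * L) * ΨL z + f1 z
  row2 : ∀ z : ℂ, a ≤ z.im → z.im ≤ b →
    ΦL z = C z * Complex.exp (-Complex.I * z * L) * Ψ0 z + f2 z

/-! ## Splittings of the data -/

/-- `Bplus, Bminus` stand for `B₊, B₋`; `K1plus, K1minus, K3plus, K3minus` for the multiplicative
factors `(K₁)₊, (K₁)₋, (K₃)₊, (K₃)₋`; `K1p, K1m, K3p, K3m` for the additive parts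
`K₁⁺, K₁⁻, K₃⁺, K₃⁻`. -/
structure Parts where
  Bplus : ℂ → ℂ
  Bminus : ℂ → ℂ
  K1plus : ℂ → ℂ
  K1minus : ℂ → ℂ
  K3plus : ℂ → ℂ
  K3minus : ℂ → ℂ
  K1p : ℂ → ℂ
  K1m : ℂ → ℂ
  K3p : ℂ → ℂ
  K3m : ℂ → ℂ

/-- `K₁ = A / (C B₋)`. -/
def K1 (A C : ℂ → ℂ) (s : Parts) : ℂ → ℂ := fun z => A z / (C z * s.Bminus z)

/-- `K₃ = A / B₋`. -/
def K3 (A : ℂ → ℂ) (s : Parts) : ℂ → ℂ := fun z => A z / s.Bminus z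

/-- The parts are the splittings of `B`, `K₁`, `K₃`. In the additive splittings the limit `1` at
infinity is attributed to `K₁⁻` and to `K₃⁺` (the scheme does not depend on this choice). -/
structure IsParts (a b : ℝ) (A B C : ℂ → ℂ) (s : Parts) : Prop where
  B_mul : IsMulSplit a b B s.Bplus s.Bminus
  K1_mul : IsMulSplit a b (K1 A C s) s.K1plus s.K1minus
  K3_mul : IsMulSplit a b (K3 A s) s.K3plus s.K3minus
  K1_add : IsAddSplit a b (fun z => K1 A C s z - 1) s.K1p (fun z => s.K1m z - 1)
  K3_add : IsAddSplit a b (fun z => K3 A s z - 1) (fun z => s.K3p z - 1) s.K3m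

/-- The additive parts `f₃⁺, f₃⁻, f₄⁺, f₄⁻` of the forcing terms. -/
structure Forcing where
  f3p : ℂ → ℂ
  f3m : ℂ → ℂ
  f4p : ℂ → ℂ
  f4m : ℂ → ℂ

/-- `f₃ = - e^{-i z L} f₁ / B₋ + A f₂ / (C B₋)` and `f₄ = f₁ / B₋`, split additively. -/
structure IsForcing (a b L : ℝ) (A C f1 f2 : ℂ → ℂ) (s : Parts) (g : Forcing) : Prop where
  f3 : IsAddSplit a b
    (fun z => -Complex.exp (-Complex.I * z * L) / s.Bminus z * f1 z
      + A z / (C z * s.Bminus z) * f2 z) g.f3p g.f3m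
  f4 : IsAddSplit a b (fun z => f1 z / s.Bminus z) g.f4p g.f4m

/-! ## The iterative scheme -/

/-- The first approximation, on the line `Im z = a`: `K₁⁻ Φ = f₃⁻ - (K₁⁺ Φ)⁻`. -/
def FirstApprox (a b : ℝ) (s : Parts) (g : Forcing) (Φ : ℂ → ℂ) : Prop :=
  ∃ Dp Dm : ℂ → ℂ, IsAddSplit a b (fun z => s.K1p z * Φ z) Dp Dm ∧
    ∀ z : ℂ, z.im = a → s.K1m z * Φ z = g.f3m z - Dm z

/-- The equation for `Φ` with given `Ψ`, on the line `Im z = a`: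
`K₁⁻ Φ = f₃⁻ - (K₁⁺ Φ)⁻ + e^{-i z L} ((K₃⁻ Ψ)⁻ + f₄⁻)`. -/
def PhiEquation (a b L : ℝ) (s : Parts) (g : Forcing) (Ψ Φ : ℂ → ℂ) : Prop :=
  ∃ Dp Dm Ep Em : ℂ → ℂ,
    IsAddSplit a b (fun z => s.K1p z * Φ z) Dp Dm ∧
    IsAddSplit a b (fun z => s.K3m z * Ψ z) Ep Em ∧
    ∀ z : ℂ, z.im = a →
      s.K1m z * Φ z
        = g.f3m z - Dm z + Complex.exp (-Complex.I * z * L) * (Em z + g.f4m z)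

/-- The equation for `Ψ` with given `Φ`, on the line `Im z = b`:
`K₃⁺ Ψ = - f₄⁺ - (K₃⁻ Ψ)⁺ + e^{i z L} ((K₁⁺ Φ)⁺ - f₃⁺)`. -/
def PsiEquation (a b L : ℝ) (s : Parts) (g : Forcing) (Φ Ψ : ℂ → ℂ) : Prop :=
  ∃ Dp Dm Ep Em : ℂ → ℂ,
    IsAddSplit a b (fun z => s.K1p z * Φ z) Dp Dm ∧
    IsAddSplit a b (fun z => s.K3m z * Ψ z) Ep Em ∧
    ∀ z : ℂ, z.im = b →
      s.K3p z * Ψ z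
        = -g.f4p z - Ep z + Complex.exp (Complex.I * z * L) * (Dp z - g.f3p z)

/-- `Φ n` and `Ψ (n + 1)` (for all `n ≥ 0`) are the iterates: `Φ n` determines `Ψ (n + 1)`, which
determines `Φ (n + 1)`. The scheme starts from `Φ 0`, and `Ψ 0` plays no role. -/
structure IsIteration (a b L : ℝ) (s : Parts) (g : Forcing) (Φ Ψ : ℕ → ℂ → ℂ) : Prop where
  Φ_mem : ∀ n, MinusClass b (Φ n)
  Ψ_mem : ∀ n, PlusClass a (Ψ (n + 1))
  Ψ_step : ∀ n, PsiEquation a b L s g (Φ n) (Ψ (n + 1))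
  Φ_step : ∀ n, PhiEquation a b L s g (Ψ (n + 1)) (Φ (n + 1))

/-- `q = d₁ d₂ ε₁ ε₂`, where `d₁ = sup |(K₁)₊|` and `ε₁ = sup |(K₁)₊⁻¹ e^{-i L z}|` on the line
`Im z = a`, and `d₂ = sup |(K₃)₋|` and `ε₂ = sup |e^{i L z} (K₃)₋⁻¹|` on the line `Im z = b`. -/
def ratio (a b L : ℝ) (s : Parts) : ℝ :=
  lineSup a s.K1plus * lineSup b s.K3minus *
    lineSup a (fun z => (s.K1plus z)⁻¹ * Complex.exp (-Complex.I * z * L)) *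
    lineSup b (fun z => Complex.exp (Complex.I * z * L) * (s.K3minus z)⁻¹)

end WienerHopf

end

/-! Factorise `B` and eliminate. With Y = Φ⁰/B₋ and X = −B₊Ψᴸ the matrix equation becomes two scalar
Wiener-Hopf equations, K₃Ψ = Y + e^{iαL}X − f₄ and K₁Φ = X + e^{−iαL}Y + f₃, coupled only through
the exponentials (`GoodParts.exact_steps`, `GoodParts.exists_exactSolution`). Each half-step of the
scheme is one of these equations with the coupling term frozen. An identity between plus functions,
or between minus functions, on one line extends to the whole half-plane, so the equation posed on
one line is an equation on the strip (`plusSolves_of_line`, `minusSolves_of_line`). Differences of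
iterates, and differences from the exact solution, satisfy the homogeneous equations K₃Ψ = Y +
e^{iαL}X and K₁Φ = X' + e^{−iαL}Y.

The contraction comes from the tail of a Fourier density. Dividing the first homogeneous equation by
(K₃)₋ shows that −Y/(K₃)₋ is the minus part of e^{iαL}X/(K₃)₋. Write 1/(K₃)₋ = 1 + h with h a minus
function. The term e^{iαL}X is a plus function and drops out, and so does the part of h with
frequencies in (−L, 0), since e^{iαL} shifts them to positive ones. Only the tail of h beyond −L
remains. Its density is square integrable after weighting at the edge Im α = b, so on Im α = a the
tail is o(e^{(a−b)L}), and ‖Y‖ = o(e^{−bL})‖X‖ there. Solving the second equation costs a constant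
times e^{aL}. A full cycle therefore has norm o(e^{(a−b)L}); the same holds on the upper line by z ↦
−z (`Factorisation.exists_tail_bound_minus`, `exists_contraction_minus`, `exists_contraction_plus`).
On the other side e^{(a−b)L} ≤ q ≤ R e^{(a−b)L} (`GoodParts.exists_ratio_bound`), so for large L the
o(1) factor absorbs every constant, the cycle contracts with ratio q, and q < 1.

The same contraction yields an exact solution, but only as an L² limit on the lower line, which says
nothing about Hölder regularity. `exists_coupled_solution` recovers the classes: the limit of X is
uniform on a smaller half-plane, projecting there produces Y with regular values on its own edge Im
α = b, and one more cycle started from that Y has all its members in the required classes.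

The function theory rests on three facts. Plus functions are exactly the continuous, bounded,
holomorphic functions with L² ∩ Hölder values and bounded L² norms on the lines
(`plusClass_iff_nice`, a Paley-Wiener theorem), so the classes are stable under products and
exponentials. Functions with these properties on a strip split additively by Cauchy integrals
(`Nice.stripClass`), and Plancherel bounds the parts on each line (`lineNorm_le_add`). Index zero
gives a coefficient a logarithm of the same kind (`Coefficient.exists_log`), and splitting it
factorises the coefficient (`exists_factorisation`). -/

open scoped FourierTransform

namespace WienerHopf

/-! ## Hölder functions on the line -/

/-- Bounded, globally Hölder functions on the line. -/
def HolderBdd (u : ℝ → ℂ) : Prop :=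
  ∃ C r : ℝ, 0 < r ∧ r ≤ 1 ∧ (∀ x, ‖u x‖ ≤ C) ∧ ∀ x y, ‖u x - u y‖ ≤ C * |x - y| ^ r

/-- Functions with power decay at infinity. -/
def PowerDecay (u : ℝ → ℂ) : Prop :=
  ∃ C r : ℝ, 0 < r ∧ r ≤ 1 ∧ ∀ x, ‖u x‖ ≤ C * (1 + |x|) ^ (-r)

/-- Boundedness controls distances above 1, so the Hölder exponent can be lowered freely. This
brings two functions to a common exponent. -/
theorem HolderBdd.exists_exponent_le {u : ℝ → ℂ} (h : HolderBdd u) :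
    ∃ C r : ℝ, 0 < r ∧ r ≤ 1 ∧ 0 ≤ C ∧ (∀ x, ‖u x‖ ≤ C) ∧
      ∀ s, 0 < s → s ≤ r → ∀ x y, ‖u x - u y‖ ≤ C * |x - y| ^ s := by
  obtain ⟨C, r, hr, hr1, hb, hh⟩ := h
  have hC : 0 ≤ C := (norm_nonneg _).trans (hb 0)
  refine ⟨2 * C, r, hr, hr1, by positivity, fun x => (hb x).trans (by linarith), ?_⟩
  intro s hs hsr x y
  rcases le_total |x - y| 1 with h1 | h1
  · have h0 : |x - y| ^ r ≤ |x - y| ^ s := by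
      rcases (abs_nonneg (x - y)).eq_or_lt with h0 | h0
      · rw [← h0, Real.zero_rpow hr.ne', Real.zero_rpow hs.ne']
      · exact Real.rpow_le_rpow_of_exponent_ge h0 h1 hsr
    calc ‖u x - u y‖ ≤ C * |x - y| ^ r := hh x y
      _ ≤ C * |x - y| ^ s := by gcongr
      _ ≤ 2 * C * |x - y| ^ s := by gcongr; linarith
  · have h0 : 1 ≤ |x - y| ^ s := Real.one_le_rpow h1 hs.le
    calc ‖u x - u y‖ ≤ ‖u x‖ + ‖u y‖ := norm_sub_le _ _
      _ ≤ 2 * C := by linarith [hb x, hb y]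
      _ ≤ 2 * C * |x - y| ^ s := le_mul_of_one_le_right (by positivity) h0

theorem HolderBdd.of_lipschitz {u : ℝ → ℂ} {C K : ℝ} (hb : ∀ x, ‖u x‖ ≤ C)
    (hl : ∀ x y, ‖u x - u y‖ ≤ K * |x - y|) : HolderBdd u := by
  refine ⟨max C K, 1, one_pos, le_rfl, fun x => (hb x).trans (le_max_left _ _), fun x y => ?_⟩
  rw [Real.rpow_one]
  exact (hl x y).trans (mul_le_mul_of_nonneg_right (le_max_right _ _) (abs_nonneg _))

theorem HolderBdd.continuous {u : ℝ → ℂ} (h : HolderBdd u) : Continuous u := by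
  obtain ⟨C, r, hr, hr1, hb, hh⟩ := h
  rw [continuous_iff_continuousAt]
  intro x
  rw [ContinuousAt, tendsto_iff_norm_sub_tendsto_zero]
  have h1 : Tendsto (fun y : ℝ => C * |y - x| ^ r) (𝓝 x) (𝓝 0) := by
    have : Continuous fun y : ℝ => C * |y - x| ^ r := by
      refine continuous_const.mul (Continuous.rpow_const (by fun_prop) fun _ => Or.inr hr.le)
    simpa [Real.zero_rpow hr.ne'] using this.tendsto x
  exact squeeze_zero (fun _ => norm_nonneg _) (fun y => hh y x) h1

theorem HolderBdd.const (c : ℂ) : HolderBdd fun _ => c :=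
  HolderBdd.of_lipschitz (C := ‖c‖) (K := 0) (fun _ => le_rfl) (by simp)

theorem HolderBdd.add {u v : ℝ → ℂ} (hu : HolderBdd u) (hv : HolderBdd v) :
    HolderBdd fun x => u x + v x := by
  obtain ⟨C, r, hr, hr1, hC, hb, hh⟩ := hu.exists_exponent_le
  obtain ⟨D, s, hs, hs1, hD, hb', hh'⟩ := hv.exists_exponent_le
  refine ⟨C + D, min r s, lt_min hr hs, (min_le_left _ _).trans hr1,
    fun x => (norm_add_le _ _).trans (add_le_add (hb x) (hb' x)), fun x y => ?_⟩
  have h1 := hh (min r s) (lt_min hr hs) (min_le_left _ _) x y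
  have h2 := hh' (min r s) (lt_min hr hs) (min_le_right _ _) x y
  calc ‖u x + v x - (u y + v y)‖ = ‖(u x - u y) + (v x - v y)‖ := by ring_nf
    _ ≤ _ := norm_add_le _ _
    _ ≤ _ := by rw [add_mul]; exact add_le_add h1 h2

theorem HolderBdd.mul {u v : ℝ → ℂ} (hu : HolderBdd u) (hv : HolderBdd v) :
    HolderBdd fun x => u x * v x := by
  obtain ⟨C, r, hr, hr1, hC, hb, hh⟩ := hu.exists_exponent_le
  obtain ⟨D, s, hs, hs1, hD, hb', hh'⟩ := hv.exists_exponent_le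
  refine ⟨2 * (C * D), min r s, lt_min hr hs, (min_le_left _ _).trans hr1, fun x => ?_,
    fun x y => ?_⟩
  · rw [norm_mul]
    calc ‖u x‖ * ‖v x‖ ≤ C * D := mul_le_mul (hb x) (hb' x) (norm_nonneg _) hC
      _ ≤ _ := by linarith [mul_nonneg hC hD]
  have h1 := hh (min r s) (lt_min hr hs) (min_le_left _ _) x y
  have h2 := hh' (min r s) (lt_min hr hs) (min_le_right _ _) x y
  calc ‖u x * v x - u y * v y‖ = ‖(u x - u y) * v x + u y * (v x - v y)‖ := by ring_nf
    _ ≤ ‖u x - u y‖ * ‖v x‖ + ‖u y‖ * ‖v x - v y‖ := by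
      refine (norm_add_le _ _).trans ?_
      rw [norm_mul, norm_mul]
    _ ≤ (C * |x - y| ^ min r s) * D + C * (D * |x - y| ^ min r s) := by
      gcongr
      · exact hb' x
      · exact hb y
    _ = _ := by ring

theorem HolderBdd.comp_lipschitz {u : ℝ → ℂ} (hu : HolderBdd u) {φ : ℂ → ℂ}
    {M K : ℝ} (hM : ∀ x, ‖φ (u x)‖ ≤ M)
    (hK : ∀ x y, ‖φ (u x) - φ (u y)‖ ≤ K * ‖u x - u y‖) : HolderBdd fun x => φ (u x) := by
  obtain ⟨C, r, hr, hr1, hC, hb, hh⟩ := hu.exists_exponent_le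
  have hM0 : 0 ≤ M := (norm_nonneg _).trans (hM 0)
  refine ⟨M + |K| * C, r, hr, hr1, fun x => (hM x).trans (by
    have : 0 ≤ |K| * C := by positivity
    linarith), fun x y => ?_⟩
  have h0 : 0 ≤ |x - y| ^ r := by positivity
  calc ‖φ (u x) - φ (u y)‖ ≤ K * ‖u x - u y‖ := hK x y
    _ ≤ |K| * (C * |x - y| ^ r) := by
      gcongr
      · exact le_abs_self K
      · exact hh r hr le_rfl x y
    _ ≤ _ := by nlinarith [mul_nonneg hM0 h0]

theorem HolderBdd.comp_neg {u : ℝ → ℂ} (hu : HolderBdd u) : HolderBdd fun x => u (-x) := by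
  obtain ⟨C, r, hr, hr1, hb, hh⟩ := hu
  refine ⟨C, r, hr, hr1, fun x => hb _, fun x y => (hh _ _).trans_eq ?_⟩
  rw [← abs_neg]; ring_nf

theorem PowerDecay.exists_exponent_le {u : ℝ → ℂ} (h : PowerDecay u) :
    ∃ C r : ℝ, 0 < r ∧ r ≤ 1 ∧ 0 ≤ C ∧
      ∀ s, s ≤ r → ∀ x, ‖u x‖ ≤ C * (1 + |x|) ^ (-s) := by
  obtain ⟨C, r, hr, hr1, hb⟩ := h
  have hC : 0 ≤ C := by
    have := (norm_nonneg _).trans (hb 0)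
    simpa using this
  refine ⟨C, r, hr, hr1, hC, fun s hs x => (hb x).trans ?_⟩
  gcongr
  linarith [abs_nonneg x]

theorem PowerDecay.add {u v : ℝ → ℂ} (hu : PowerDecay u) (hv : PowerDecay v) :
    PowerDecay fun x => u x + v x := by
  obtain ⟨C, r, hr, hr1, hC, hb⟩ := hu.exists_exponent_le
  obtain ⟨D, s, hs, hs1, hD, hb'⟩ := hv.exists_exponent_le
  refine ⟨C + D, min r s, lt_min hr hs, (min_le_left _ _).trans hr1, fun x => ?_⟩
  rw [add_mul]
  exact (norm_add_le _ _).trans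
    (add_le_add (hb _ (min_le_left _ _) x) (hb' _ (min_le_right _ _) x))

theorem PowerDecay.of_le_mul {u v : ℝ → ℂ} (hv : PowerDecay v) {K : ℝ}
    (h : ∀ x, ‖u x‖ ≤ K * ‖v x‖) : PowerDecay u := by
  obtain ⟨C, r, hr, hr1, hC, hb⟩ := hv.exists_exponent_le
  refine ⟨|K| * C, r, hr, hr1, fun x => ?_⟩
  calc ‖u x‖ ≤ K * ‖v x‖ := h x
    _ ≤ |K| * (C * (1 + |x|) ^ (-r)) := by
      gcongr
      · exact le_abs_self K
      · exact hb r le_rfl x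
    _ = _ := by ring

theorem PowerDecay.comp_neg {u : ℝ → ℂ} (hu : PowerDecay u) : PowerDecay fun x => u (-x) := by
  obtain ⟨C, r, hr, hr1, hb⟩ := hu
  exact ⟨C, r, hr, hr1, fun x => by simpa using hb (-x)⟩

/-! ### The compactified Hölder condition as Hölder continuity with decay. -/

theorem exists_norm_lt_of_memLp {u : ℝ → ℂ} (hu : MemLp u 2 volume) {ε : ℝ} (hε : 0 < ε) (N : ℝ) :
    ∃ y, N < y ∧ ‖u y‖ < ε := by
  by_contra! h
  have h1 := (memLp_two_iff_integrable_sq_norm hu.1).1 hu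
  have h2 : IntegrableOn (fun _ : ℝ => ε ^ 2) (Set.Ioi N) volume := by
    refine Integrable.mono' (h1.integrableOn (s := Set.Ioi N)) (by fun_prop) ?_
    refine (ae_restrict_iff' measurableSet_Ioi).2 (Eventually.of_forall fun y hy => ?_)
    rw [Real.norm_of_nonneg (by positivity)]
    exact pow_le_pow_left₀ hε.le (h y hy) 2
  rw [integrableOn_const_iff] at h2
  simp [hε.ne'] at h2

/-- Letting y → ∞ in the condition on |1/x − 1/y| compares u(x) with a limit at infinity. Square
integrability supplies points y arbitrarily far out with u(y) small, which forces that limit to be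
0. -/
theorem HolderCompactified.powerDecay {u : ℝ → ℂ} (h : HolderCompactified u)
    (hu : MemLp u 2 volume) : PowerDecay u := by
  obtain ⟨C, r, hr, hr1, h1, h2⟩ := h
  have hC : 0 ≤ C := by
    have := (norm_nonneg _).trans (h1 1 0)
    simpa using this
  have hout : ∀ x, 1 < |x| → ‖u x‖ ≤ C * |1 / x| ^ r := by
    intro x hx
    refine le_of_forall_pos_le_add fun ε hε => ?_
    have hcont : Tendsto (fun y : ℝ => C * |1 / x - 1 / y| ^ r) atTop (𝓝 (C * |1 / x - 0| ^ r)) := by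
      refine Tendsto.const_mul _ (Tendsto.rpow_const ?_ (Or.inr hr.le))
      refine (Tendsto.sub tendsto_const_nhds ?_).abs
      exact tendsto_const_nhds.div_atTop tendsto_id
    rw [sub_zero] at hcont
    have hev := hcont.eventually (gt_mem_nhds (show C * |1 / x| ^ r < C * |1 / x| ^ r + ε / 2 by linarith))
    obtain ⟨N, hN⟩ := eventually_atTop.1 hev
    obtain ⟨y, hy, hyε⟩ := exists_norm_lt_of_memLp hu (half_pos hε) (max N 1)
    have hy1 : 1 < |y| := (le_max_right N 1).trans_lt (hy.trans_le (le_abs_self y))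
    have hyN : N ≤ y := (le_max_left N 1).trans hy.le
    have := h2 x y hx hy1
    have h3 := hN y hyN
    have h4 : ‖u x‖ ≤ ‖u x - u y‖ + ‖u y‖ := by
      simpa using norm_add_le (u x - u y) (u y)
    linarith
  refine ⟨2 * (C * 3 + ‖u 2‖), r, hr, hr1, fun x => ?_⟩
  have h2r : (2:ℝ) ^ (r) ≤ 2 := by
    simpa using Real.rpow_le_rpow_of_exponent_le (x := 2) (by norm_num) hr1
  rcases lt_or_ge 1 |x| with hx | hx
  · have hx0 : 0 < |x| := by linarith
    have h5 : |1 / x| ^ r ≤ 2 * (1 + |x|) ^ (-r) := by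
      have : |1 / x| = |x|⁻¹ := by rw [one_div, abs_inv]
      rw [this, Real.inv_rpow hx0.le, Real.rpow_neg (by positivity), ← div_eq_mul_inv,
        inv_eq_one_div, div_le_div_iff₀ (by positivity) (by positivity), one_mul]
      calc (1 + |x|) ^ r ≤ (2 * |x|) ^ r := by gcongr; linarith
        _ = 2 ^ r * |x| ^ r := Real.mul_rpow (by norm_num) hx0.le
        _ ≤ 2 * |x| ^ r := by gcongr
    calc ‖u x‖ ≤ C * |1 / x| ^ r := hout x hx
      _ ≤ C * (2 * (1 + |x|) ^ (-r)) := by gcongr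
      _ ≤ 2 * (C * 3 + ‖u 2‖) * (1 + |x|) ^ (-r) := by
        have h0 : 0 ≤ (1 + |x|) ^ (-r) := by positivity
        nlinarith [mul_nonneg hC h0, mul_nonneg (norm_nonneg (u 2)) h0]
  · have h5 : ‖u x‖ ≤ C * 3 + ‖u 2‖ := by
      have h6 : ‖u x‖ ≤ ‖u x - u 2‖ + ‖u 2‖ := by
        simpa using norm_add_le (u x - u 2) (u 2)
      have h7 : |x - 2| ≤ 3 := by
        rw [abs_le] at hx ⊢; constructor <;> linarith [hx.1, hx.2]
      have h8 : |x - 2| ^ r ≤ 3 := by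
        calc |x - 2| ^ r ≤ 3 ^ r := by gcongr
          _ ≤ 3 ^ (1:ℝ) := Real.rpow_le_rpow_of_exponent_le (by norm_num) hr1
          _ = 3 := Real.rpow_one _
      have := h1 x 2
      nlinarith
    have h9 : 1 ≤ 2 * (1 + |x|) ^ (-r) := by
      rw [Real.rpow_neg (by positivity), ← div_eq_mul_inv, le_div_iff₀ (by positivity), one_mul]
      calc (1 + |x|) ^ r ≤ 2 ^ r := by gcongr; linarith
        _ ≤ 2 := h2r
    have : 0 ≤ C * 3 + ‖u 2‖ := by positivity
    nlinarith

/-- If |y| ≥ 2|x|, then |1/x − 1/y| is at least 1/(2|x|) and decay alone suffices. If |x| ≤ |y| ≤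
2|x|, the Hölder bound and the decay bound are interpolated, and |x − y|/|x|² is comparable with
|1/x − 1/y|. -/
theorem holderCompactified_of_powerDecay {u : ℝ → ℂ} (hu : HolderBdd u) (hd : PowerDecay u) :
    HolderCompactified u := by
  obtain ⟨C, r, hr, hr1, hC, hb, hh⟩ := hu.exists_exponent_le
  obtain ⟨D, s, hs, hs1, hD, hb'⟩ := hd.exists_exponent_le
  -- The solution of rθ = ρ and s(1 − θ) = 2ρ: the interpolated bound is then exactly a multiple of
  -- (|x − y|/|x|²)^ρ.
  set ρ : ℝ := s * r / (2 * r + s) with hρ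
  have hρ0 : 0 < ρ := by positivity
  have hρr : ρ ≤ r := by
    rw [hρ, div_le_iff₀ (by positivity)]; nlinarith
  have hρs : ρ ≤ s := by
    rw [hρ, div_le_iff₀ (by positivity)]; nlinarith
  set θ : ℝ := ρ / r with hθ
  have hθ0 : 0 < θ := by positivity
  have hθ1 : θ ≤ 1 := by rw [hθ, div_le_one hr]; exact hρr
  have hθr : r * θ = ρ := by rw [hθ]; field_simp
  have hsθ : s * (1 - θ) = 2 * ρ := by rw [hθ, hρ]; field_simp; ring
  have key : ∀ x y : ℝ, 1 < |x| → 1 < |y| → |x| ≤ |y| →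
      ‖u x - u y‖ ≤ 2 * ((2 * D) + (2 * D) ^ (1 - θ) * C ^ θ) * |1 / x - 1 / y| ^ ρ := by
    intro x y hx hy hxy
    have hx0 : 0 < |x| := by linarith
    have hy0 : 0 < |y| := by linarith
    have hxne : x ≠ 0 := abs_pos.1 hx0
    have hyne : y ≠ 0 := abs_pos.1 hy0
    have hE : |1 / x - 1 / y| = |x - y| / (|x| * |y|) := by
      rw [← abs_mul, ← abs_div, ← abs_neg]; congr 1; field_simp; ring
    have hA : ∀ t, t ≤ s → ‖u x - u y‖ ≤ 2 * D * |x| ^ (-t) := by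
      intro t ht
      by_cases ht0 : 0 ≤ t
      swap
      · push Not at ht0
        have h1 := hb' 0 hs.le x
        have h2 := hb' 0 hs.le y
        simp only [neg_zero, Real.rpow_zero, mul_one] at h1 h2
        have h3 : 1 ≤ |x| ^ (-t) := Real.one_le_rpow hx.le (by linarith)
        have := norm_sub_le (u x) (u y)
        nlinarith
      have h1 : (1 + |x|) ^ (-t) ≤ |x| ^ (-t) :=
        Real.rpow_le_rpow_of_nonpos hx0 (by linarith) (by linarith)
      have h2 : (1 + |y|) ^ (-t) ≤ |x| ^ (-t) :=
        Real.rpow_le_rpow_of_nonpos hx0 (by linarith) (by linarith)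
      calc ‖u x - u y‖ ≤ ‖u x‖ + ‖u y‖ := norm_sub_le _ _
        _ ≤ D * (1 + |x|) ^ (-t) + D * (1 + |y|) ^ (-t) := add_le_add (hb' t ht x) (hb' t ht y)
        _ ≤ D * |x| ^ (-t) + D * |x| ^ (-t) := by gcongr
        _ = _ := by ring
    have h2ρ : (2:ℝ) ^ ρ ≤ 2 := by
      simpa using Real.rpow_le_rpow_of_exponent_le (x := 2) (by norm_num) (hρr.trans hr1)
    have hK : 0 ≤ (2 * D) ^ (1 - θ) * C ^ θ := by positivity
    rcases le_total (2 * |x|) |y| with hc | hc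
    · have h1 : |x|⁻¹ ≤ 2 * |1 / x - 1 / y| := by
        rw [hE]
        have : |y| / 2 ≤ |x - y| := by
          have := abs_sub_abs_le_abs_sub y x
          rw [abs_sub_comm] at this
          linarith
        rw [inv_eq_one_div, ← mul_div_assoc, div_le_div_iff₀ hx0 (by positivity)]
        nlinarith
      calc ‖u x - u y‖ ≤ 2 * D * |x| ^ (-ρ) := hA ρ hρs
        _ = 2 * D * (|x|⁻¹) ^ ρ := by rw [Real.inv_rpow hx0.le, Real.rpow_neg hx0.le]
        _ ≤ 2 * D * (2 * |1 / x - 1 / y|) ^ ρ := by gcongr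
        _ = 2 * D * (2 ^ ρ * |1 / x - 1 / y| ^ ρ) := by rw [Real.mul_rpow (by norm_num) (abs_nonneg _)]
        _ ≤ 2 * D * (2 * |1 / x - 1 / y| ^ ρ) := by gcongr
        _ ≤ _ := by
          have : 0 ≤ |1 / x - 1 / y| ^ ρ := by positivity
          nlinarith [mul_nonneg hK this]
    · have h1 : |x - y| / |x| ^ 2 ≤ 2 * |1 / x - 1 / y| := by
        rw [hE, ← mul_div_assoc, div_le_div_iff₀ (by positivity) (by positivity)]
        nlinarith [mul_nonneg (abs_nonneg (x - y)) (mul_nonneg hx0.le (sub_nonneg.2 hc))]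
      have h2 : ‖u x - u y‖ ≤ (2 * D * |x| ^ (-s)) ^ (1 - θ) * (C * |x - y| ^ r) ^ θ := by
        rcases (norm_nonneg (u x - u y)).eq_or_lt with h0 | h0
        · rw [← h0]; positivity
        calc ‖u x - u y‖ = ‖u x - u y‖ ^ (1 - θ) * ‖u x - u y‖ ^ θ := by
              rw [← Real.rpow_add h0]; simp
          _ ≤ _ := by
            gcongr
            · exact hA s le_rfl
            · exact hh r hr le_rfl x y
      have h3 : (2 * D * |x| ^ (-s)) ^ (1 - θ) * (C * |x - y| ^ r) ^ θ
          = (2 * D) ^ (1 - θ) * C ^ θ * (|x - y| / |x| ^ 2) ^ ρ := by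
        rw [Real.mul_rpow (by positivity) (by positivity), Real.mul_rpow hC (by positivity),
          ← Real.rpow_mul hx0.le, ← Real.rpow_mul (abs_nonneg _), hθr,
          Real.div_rpow (abs_nonneg _) (by positivity), ← Real.rpow_natCast, ← Real.rpow_mul hx0.le,
          neg_mul, hsθ, Real.rpow_neg hx0.le]
        push_cast
        field_simp
      calc ‖u x - u y‖ ≤ (2 * D) ^ (1 - θ) * C ^ θ * (|x - y| / |x| ^ 2) ^ ρ := h2.trans_eq h3
        _ ≤ (2 * D) ^ (1 - θ) * C ^ θ * (2 * |1 / x - 1 / y|) ^ ρ := by gcongr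
        _ = (2 * D) ^ (1 - θ) * C ^ θ * (2 ^ ρ * |1 / x - 1 / y| ^ ρ) := by
          rw [Real.mul_rpow (by norm_num) (abs_nonneg _)]
        _ ≤ (2 * D) ^ (1 - θ) * C ^ θ * (2 * |1 / x - 1 / y| ^ ρ) := by gcongr
        _ ≤ _ := by
          have : 0 ≤ |1 / x - 1 / y| ^ ρ := by positivity
          nlinarith [mul_nonneg hD this]
  set K : ℝ := 2 * ((2 * D) + (2 * D) ^ (1 - θ) * C ^ θ) with hKdef
  have hK0 : 0 ≤ K := by positivity
  refine ⟨max C K, ρ, hρ0, hρr.trans hr1, fun x y => ?_, fun x y hx hy => ?_⟩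
  · exact (hh ρ hρ0 hρr x y).trans (by gcongr; exact le_max_left _ _)
  · rcases le_total |x| |y| with h | h
    · exact (key x y hx hy h).trans (by gcongr; exact le_max_right _ _)
    · rw [norm_sub_rev, abs_sub_comm (1 / x)]
      exact (key y x hy hx h).trans (by gcongr; exact le_max_right _ _)

theorem HolderCompactified.holderBdd {u : ℝ → ℂ} (h : HolderCompactified u)
    (hu : MemLp u 2 volume) : HolderBdd u := by
  obtain ⟨D, s, hs, hs1, hD, hb⟩ := (h.powerDecay hu).exists_exponent_le
  obtain ⟨C, r, hr, hr1, h1, h2⟩ := h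
  refine ⟨max D C, r, hr, hr1, fun x => ?_, fun x y => (h1 x y).trans ?_⟩
  · exact (by simpa using hb 0 hs.le x : ‖u x‖ ≤ D).trans (le_max_left _ _)
  · gcongr; exact le_max_right _ _

/-- The three conditions on the right pass separately through products, Cauchy integrals and
exponentials, so membership is always checked in this form. -/
theorem classZero_iff {u : ℝ → ℂ} :
    ClassZero u ↔ MemLp u 2 volume ∧ HolderBdd u ∧ PowerDecay u :=
  ⟨fun h => ⟨h.1, h.2.holderBdd h.1, h.2.powerDecay h.1⟩,
    fun h => ⟨h.1, holderCompactified_of_powerDecay h.2.1 h.2.2⟩⟩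

theorem ClassZero.mul_holderBdd {u v : ℝ → ℂ} (hu : ClassZero u) (hv : HolderBdd v) :
    ClassZero fun x => v x * u x := by
  rw [classZero_iff] at hu ⊢
  obtain ⟨C, r, hr, hr1, hC, hb, hh⟩ := hv.exists_exponent_le
  have hle : ∀ x, ‖v x * u x‖ ≤ C * ‖u x‖ := fun x => by
    rw [norm_mul]; exact mul_le_mul_of_nonneg_right (hb x) (norm_nonneg _)
  exact ⟨hu.1.of_le_mul (hv.continuous.aestronglyMeasurable.mul hu.1.1) (Eventually.of_forall hle),
    hv.mul hu.2.1, hu.2.2.of_le_mul hle⟩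

theorem ClassZero.add {u v : ℝ → ℂ} (hu : ClassZero u) (hv : ClassZero v) :
    ClassZero fun x => u x + v x := by
  rw [classZero_iff] at hu hv ⊢
  exact ⟨hu.1.add hv.1, hu.2.1.add hv.2.1, hu.2.2.add hv.2.2⟩

theorem ClassZero.of_le_mul {u v : ℝ → ℂ} (hv : ClassZero v) (hu : HolderBdd u) {K : ℝ}
    (h : ∀ x, ‖u x‖ ≤ K * ‖v x‖) : ClassZero u := by
  rw [classZero_iff] at hv ⊢
  exact ⟨hv.1.of_le_mul hu.continuous.aestronglyMeasurable (Eventually.of_forall h), hu,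
    hv.2.2.of_le_mul h⟩

theorem ClassZero.holderBdd {u : ℝ → ℂ} (hu : ClassZero u) : HolderBdd u :=
  (classZero_iff.1 hu).2.1

theorem ClassZero.comp_neg {u : ℝ → ℂ} (hu : ClassZero u) : ClassZero fun x => u (-x) := by
  rw [classZero_iff] at hu ⊢
  exact ⟨hu.1.comp_measurePreserving (Measure.measurePreserving_neg _), hu.2.1.comp_neg,
    hu.2.2.comp_neg⟩

/-! ## The Fourier transform in `L²` with kernel `exp (i t x)` -/

/-- The Fourier integral with kernel `exp (i t x)`. -/
noncomputable def ft (g : ℝ → ℂ) (t : ℝ) : ℂ := ∫ x : ℝ, g x * Complex.exp (Complex.I * t * x)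

/-- The kernel exp(2πisx) differs from exp(itx) by t = 2πs; this is the source of the factors 2π in
the following lemmas. -/
theorem fourierInv_eq_ft (g : ℝ → ℂ) (s : ℝ) : 𝓕⁻ g s = ft g (2 * Real.pi * s) := by
  rw [Real.fourierInv_eq', ft]
  refine integral_congr_ae (Eventually.of_forall fun x => ?_)
  simp only [smul_eq_mul]
  rw [mul_comm]
  congr 2
  simp only [RCLike.inner_apply, conj_trivial]
  push_cast
  ring

theorem map_two_pi : Measure.map (fun s : ℝ => 2 * Real.pi * s) volume
    = ENNReal.ofReal ((2 * Real.pi)⁻¹) • volume := by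
  have := Real.map_volume_mul_left (a := 2 * Real.pi) (by positivity)
  rwa [abs_of_pos (by positivity)] at this

theorem measurableEmbedding_two_pi : MeasurableEmbedding fun s : ℝ => 2 * Real.pi * s :=
  (Homeomorph.mulLeft₀ (2 * Real.pi) (by positivity)).measurableEmbedding

theorem eLpNorm_scaled (u : ℝ → ℂ) :
    eLpNorm (fun s => u (2 * Real.pi * s)) 2 volume
      = ENNReal.ofReal (Real.sqrt (2 * Real.pi))⁻¹ * eLpNorm u 2 volume := by
  have h := measurableEmbedding_two_pi.eLpNorm_map_measure (g := u) (p := 2) (μ := volume)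
  rw [map_two_pi, eLpNorm_smul_measure_of_ne_top (by norm_num)] at h
  change eLpNorm (u ∘ fun s => 2 * Real.pi * s) 2 volume = _
  rw [← h, smul_eq_mul]
  congr 1
  rw [ENNReal.ofReal_rpow_of_pos (by positivity), Real.sqrt_eq_rpow, ← Real.inv_rpow (by positivity)]
  norm_num

theorem memLp_scaled_iff {u : ℝ → ℂ} :
    MemLp (fun s => u (2 * Real.pi * s)) 2 volume ↔ MemLp u 2 volume := by
  have h := measurableEmbedding_two_pi.memLp_map_measure_iff (g := u) (p := 2) (μ := volume)
  change MemLp (u ∘ fun s => 2 * Real.pi * s) 2 volume ↔ _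
  rw [← h, map_two_pi]
  refine ⟨fun h => ?_, fun h => h.smul_measure (by simp)⟩
  have h2 := h.smul_measure (c := ENNReal.ofReal (2 * Real.pi)) ENNReal.ofReal_ne_top
  rwa [smul_smul, ← ENNReal.ofReal_mul (by positivity),
    mul_inv_cancel₀ (by positivity), ENNReal.ofReal_one, one_smul] at h2

/-- `u` is the `L²` Fourier transform of `g`. -/
def IsFT (g u : ℝ → ℂ) : Prop :=
  ∃ (hg : MemLp g 2 volume) (hu : MemLp (fun s => u (2 * Real.pi * s)) 2 volume),
    𝓕⁻ (hg.toLp g) = hu.toLp fun s => u (2 * Real.pi * s)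

theorem IsFT.left {g u : ℝ → ℂ} (h : IsFT g u) : MemLp g 2 volume := h.1

theorem IsFT.right {g u : ℝ → ℂ} (h : IsFT g u) : MemLp u 2 volume :=
  memLp_scaled_iff.1 h.2.1

theorem isFT_of_ae {g : ℝ → ℂ} (hg : MemLp g 2 volume) {u : ℝ → ℂ}
    (h : (𝓕⁻ (hg.toLp g) : Lp ℂ 2 (volume : Measure ℝ)) =ᵐ[volume] fun s => u (2 * Real.pi * s)) :
    IsFT g u := by
  refine ⟨hg, (memLp_congr_ae h).1 (Lp.memLp _), ?_⟩
  apply Lp.ext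
  exact h.trans (MemLp.coeFn_toLp _).symm

theorem IsFT.congr_right {g u u' : ℝ → ℂ} (h : IsFT g u) (hu : u =ᵐ[volume] u') : IsFT g u' := by
  obtain ⟨h1, h2, h3⟩ := h
  have hq : Measure.QuasiMeasurePreserving (fun s : ℝ => 2 * Real.pi * s) volume volume := by
    refine ⟨measurableEmbedding_two_pi.measurable, ?_⟩
    rw [map_two_pi]
    exact Measure.smul_absolutelyContinuous
  have hu' : (fun s => u (2 * Real.pi * s)) =ᵐ[volume] fun s => u' (2 * Real.pi * s) :=
    hq.ae_eq_comp hu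
  refine isFT_of_ae h1 ?_
  rw [h3]
  exact (MemLp.coeFn_toLp _).trans hu'

theorem IsFT.add {g u g' u' : ℝ → ℂ} (h : IsFT g u) (h' : IsFT g' u') :
    IsFT (fun x => g x + g' x) fun x => u x + u' x := by
  obtain ⟨h1, h2, h3⟩ := h
  obtain ⟨h1', h2', h3'⟩ := h'
  refine ⟨h1.add h1', h2.add h2', ?_⟩
  have e1 : (h1.add h1').toLp (fun x => g x + g' x) = h1.toLp g + h1'.toLp g' := rfl
  have e2 : (h2.add h2').toLp (fun s => u (2 * Real.pi * s) + u' (2 * Real.pi * s))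
    = h2.toLp (fun s => u (2 * Real.pi * s)) + h2'.toLp fun s => u' (2 * Real.pi * s) := rfl
  erw [e1, e2]
  rw [FourierTransform.fourierInv_add, h3, h3']

theorem IsFT.const_mul {g u : ℝ → ℂ} (h : IsFT g u) (c : ℂ) :
    IsFT (fun x => c * g x) fun x => c * u x := by
  obtain ⟨h1, h2, h3⟩ := h
  refine ⟨h1.const_mul c, h2.const_mul c, ?_⟩
  have e1 : (h1.const_mul c).toLp (fun x => c * g x) = c • h1.toLp g := rfl
  have e2 : (h2.const_mul c).toLp (fun s => c * u (2 * Real.pi * s))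
    = c • h2.toLp (fun s => u (2 * Real.pi * s)) := rfl
  rw [e1, e2, FourierTransform.fourierInv_smul, h3]

theorem IsFT.sub {g u g' u' : ℝ → ℂ} (h : IsFT g u) (h' : IsFT g' u') :
    IsFT (fun x => g x - g' x) fun x => u x - u' x := by
  simpa [sub_eq_add_neg] using h.add (h'.const_mul (-1))

theorem norm_fourierInv_lp (f : Lp ℂ 2 (volume : Measure ℝ)) : ‖𝓕⁻ f‖ = ‖f‖ :=
  (Lp.fourierTransformₗᵢ ℝ ℂ).symm.norm_map f

theorem IsFT.eLpNorm_eq {g u : ℝ → ℂ} (h : IsFT g u) :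
    eLpNorm u 2 volume = ENNReal.ofReal (Real.sqrt (2 * Real.pi)) * eLpNorm g 2 volume := by
  obtain ⟨h1, h2, h3⟩ := h
  have hn := norm_fourierInv_lp (h1.toLp g)
  rw [h3, Lp.norm_toLp, Lp.norm_toLp,
    ENNReal.toReal_eq_toReal_iff' h2.2.ne h1.2.ne, eLpNorm_scaled] at hn
  rw [← hn, ← mul_assoc, ← ENNReal.ofReal_mul (by positivity),
    mul_inv_cancel₀ (by positivity), ENNReal.ofReal_one, one_mul]

theorem exists_isFT_left {u : ℝ → ℂ} (hu : MemLp u 2 volume) : ∃ g, IsFT g u := by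
  have hu' := memLp_scaled_iff.2 hu
  refine ⟨(𝓕 (hu'.toLp _) : Lp ℂ 2 (volume : Measure ℝ)), Lp.memLp _, hu', ?_⟩
  rw [Lp.toLp_coeFn]
  exact FourierTransform.fourierInv_fourier_eq _

theorem exists_isFT_right {g : ℝ → ℂ} (hg : MemLp g 2 volume) : ∃ u, IsFT g u := by
  refine ⟨fun t => (𝓕⁻ (hg.toLp g) : Lp ℂ 2 (volume : Measure ℝ)) ((2 * Real.pi)⁻¹ * t),
    isFT_of_ae hg (Eventually.of_forall fun s => ?_)⟩
  simp only
  rw [← mul_assoc, inv_mul_cancel₀ (by positivity), one_mul]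

theorem integral_scaled (u : ℝ → ℂ) :
    ∫ s, u (2 * Real.pi * s) = (2 * Real.pi : ℝ)⁻¹ • ∫ t, u t := by
  rw [Measure.integral_comp_mul_left, abs_of_pos (by positivity)]

/-- Polarised Plancherel. Applied with a Cauchy kernel as second function, it turns Cauchy integrals
into half-line Fourier integrals. -/
theorem IsFT.inner_eq {g u g' u' : ℝ → ℂ} (h : IsFT g u) (h' : IsFT g' u') :
    ∫ t, u t * starRingEnd ℂ (u' t) = 2 * Real.pi * ∫ x, g x * starRingEnd ℂ (g' x) := by
  obtain ⟨h1, h2, h3⟩ := h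
  obtain ⟨h1', h2', h3'⟩ := h'
  have hn : inner ℂ (𝓕⁻ (h1'.toLp g')) (𝓕⁻ (h1.toLp g)) = inner ℂ (h1'.toLp g') (h1.toLp g) :=
    (Lp.fourierTransformₗᵢ ℝ ℂ).symm.inner_map_map _ _
  rw [h3, h3', L2.inner_def, L2.inner_def] at hn
  have e1 : ∫ s, inner ℂ ((h2'.toLp fun s => u' (2 * Real.pi * s)) s)
      ((h2.toLp fun s => u (2 * Real.pi * s)) s)
      = ∫ s, (fun t => u t * starRingEnd ℂ (u' t)) (2 * Real.pi * s) := by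
    refine integral_congr_ae ?_
    filter_upwards [h2.coeFn_toLp, h2'.coeFn_toLp] with s hs hs'
    rw [hs, hs', RCLike.inner_apply]
  have e2 : ∫ x, inner ℂ (h1'.toLp g' x) (h1.toLp g x) = ∫ x, g x * starRingEnd ℂ (g' x) := by
    refine integral_congr_ae ?_
    filter_upwards [h1.coeFn_toLp, h1'.coeFn_toLp] with s hs hs'
    rw [hs, hs', RCLike.inner_apply]
  rw [e1, e2, integral_scaled fun t => u t * starRingEnd ℂ (u' t)] at hn
  rw [← hn, Complex.real_smul]
  push_cast
  have : (Real.pi : ℂ) ≠ 0 := by exact_mod_cast Real.pi_ne_zero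
  field_simp

/-- The multiplication formula for the inverse Fourier integral of an integrable function. -/
theorem integral_fourierInv_smul {g : ℝ → ℂ} (hg : Integrable g) (φ : SchwartzMap ℝ ℂ) :
    ∫ s, φ s • 𝓕⁻ g s = ∫ x, (𝓕⁻ φ : SchwartzMap ℝ ℂ) x • g x := by
  have h := VectorFourier.integral_fourierIntegral_smul_eq_flip (L := -innerₗ ℝ)
    (f := g) (g := (φ : ℝ → ℂ)) (μ := volume) (ν := volume) Real.continuous_fourierChar
    (continuous_inner (𝕜 := ℝ) (E := ℝ)).neg hg φ.integrable
  simp only [smul_eq_mul] at h ⊢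
  calc ∫ s, φ s * 𝓕⁻ g s = ∫ s, 𝓕⁻ g s * φ s := by simp_rw [mul_comm]
    _ = ∫ x, g x * 𝓕⁻ (φ : ℝ → ℂ) x := by
      have h1 : ∀ s, 𝓕⁻ g s = VectorFourier.fourierIntegral 𝐞 volume (-innerₗ ℝ) g s :=
        fun s => rfl
      have h2 : ∀ x, 𝓕⁻ (φ : ℝ → ℂ) x
          = VectorFourier.fourierIntegral 𝐞 volume (-innerₗ ℝ).flip (φ : ℝ → ℂ) x := fun x => by
        simp [Real.fourierInv_eq, VectorFourier.fourierIntegral, mul_comm]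
      simp_rw [h1, h2]
      exact h
    _ = _ := by
      rw [SchwartzMap.fourierInv_coe]
      simp_rw [mul_comm]

theorem continuous_fourierInv {g : ℝ → ℂ} (hg : Integrable g) : Continuous (𝓕⁻ g) := by
  refine VectorFourier.fourierIntegral_continuous (L := -innerₗ ℝ) Real.continuous_fourierChar
    (continuous_inner (𝕜 := ℝ) (E := ℝ)).neg hg

/-- Both transforms agree as tempered distributions, by the multiplication formula tested against
smooth compactly supported functions, and hence almost everywhere. -/
theorem isFT_ft {g : ℝ → ℂ} (hg : Integrable g) (hg2 : MemLp g 2 volume) : IsFT g (ft g) := by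
  refine isFT_of_ae hg2 ?_
  have e : (fun s => ft g (2 * Real.pi * s)) = 𝓕⁻ g := by
    ext s; rw [fourierInv_eq_ft]
  rw [e]
  refine ae_eq_of_integral_contDiff_smul_eq ((Lp.memLp _).locallyIntegrable (by norm_num))
    (continuous_fourierInv hg).locallyIntegrable fun φ hφ hφc => ?_
  have hφ₁ : HasCompactSupport (Complex.ofRealCLM ∘ φ) := hφc.comp_left rfl
  have hφ₂ : ContDiff ℝ ((⊤ : ℕ∞) : WithTop ℕ∞) (Complex.ofRealCLM ∘ φ) := by fun_prop
  set ψ : SchwartzMap ℝ ℂ := hφ₁.toSchwartzMap hφ₂ with hψ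
  have hψx : ∀ x, (ψ x : ℂ) = (φ x : ℂ) := fun x => rfl
  have h1 := integral_fourierInv_smul hg ψ
  have h2 : ∫ x, (ψ x) • (𝓕⁻ (hg2.toLp g) : Lp ℂ 2 (volume : Measure ℝ)) x
      = ∫ x, (𝓕⁻ ψ : SchwartzMap ℝ ℂ) x • (hg2.toLp g) x := by
    have h3 := congrArg (fun T => T ψ) (Lp.fourierInv_toTemperedDistribution_eq (hg2.toLp g))
    simpa [TemperedDistribution.fourierInv_apply] using h3.symm
  have h4 : ∫ x, (𝓕⁻ ψ : SchwartzMap ℝ ℂ) x • (hg2.toLp g) x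
      = ∫ x, (𝓕⁻ ψ : SchwartzMap ℝ ℂ) x • g x := by
    refine integral_congr_ae ?_
    filter_upwards [hg2.coeFn_toLp] with x hx
    rw [hx]
  have h5 := h2.trans (h4.trans h1.symm)
  simpa [hψx] using h5

/-! ### Limits and reflections of L² transforms. -/

theorem tendsto_eLpNorm_sub_of_dominated {g : ℝ → ℂ} {G : ℕ → ℝ → ℂ} (hg : MemLp g 2 volume)
    (hG : ∀ n, AEStronglyMeasurable (G n) volume) (hle : ∀ n x, ‖G n x‖ ≤ ‖g x‖)
    (hlim : ∀ x, Tendsto (fun n => G n x) atTop (𝓝 (g x))) :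
    Tendsto (fun n => eLpNorm (G n - g) 2 volume) atTop (𝓝 0) := by
  have h1 : Tendsto (fun n => ∫⁻ x, ‖(G n - g) x‖ₑ ^ (2:ℝ)) atTop (𝓝 (∫⁻ _ : ℝ, 0)) := by
    refine tendsto_lintegral_of_dominated_convergence' (fun x => ((2:ENNReal) * ‖g x‖ₑ) ^ (2:ℝ))
      (fun n => (((hG n).sub hg.1).enorm).pow_const _) (fun n => Eventually.of_forall fun x => ?_) ?_
      (Eventually.of_forall fun x => ?_)
    · have : ‖(G n - g) x‖ₑ ≤ 2 * ‖g x‖ₑ := by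
        rw [two_mul]
        refine (enorm_sub_le).trans (add_le_add_left ?_ _)
        exact enorm_le_iff_norm_le.2 (hle n x)
      exact ENNReal.rpow_le_rpow this (by norm_num)
    · have h2 := (hg.const_mul (2:ℂ)).2
      rw [eLpNorm_lt_top_iff_lintegral_rpow_enorm_lt_top (by norm_num) (by norm_num)] at h2
      simp only [ENNReal.toReal_ofNat] at h2
      convert h2.ne using 3 with x
      rw [enorm_mul]
      congr 2
      rw [← ofReal_norm]; simp
    · have h3 : Tendsto (fun n => ‖(G n - g) x‖ₑ) atTop (𝓝 ‖g x - g x‖ₑ) :=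
        ((hlim x).sub_const _).enorm
      have := (ENNReal.continuous_rpow_const (y := (2:ℝ))).tendsto _ |>.comp h3
      simpa [Function.comp_def] using this
  simp only [lintegral_zero] at h1
  have h4 := (ENNReal.continuous_rpow_const (y := (1 / 2 : ℝ))).tendsto _ |>.comp h1
  simp only [ENNReal.zero_rpow_of_pos (show (0:ℝ) < 1 / 2 by norm_num)] at h4
  refine h4.congr fun n => ?_
  rw [eLpNorm_eq_lintegral_rpow_enorm_toReal (by norm_num) (by norm_num)]
  simp

/-- By Plancherel the transforms converge in L² to the transform of the limit; an almost everywhere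
convergent subsequence identifies it with the pointwise limit. -/
theorem IsFT.of_tendsto {g u : ℝ → ℂ} {G U : ℕ → ℝ → ℂ} (hg : MemLp g 2 volume)
    (h : ∀ n, IsFT (G n) (U n))
    (hG : Tendsto (fun n => eLpNorm (G n - g) 2 volume) atTop (𝓝 0))
    (hU : ∀ᵐ t, Tendsto (fun n => U n t) atTop (𝓝 (u t))) : IsFT g u := by
  obtain ⟨v, hv⟩ := exists_isFT_right hg
  have h1 : Tendsto (fun n => eLpNorm (U n - v) 2 volume) atTop (𝓝 0) := by
    have : ∀ n, eLpNorm (U n - v) 2 volume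
        = ENNReal.ofReal (Real.sqrt (2 * Real.pi)) * eLpNorm (G n - g) 2 volume :=
      fun n => ((h n).sub hv).eLpNorm_eq
    simp_rw [this]
    have h0 := ENNReal.Tendsto.const_mul (a := ENNReal.ofReal (Real.sqrt (2 * Real.pi))) hG
      (Or.inr ENNReal.ofReal_ne_top)
    rwa [mul_zero] at h0
  obtain ⟨ns, hns, hae⟩ := (tendstoInMeasure_of_tendsto_eLpNorm (by norm_num)
    (fun n => (h n).right.1) hv.right.1 h1).exists_seq_tendsto_ae
  refine hv.congr_right ?_
  filter_upwards [hae, hU] with t h2 h3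
  exact tendsto_nhds_unique h2 (h3.comp hns.tendsto_atTop)

theorem ft_comp_neg (g : ℝ → ℂ) (t : ℝ) : ft (fun x => g (-x)) t = ft g (-t) := by
  unfold ft
  rw [← integral_neg_eq_self fun x : ℝ => g x * Complex.exp (Complex.I * ((-t : ℝ) : ℂ) * x)]
  refine integral_congr_ae (Eventually.of_forall fun x => ?_)
  simp

theorem tendsto_indicator_Icc (g : ℝ → ℂ) (x : ℝ) :
    Tendsto (fun n : ℕ => (Set.Icc (-(n:ℝ)) n).indicator g x) atTop (𝓝 (g x)) := by
  obtain ⟨N, hN⟩ := exists_nat_ge |x|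
  refine tendsto_const_nhds.congr' ?_
  filter_upwards [eventually_ge_atTop N] with n hn
  rw [Set.indicator_of_mem]
  have h := abs_le.1 (hN.trans (Nat.cast_le.2 hn))
  exact ⟨h.1, h.2⟩

/-- For integrable functions this is a change of variables. The general case follows by truncating
to [−n, n] and passing to a subsequence. -/
theorem IsFT.comp_neg {g u : ℝ → ℂ} (h : IsFT g u) :
    IsFT (fun x => g (-x)) fun t => u (-t) := by
  set G : ℕ → ℝ → ℂ := fun n => (Set.Icc (-(n:ℝ)) n).indicator g with hG
  have hG2 : ∀ n, MemLp (G n) 2 volume := fun n => h.left.indicator measurableSet_Icc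
  have hG1 : ∀ n, Integrable (G n) := fun n => by
    rw [hG, integrable_indicator_iff measurableSet_Icc]
    exact (h.left.restrict _).integrable (by norm_num)
  have hle : ∀ n x, ‖G n x‖ ≤ ‖g x‖ := fun n x => norm_indicator_le_norm_self _ _
  have hlim := tendsto_indicator_Icc g
  have hconv := tendsto_eLpNorm_sub_of_dominated h.left (fun n => (hG2 n).1) hle hlim
  have h1 : Tendsto (fun n => eLpNorm (ft (G n) - u) 2 volume) atTop (𝓝 0) := by
    have : ∀ n, eLpNorm (ft (G n) - u) 2 volume
        = ENNReal.ofReal (Real.sqrt (2 * Real.pi)) * eLpNorm (G n - g) 2 volume :=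
      fun n => ((isFT_ft (hG1 n) (hG2 n)).sub h).eLpNorm_eq
    simp_rw [this]
    have h0 := ENNReal.Tendsto.const_mul (a := ENNReal.ofReal (Real.sqrt (2 * Real.pi))) hconv
      (Or.inr ENNReal.ofReal_ne_top)
    rwa [mul_zero] at h0
  obtain ⟨ns, hns, hae⟩ := (tendstoInMeasure_of_tendsto_eLpNorm (by norm_num)
    (fun n => (isFT_ft (hG1 n) (hG2 n)).right.1) h.right.1 h1).exists_seq_tendsto_ae
  have hmp : MeasurePreserving (fun x : ℝ => -x) volume volume := Measure.measurePreserving_neg _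
  have hg' : MemLp (fun x => g (-x)) 2 volume := h.left.comp_measurePreserving hmp
  have hG2' : ∀ n, MemLp (fun x => G n (-x)) 2 volume :=
    fun n => (hG2 n).comp_measurePreserving hmp
  refine IsFT.of_tendsto (G := fun n x => G (ns n) (-x)) (U := fun n t => ft (G (ns n)) (-t)) hg'
    (fun n => ?_) ?_ (hmp.quasiMeasurePreserving.ae hae)
  · have := isFT_ft ((hG1 (ns n)).comp_neg) (hG2' (ns n))
    convert this using 1
    ext t; rw [ft_comp_neg]
  · exact tendsto_eLpNorm_sub_of_dominated hg' (fun n => (hG2' _).1) (fun n x => hle _ _)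
      fun x => (hlim (-x)).comp hns.tendsto_atTop

/-! ## Exponentials on a half-line and the Cauchy kernel -/

/-- `exp (i w x)` on `x > 0`. -/
noncomputable def halfExp (w : ℂ) : ℝ → ℂ :=
  (Set.Ioi (0:ℝ)).indicator fun x => Complex.exp (Complex.I * w * x)

theorem norm_exp_I_mul (w : ℂ) (x : ℝ) :
    ‖Complex.exp (Complex.I * w * x)‖ = Real.exp (-w.im * x) := by
  rw [Complex.norm_exp]
  congr 1
  simp

theorem integrable_halfExp {w : ℂ} (hw : 0 < w.im) : Integrable (halfExp w) := by
  rw [halfExp, integrable_indicator_iff measurableSet_Ioi]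
  exact integrableOn_exp_mul_complex_Ioi (by simpa using hw) 0

theorem memLp_halfExp {w : ℂ} (hw : 0 < w.im) : MemLp (halfExp w) 2 volume := by
  refine (memLp_two_iff_integrable_sq_norm (integrable_halfExp hw).1).2 ?_
  refine (integrable_halfExp (w := 2 * w) (by simpa using hw)).norm.congr ?_
  refine Eventually.of_forall fun x => ?_
  simp only [halfExp, Set.indicator_apply]
  split_ifs
  · rw [norm_exp_I_mul, norm_exp_I_mul, ← Real.exp_nat_mul]
    congr 1
    simp; ring
  · simp

theorem ft_halfExp {w : ℂ} (hw : 0 < w.im) (t : ℝ) : ft (halfExp w) t = Complex.I / (t + w) := by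
  have h1 : ft (halfExp w) t
      = ∫ x in Set.Ioi (0:ℝ), Complex.exp (Complex.I * (t + w) * x) := by
    rw [ft, ← integral_indicator measurableSet_Ioi]
    refine integral_congr_ae (Eventually.of_forall fun x => ?_)
    simp only [halfExp, Set.indicator_apply]
    split_ifs
    · rw [← Complex.exp_add]; congr 1; ring
    · simp
  have hne : (t:ℂ) + w ≠ 0 := fun h => by
    have := congrArg Complex.im h
    simp at this; linarith
  rw [h1, integral_exp_mul_complex_Ioi (by simpa using hw)]
  simp only [Complex.ofReal_zero, mul_zero, Complex.exp_zero]
  field_simp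
  simp

/-- The Cauchy integral along the real line. -/
noncomputable def cauchyInt (u : ℝ → ℂ) (w : ℂ) : ℂ := ∫ t : ℝ, u t / ((t : ℂ) - w)

/-- For Im w > 0 the kernel 1/(t − w) is the complex conjugate of −i times the transform of a
decaying exponential on x > 0. Plancherel therefore picks out the part of the density on x > 0. -/
theorem IsFT.cauchyInt_of_pos {g u : ℝ → ℂ} (h : IsFT g u) {w : ℂ} (hw : 0 < w.im) :
    cauchyInt u w
      = 2 * Real.pi * Complex.I * ∫ x in Set.Ioi (0:ℝ), g x * Complex.exp (Complex.I * w * x) := by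
  have hw' : 0 < (-(starRingEnd ℂ w)).im := by simpa using hw
  have hk := (isFT_ft (integrable_halfExp hw') (memLp_halfExp hw')).const_mul (-Complex.I)
  have := h.inner_eq hk
  have e1 : cauchyInt u w = ∫ t, u t *
      starRingEnd ℂ (-Complex.I * ft (halfExp (-(starRingEnd ℂ w))) t) := by
    refine integral_congr_ae (Eventually.of_forall fun t => ?_)
    simp only [ft_halfExp hw', map_mul, map_neg, Complex.conj_I, div_eq_mul_inv, map_inv₀, map_add,
      Complex.conj_ofReal, Complex.conj_conj]
    rw [← sub_eq_add_neg]
    linear_combination (u t * ((t:ℂ) - w)⁻¹) * Complex.I_mul_I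
  rw [e1, this, mul_assoc (2 * (Real.pi : ℂ)) Complex.I]
  congr 1
  rw [← integral_const_mul, ← integral_indicator measurableSet_Ioi]
  refine integral_congr_ae (Eventually.of_forall fun x => ?_)
  simp only [halfExp, Set.indicator_apply]
  split_ifs
  · rw [map_mul, ← Complex.exp_conj]
    simp only [map_mul, map_neg, Complex.conj_I, Complex.conj_conj, Complex.conj_ofReal, neg_neg]
    ring_nf
  · simp

theorem IsFT.cauchyInt_of_neg {g u : ℝ → ℂ} (h : IsFT g u) {w : ℂ} (hw : w.im < 0) :
    cauchyInt u w
      = -(2 * Real.pi * Complex.I *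
          ∫ x in Set.Iio (0:ℝ), g x * Complex.exp (Complex.I * w * x)) := by
  have h1 := h.comp_neg.cauchyInt_of_pos (w := -w) (by simpa using hw)
  have e1 : cauchyInt u w = -cauchyInt (fun t => u (-t)) (-w) := by
    rw [cauchyInt, cauchyInt, ← integral_neg_eq_self, ← integral_neg]
    refine integral_congr_ae (Eventually.of_forall fun t => ?_)
    simp only [Complex.ofReal_neg]
    rw [← div_neg]
    ring_nf
  have h2 := integral_comp_neg_Ioi (0:ℝ) fun x => g x * Complex.exp (Complex.I * w * x)
  rw [neg_zero] at h2
  rw [e1, h1, ← integral_Iic_eq_integral_Iio, ← h2]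
  simp

/-- The kernel is, up to a constant and a reflection, the transform of a square integrable half-line
exponential. -/
theorem memLp_cauchyKernel {w : ℂ} (hw : w.im ≠ 0) :
    MemLp (fun t : ℝ => 1 / ((t:ℂ) - w)) 2 volume := by
  have key : ∀ w : ℂ, 0 < w.im → MemLp (fun t : ℝ => 1 / ((t:ℂ) + w)) 2 volume := by
    intro w hw
    refine ((isFT_ft (integrable_halfExp hw) (memLp_halfExp hw)).const_mul (-Complex.I)).right.ae_eq
      (Eventually.of_forall fun t => ?_)
    simp only [ft_halfExp hw]
    rw [← mul_div_assoc]; simp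
  rcases lt_or_gt_of_ne hw with h | h
  · simpa [sub_eq_add_neg] using key (-w) (by simpa using h)
  · have h1 := (key w h).comp_measurePreserving (Measure.measurePreserving_neg volume)
    refine (h1.const_mul (-1)).ae_eq (Eventually.of_forall fun t => ?_)
    simp only [Function.comp, Complex.ofReal_neg]
    rw [← neg_sub w, sub_eq_add_neg, add_comm w, one_div, one_div, inv_neg]
    simp

theorem integrable_div_sub {u : ℝ → ℂ} (hu : MemLp u 2 volume) {w : ℂ} (hw : w.im ≠ 0) :
    Integrable fun t : ℝ => u t / ((t:ℂ) - w) := by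
  have := hu.integrable_mul (memLp_cauchyKernel hw)
  refine this.congr (Eventually.of_forall fun t => ?_)
  simp [div_eq_mul_inv]

/-! ## Estimates for Cauchy integrals -/

theorem normSq_ofReal_sub (t : ℝ) (w : ℂ) : ‖(t:ℂ) - w‖ ^ 2 = (t - w.re) ^ 2 + w.im ^ 2 := by
  rw [← Complex.normSq_eq_norm_sq, Complex.normSq_apply]
  simp; ring

theorem abs_im_le_norm_ofReal_sub (t : ℝ) (w : ℂ) : |w.im| ≤ ‖(t:ℂ) - w‖ := by
  simpa using Complex.abs_im_le_norm ((t:ℂ) - w)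

theorem ofReal_sub_ne_zero {w : ℂ} (hw : w.im ≠ 0) (t : ℝ) : (t:ℂ) - w ≠ 0 := by
  rw [← norm_pos_iff]
  exact (abs_pos.2 hw).trans_le (abs_im_le_norm_ofReal_sub t w)

theorem poisson_eq {y : ℝ} (hy : 0 < y) (x t : ℝ) :
    y / ((t - x) ^ 2 + y ^ 2) = y⁻¹ * (1 + ((t - x) / y) ^ 2)⁻¹ := by
  field_simp; ring

theorem integrable_poisson {y : ℝ} (hy : 0 < y) (x : ℝ) :
    Integrable fun t : ℝ => y / ((t - x) ^ 2 + y ^ 2) := by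
  simp_rw [poisson_eq hy]
  exact ((integrable_inv_one_add_sq.comp_div hy.ne').comp_sub_right x).const_mul _

theorem integral_poisson {y : ℝ} (hy : 0 < y) (x : ℝ) :
    ∫ t : ℝ, y / ((t - x) ^ 2 + y ^ 2) = Real.pi := by
  simp_rw [poisson_eq hy]
  rw [integral_const_mul, integral_sub_right_eq_self (fun t : ℝ => (1 + (t / y) ^ 2)⁻¹) x,
    Measure.integral_comp_div (fun t : ℝ => (1 + t ^ 2)⁻¹) y, integral_univ_inv_one_add_sq,
    abs_of_pos hy, smul_eq_mul]
  field_simp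

/-- The difference of the kernels at w and at its conjugate is 2i times the Poisson kernel, whose
total mass is π. -/
theorem norm_cauchyInt_sub_conj_le {u : ℝ → ℂ} (hu : MemLp u 2 volume) {M : ℝ}
    (hM : ∀ t, ‖u t‖ ≤ M) {w : ℂ} (hw : 0 < w.im) :
    ‖cauchyInt u w - cauchyInt u (starRingEnd ℂ w)‖ ≤ 2 * Real.pi * M := by
  have hw' : (starRingEnd ℂ w).im ≠ 0 := by simpa using hw.ne'
  have hM0 : 0 ≤ M := (norm_nonneg _).trans (hM 0)
  rw [cauchyInt, cauchyInt, ← integral_sub (integrable_div_sub hu hw.ne') (integrable_div_sub hu hw')]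
  have hb : ∀ t : ℝ, ‖u t / ((t:ℂ) - w) - u t / ((t:ℂ) - starRingEnd ℂ w)‖
      ≤ 2 * M * (w.im / ((t - w.re) ^ 2 + w.im ^ 2)) := by
    intro t
    have h1 := ofReal_sub_ne_zero hw.ne' t
    have h2 := ofReal_sub_ne_zero hw' t
    have e : u t / ((t:ℂ) - w) - u t / ((t:ℂ) - starRingEnd ℂ w)
        = u t * (w - starRingEnd ℂ w) / (((t:ℂ) - w) * starRingEnd ℂ ((t:ℂ) - w)) := by
      rw [map_sub, Complex.conj_ofReal]
      field_simp
      ring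
    rw [e, Complex.mul_conj, norm_div, norm_mul, Complex.sub_conj, Complex.norm_real,
      Complex.normSq_eq_norm_sq, normSq_ofReal_sub, norm_mul, Complex.norm_real, Complex.norm_I,
      mul_one, Real.norm_of_nonneg (by positivity), Real.norm_of_nonneg (by positivity)]
    rw [← mul_div_assoc]
    refine div_le_div_of_nonneg_right ?_ (by positivity)
    nlinarith [hM t, hw]
  refine (norm_integral_le_of_norm_le ((integrable_poisson hw w.re).const_mul (2 * M))
    (Eventually.of_forall hb)).trans_eq ?_
  rw [integral_const_mul, integral_poisson hw]
  ring

theorem hasDerivAt_cauchyInt {u : ℝ → ℂ} (hu : MemLp u 2 volume) {w : ℂ} (hw : w.im ≠ 0) :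
    HasDerivAt (cauchyInt u) (∫ t : ℝ, u t / ((t:ℂ) - w) ^ 2) w := by
  have hy : 0 < |w.im| := abs_pos.2 hw
  -- On a ball of half the distance to the real axis the kernels at v and w are comparable uniformly
  -- in t, which gives an integrable dominating function.
  have hball : ∀ v ∈ Metric.ball w (|w.im| / 2), ∀ t : ℝ, ‖(t:ℂ) - w‖ ≤ 2 * ‖(t:ℂ) - v‖ := by
    intro v hv t
    have h1 := abs_im_le_norm_ofReal_sub t w
    have h2 : ‖(t:ℂ) - w‖ ≤ ‖(t:ℂ) - v‖ + ‖v - w‖ := by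
      simpa using norm_add_le ((t:ℂ) - v) (v - w)
    rw [Metric.mem_ball, dist_eq_norm] at hv
    linarith
  have hpos : ∀ t : ℝ, 0 < ‖(t:ℂ) - w‖ := fun t => hy.trans_le (abs_im_le_norm_ofReal_sub t w)
  have hmeas : ∀ v : ℂ, ∀ n : ℕ, AEStronglyMeasurable (fun t : ℝ => u t / ((t:ℂ) - v) ^ n) volume :=
    fun v n => hu.1.div₀ (by
      refine Measurable.aestronglyMeasurable ?_
      fun_prop)
  refine (hasDerivAt_integral_of_dominated_loc_of_deriv_le (μ := volume)
    (F := fun (w : ℂ) (t : ℝ) => u t / ((t:ℂ) - w)) (F' := fun w t => u t / ((t:ℂ) - w) ^ 2)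
    (bound := fun t => 4 / |w.im| * ‖u t / ((t:ℂ) - w)‖)
    (Metric.ball_mem_nhds w (half_pos hy)) ?_ (integrable_div_sub hu hw) (hmeas w 2) ?_ ?_ ?_).2
  · exact Eventually.of_forall fun v => by simpa using hmeas v 1
  · refine Eventually.of_forall fun t v hv => ?_
    have h1 := hball v hv t
    have h2 := abs_im_le_norm_ofReal_sub t w
    have h3 := hpos t
    rw [norm_div, norm_div, norm_pow]
    rw [← mul_div_assoc, div_mul_eq_mul_div, div_div, div_le_div_iff₀ (by nlinarith) (by positivity)]
    nlinarith [norm_nonneg (u t), mul_le_mul h2 h3.le, mul_le_mul h1 h1 h3.le (by linarith),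
      mul_nonneg (norm_nonneg (u t)) (mul_nonneg h3.le (sub_nonneg.2 h2)),
      mul_nonneg (norm_nonneg (u t)) (sub_nonneg.2 (mul_le_mul h1 h1 h3.le (by linarith)))]
  · exact (integrable_div_sub hu hw).norm.const_mul _
  · refine Eventually.of_forall fun t v hv => ?_
    have h1 : (t:ℂ) - v ≠ 0 := norm_pos_iff.1 (by linarith [hball v hv t, hpos t])
    have h2 : HasDerivAt (fun v : ℂ => (t:ℂ) - v) (-1) v := by
      simpa using (hasDerivAt_id v).const_sub (t:ℂ)
    have h3 := (h2.inv h1).const_mul (u t)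
    simpa [div_eq_mul_inv] using h3

theorem rpow_neg_mul_rpow_neg_le {p q α β : ℝ} (hp : 0 < p) (hq : 0 < q) (hα : 0 ≤ α)
    (hβ : 0 ≤ β) : p ^ (-α) * q ^ (-β) ≤ p ^ (-(α + β)) + q ^ (-(α + β)) := by
  rcases le_total p q with h | h
  · calc p ^ (-α) * q ^ (-β) ≤ p ^ (-α) * p ^ (-β) := by
          gcongr ?_ * ?_
          exact Real.rpow_le_rpow_of_nonpos hp h (by linarith)
      _ = p ^ (-(α + β)) := by rw [← Real.rpow_add hp]; ring_nf
      _ ≤ _ := le_add_of_nonneg_right (by positivity)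
  · calc p ^ (-α) * q ^ (-β) ≤ q ^ (-α) * q ^ (-β) := by
          gcongr ?_ * ?_
          exact Real.rpow_le_rpow_of_nonpos hq h (by linarith)
      _ = q ^ (-(α + β)) := by rw [← Real.rpow_add hq]; ring_nf
      _ ≤ _ := le_add_of_nonneg_left (by positivity)

/-- Off the real line the kernel is at most a constant times (1 + |t − x|)⁻¹. The inequality 1 + |x|
≤ (1 + |t|)(1 + |t − x|) pulls out the power −r/4 of 1 + |x| and leaves total exponent 1 + r/2 > 1,
so the remaining integral converges uniformly in x. -/
theorem powerDecay_cauchyInt {u : ℝ → ℂ} (hd : PowerDecay u) {δ : ℝ}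
    (hδ : δ ≠ 0) : PowerDecay fun x : ℝ => cauchyInt u (x + δ * Complex.I) := by
  obtain ⟨C, r, hr, hr1, hC, hb⟩ := hd.exists_exponent_le
  set ρ : ℝ := 1 + r / 2 with hρ
  have hint : Integrable fun t : ℝ => (1 + |t|) ^ (-ρ) :=
    integrable_one_add_norm (E := ℝ) (by simp [hρ, hr])
  set K : ℝ := 1 + |δ|⁻¹ with hK
  have hδ' : 0 < |δ| := abs_pos.2 hδ
  refine ⟨C * K * (2 * ∫ t : ℝ, (1 + |t|) ^ (-ρ)), r / 4, by positivity, by linarith, fun x => ?_⟩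
  have hbound : ∀ t : ℝ, ‖u t / ((t:ℂ) - (x + δ * Complex.I))‖
      ≤ C * K * (1 + |x|) ^ (-(r / 4)) * ((1 + |t|) ^ (-ρ) + (1 + |t - x|) ^ (-ρ)) := by
    intro t
    set w : ℂ := x + δ * Complex.I with hw
    have hre : w.re = x := by simp [hw]
    have him : w.im = δ := by simp [hw]
    have h1 : |δ| ≤ ‖(t:ℂ) - w‖ := by simpa [him] using abs_im_le_norm_ofReal_sub t w
    have h2 : |t - x| ≤ ‖(t:ℂ) - w‖ := by simpa [hre] using Complex.abs_re_le_norm ((t:ℂ) - w)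
    have h3 : 1 + |t - x| ≤ K * ‖(t:ℂ) - w‖ := by
      have : 1 ≤ |δ|⁻¹ * ‖(t:ℂ) - w‖ := by
        rw [inv_mul_eq_div, one_le_div hδ']; exact h1
      rw [hK, add_mul, one_mul]; linarith
    have h4 : 0 < ‖(t:ℂ) - w‖ := hδ'.trans_le h1
    have h5 : ‖(t:ℂ) - w‖⁻¹ ≤ K * (1 + |t - x|) ^ (-1 : ℝ) := by
      rw [Real.rpow_neg_one, ← div_eq_mul_inv, le_div_iff₀ (by positivity), inv_mul_eq_div,
        div_le_iff₀ h4]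
      exact h3
    have h6 : 1 + |x| ≤ (1 + |t|) * (1 + |t - x|) := by
      have : |x| ≤ |t| + |t - x| := by
        have := abs_sub_abs_le_abs_sub x t
        rw [abs_sub_comm] at this; linarith
      nlinarith [abs_nonneg t, abs_nonneg (t - x)]
    have h7 : 1 ≤ (1 + |x|) ^ (-(r / 4)) * ((1 + |t|) ^ (r / 4) * (1 + |t - x|) ^ (r / 4)) := by
      rw [← Real.mul_rpow (by positivity) (by positivity), Real.rpow_neg (by positivity),
        inv_mul_eq_div, one_le_div (by positivity)]
      gcongr
    have h8 := rpow_neg_mul_rpow_neg_le (p := 1 + |t|) (q := 1 + |t - x|) (α := r - r / 4)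
      (β := 1 - r / 4) (by positivity) (by positivity) (by linarith) (by linarith)
    rw [show r - r / 4 + (1 - r / 4) = ρ by rw [hρ]; ring] at h8
    have h9 : (1 + |t|) ^ (-r) * (1 + |t - x|) ^ (-1 : ℝ)
        * ((1 + |t|) ^ (r / 4) * (1 + |t - x|) ^ (r / 4))
        = (1 + |t|) ^ (-(r - r / 4)) * (1 + |t - x|) ^ (-(1 - r / 4)) := by
      have e1 : (1 + |t|) ^ (-(r - r / 4)) = (1 + |t|) ^ (-r) * (1 + |t|) ^ (r / 4) := by
        rw [← Real.rpow_add (by positivity)]; ring_nf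
      have e2 : (1 + |t - x|) ^ (-(1 - r / 4))
          = (1 + |t - x|) ^ (-1 : ℝ) * (1 + |t - x|) ^ (r / 4) := by
        rw [← Real.rpow_add (by positivity)]; ring_nf
      rw [e1, e2]; ring
    rw [norm_div, div_eq_mul_inv]
    calc ‖u t‖ * ‖(t:ℂ) - w‖⁻¹ ≤ (C * (1 + |t|) ^ (-r)) * (K * (1 + |t - x|) ^ (-1 : ℝ)) := by
          gcongr
          exact hb r le_rfl t
      _ ≤ (C * (1 + |t|) ^ (-r)) * (K * (1 + |t - x|) ^ (-1 : ℝ)) *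
          ((1 + |x|) ^ (-(r / 4)) * ((1 + |t|) ^ (r / 4) * (1 + |t - x|) ^ (r / 4))) :=
        le_mul_of_one_le_right (by positivity) h7
      _ = C * K * (1 + |x|) ^ (-(r / 4)) * ((1 + |t|) ^ (-r) * (1 + |t - x|) ^ (-1 : ℝ)
        * ((1 + |t|) ^ (r / 4) * (1 + |t - x|) ^ (r / 4))) := by ring
      _ ≤ _ := by
        rw [h9]
        gcongr
  have hint2 : Integrable fun t : ℝ => (1 + |t - x|) ^ (-ρ) := hint.comp_sub_right x
  refine (norm_integral_le_of_norm_le ((hint.add hint2).const_mul _)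
    (Eventually.of_forall hbound)).trans_eq ?_
  rw [integral_const_mul]
  simp only [Pi.add_apply]
  rw [integral_add hint hint2, integral_sub_right_eq_self (fun t : ℝ => (1 + |t|) ^ (-ρ)) x]
  ring

/-- The difference of the kernels at two points of the same line is |x − x'| times a product of two
kernels. By the arithmetic-geometric mean inequality that product is dominated by Poisson kernels,
so the integral is even Lipschitz. -/
theorem holderBdd_cauchyInt {u : ℝ → ℂ} (hu : MemLp u 2 volume) (hh : HolderBdd u)
    (hd : PowerDecay u) {δ : ℝ} (hδ : δ ≠ 0) :
    HolderBdd fun x : ℝ => cauchyInt u (x + δ * Complex.I) := by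
  obtain ⟨D, r, hr, -, -, hD⟩ := (powerDecay_cauchyInt hd hδ).exists_exponent_le
  obtain ⟨M, _, _, _, hM, _⟩ := hh
  have hM0 : 0 ≤ M := (norm_nonneg _).trans (hM 0)
  have hδ' : 0 < |δ| := abs_pos.2 hδ
  refine HolderBdd.of_lipschitz (C := D) (K := M * (|δ|⁻¹ * Real.pi))
    (fun x => by simpa using hD 0 (by linarith) x) fun x x' => ?_
  have him : ∀ x : ℝ, ((x:ℂ) + δ * Complex.I).im = δ := fun x => by simp
  have hre : ∀ x : ℝ, ((x:ℂ) + δ * Complex.I).re = x := fun x => by simp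
  have hne : ∀ x : ℝ, ((x:ℂ) + δ * Complex.I).im ≠ 0 := fun x => by simpa using hδ
  rw [cauchyInt, cauchyInt, ← integral_sub (integrable_div_sub hu (hne x))
    (integrable_div_sub hu (hne x'))]
  set p : ℝ → ℝ → ℝ := fun x t => |δ| / ((t - x) ^ 2 + |δ| ^ 2) with hp
  have hb : ∀ t : ℝ, ‖u t / ((t:ℂ) - (x + δ * Complex.I)) - u t / ((t:ℂ) - (x' + δ * Complex.I))‖
      ≤ M * |x - x'| * |δ|⁻¹ / 2 * (p x t + p x' t) := by
    intro t
    have h1 := ofReal_sub_ne_zero (hne x) t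
    have h2 := ofReal_sub_ne_zero (hne x') t
    have n1 := normSq_ofReal_sub t (x + δ * Complex.I)
    have n2 := normSq_ofReal_sub t (x' + δ * Complex.I)
    rw [hre, him, ← sq_abs δ] at n1 n2
    simp only [hp, ← n1, ← n2]
    set k := ‖(t:ℂ) - (x + δ * Complex.I)‖ with hk
    set k' := ‖(t:ℂ) - (x' + δ * Complex.I)‖ with hk'
    have hk0 : 0 < k := norm_pos_iff.2 h1
    have hk'0 : 0 < k' := norm_pos_iff.2 h2
    have e : u t / ((t:ℂ) - (x + δ * Complex.I)) - u t / ((t:ℂ) - (x' + δ * Complex.I))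
        = u t * ((x - x' : ℝ) : ℂ)
          / (((t:ℂ) - (x + δ * Complex.I)) * ((t:ℂ) - (x' + δ * Complex.I))) := by
      push_cast
      rw [div_sub_div _ _ h1 h2]
      congr 1
      ring
    rw [e, norm_div, norm_mul, norm_mul, Complex.norm_real, Real.norm_eq_abs, ← hk, ← hk']
    have h3 : (k * k')⁻¹ ≤ ((k ^ 2)⁻¹ + (k' ^ 2)⁻¹) / 2 := by
      have := two_mul_le_add_sq k⁻¹ k'⁻¹
      rw [mul_inv]
      simp only [inv_pow] at this
      linarith
    calc ‖u t‖ * |x - x'| / (k * k') = ‖u t‖ * |x - x'| * (k * k')⁻¹ := div_eq_mul_inv _ _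
      _ ≤ M * |x - x'| * (((k ^ 2)⁻¹ + (k' ^ 2)⁻¹) / 2) := by
        gcongr
        exact hM t
      _ = _ := by field_simp
  refine (norm_integral_le_of_norm_le (((integrable_poisson hδ' x).add
    (integrable_poisson hδ' x')).const_mul _) (Eventually.of_forall hb)).trans_eq ?_
  rw [integral_const_mul]
  simp only [Pi.add_apply]
  rw [integral_add (integrable_poisson hδ' x) (integrable_poisson hδ' x'), integral_poisson hδ',
    integral_poisson hδ']
  ring

section

/-! ## Functions on a set of horizontal lines -/

/-- Functions on the union of the lines `Im z ∈ J`: continuous, holomorphic inside, bounded, with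
`L² ∩ Hölder` values on each line and bounded `L²` norms. -/
structure Nice (J : Set ℝ) (F : ℂ → ℂ) : Prop where
  cont : ContinuousOn F (Complex.im ⁻¹' J)
  diff : DifferentiableOn ℂ F (Complex.im ⁻¹' interior J)
  bdd : ∃ M : ℝ, ∀ z : ℂ, z.im ∈ J → ‖F z‖ ≤ M
  lines : ∀ c ∈ J, ClassZero (onLine c F)
  unif : ∃ N : ENNReal, N ≠ ⊤ ∧ ∀ c ∈ J, lineNorm c F ≤ N

/-- Multipliers on the union of the lines `Im z ∈ J`: continuous, holomorphic inside, bounded, with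
Hölder values on each line. -/
structure Multiplier (J : Set ℝ) (F : ℂ → ℂ) : Prop where
  cont : ContinuousOn F (Complex.im ⁻¹' J)
  diff : DifferentiableOn ℂ F (Complex.im ⁻¹' interior J)
  bdd : ∃ M : ℝ, ∀ z : ℂ, z.im ∈ J → ‖F z‖ ≤ M
  lines : ∀ c ∈ J, HolderBdd (onLine c F)

variable {J : Set ℝ} {F G : ℂ → ℂ}

theorem onLine_im (c x : ℝ) : ((x : ℂ) + (c : ℂ) * Complex.I).im = c := by simp

theorem onLine_re (c x : ℝ) : ((x : ℂ) + (c : ℂ) * Complex.I).re = x := by simp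

theorem lineNorm_mul_le {c M : ℝ} (h : ∀ x : ℝ, ‖onLine c F x‖ ≤ M) :
    lineNorm c (fun z => F z * G z) ≤ ENNReal.ofReal M * lineNorm c G := by
  refine eLpNorm_le_mul_eLpNorm_of_ae_le_mul (Eventually.of_forall fun x => ?_) 2
  simp only [onLine, norm_mul]
  exact mul_le_mul_of_nonneg_right (h x) (norm_nonneg _)

theorem Nice.multiplier (h : Nice J F) : Multiplier J F :=
  ⟨h.cont, h.diff, h.bdd, fun c hc => (h.lines c hc).holderBdd⟩

theorem Nice.mono {J' : Set ℝ} (h : Nice J F) (hJ : J' ⊆ J) : Nice J' F :=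
  ⟨h.cont.mono (Set.preimage_mono hJ), h.diff.mono (Set.preimage_mono (interior_mono hJ)),
    h.bdd.imp fun _ hM z hz => hM z (hJ hz), fun c hc => h.lines c (hJ hc),
    h.unif.imp fun _ hN => ⟨hN.1, fun c hc => hN.2 c (hJ hc)⟩⟩

theorem Multiplier.mono {J' : Set ℝ} (h : Multiplier J F) (hJ : J' ⊆ J) : Multiplier J' F :=
  ⟨h.cont.mono (Set.preimage_mono hJ), h.diff.mono (Set.preimage_mono (interior_mono hJ)),
    h.bdd.imp fun _ hM z hz => hM z (hJ hz), fun c hc => h.lines c (hJ hc)⟩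

theorem onLine_congr (h : ∀ z : ℂ, z.im ∈ J → F z = G z) {c : ℝ} (hc : c ∈ J) :
    onLine c F = onLine c G := by
  ext x
  exact h _ (by rwa [onLine_im])

theorem Nice.congr (hF : Nice J F) (h : ∀ z : ℂ, z.im ∈ J → F z = G z) : Nice J G := by
  refine ⟨hF.cont.congr fun z hz => (h z hz).symm,
    hF.diff.congr fun z hz => (h z (interior_subset hz)).symm,
    hF.bdd.imp fun M hM z hz => h z hz ▸ hM z hz, fun c hc => ?_,
    hF.unif.imp fun N hN => ⟨hN.1, fun c hc => ?_⟩⟩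
  · rw [← onLine_congr h hc]; exact hF.lines c hc
  · rw [lineNorm, ← onLine_congr h hc]; exact hN.2 c hc

theorem Multiplier.congr (hF : Multiplier J F) (h : ∀ z : ℂ, z.im ∈ J → F z = G z) :
    Multiplier J G := by
  refine ⟨hF.cont.congr fun z hz => (h z hz).symm,
    hF.diff.congr fun z hz => (h z (interior_subset hz)).symm,
    hF.bdd.imp fun M hM z hz => h z hz ▸ hM z hz, fun c hc => ?_⟩
  rw [← onLine_congr h hc]; exact hF.lines c hc

theorem Multiplier.mul_nice (hF : Multiplier J F) (hG : Nice J G) :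
    Nice J fun z => F z * G z := by
  obtain ⟨M, hM⟩ := hF.bdd
  obtain ⟨M', hM'⟩ := hG.bdd
  obtain ⟨N, hN, hN'⟩ := hG.unif
  refine ⟨hF.cont.mul hG.cont, hF.diff.mul hG.diff, ⟨M * M', fun z hz => ?_⟩,
    fun c hc => (hG.lines c hc).mul_holderBdd (hF.lines c hc),
    ⟨ENNReal.ofReal M * N, ENNReal.mul_ne_top ENNReal.ofReal_ne_top hN, fun c hc => ?_⟩⟩
  · rw [norm_mul]
    exact mul_le_mul (hM z hz) (hM' z hz) (norm_nonneg _) ((norm_nonneg _).trans (hM z hz))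
  · refine (lineNorm_mul_le fun x => hM _ (by rwa [onLine_im])).trans ?_
    gcongr
    exact hN' c hc

theorem Multiplier.mul (hF : Multiplier J F) (hG : Multiplier J G) :
    Multiplier J fun z => F z * G z := by
  obtain ⟨M, hM⟩ := hF.bdd
  obtain ⟨M', hM'⟩ := hG.bdd
  refine ⟨hF.cont.mul hG.cont, hF.diff.mul hG.diff, ⟨M * M', fun z hz => ?_⟩,
    fun c hc => (hF.lines c hc).mul (hG.lines c hc)⟩
  rw [norm_mul]
  exact mul_le_mul (hM z hz) (hM' z hz) (norm_nonneg _) ((norm_nonneg _).trans (hM z hz))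

theorem Multiplier.add (hF : Multiplier J F) (hG : Multiplier J G) :
    Multiplier J fun z => F z + G z := by
  obtain ⟨M, hM⟩ := hF.bdd
  obtain ⟨M', hM'⟩ := hG.bdd
  exact ⟨hF.cont.add hG.cont, hF.diff.add hG.diff,
    ⟨M + M', fun z hz => (norm_add_le _ _).trans (add_le_add (hM z hz) (hM' z hz))⟩,
    fun c hc => (hF.lines c hc).add (hG.lines c hc)⟩

theorem Multiplier.const (J : Set ℝ) (c : ℂ) : Multiplier J fun _ => c :=
  ⟨continuousOn_const, differentiableOn_const c, ⟨‖c‖, fun _ _ => le_rfl⟩,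
    fun _ _ => HolderBdd.const c⟩

theorem Nice.add (hF : Nice J F) (hG : Nice J G) : Nice J fun z => F z + G z := by
  have h := hF.multiplier.add hG.multiplier
  obtain ⟨N, hN, hN'⟩ := hF.unif
  obtain ⟨N', hN1, hN1'⟩ := hG.unif
  refine ⟨h.cont, h.diff, h.bdd, fun c hc => (hF.lines c hc).add (hG.lines c hc),
    ⟨N + N', ENNReal.add_ne_top.2 ⟨hN, hN1⟩, fun c hc => ?_⟩⟩
  refine (eLpNorm_add_le (hF.lines c hc).1.1 (hG.lines c hc).1.1 (by norm_num)).trans ?_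
  exact add_le_add (hN' c hc) (hN1' c hc)

theorem Nice.const_mul (hF : Nice J F) (c : ℂ) : Nice J fun z => c * F z :=
  (Multiplier.const J c).mul_nice hF

theorem Nice.neg (hF : Nice J F) : Nice J fun z => -F z :=
  (hF.const_mul (-1)).congr fun z _ => by ring

theorem Nice.sub (hF : Nice J F) (hG : Nice J G) : Nice J fun z => F z - G z :=
  (hF.add hG.neg).congr fun z _ => by ring

theorem nice_zero (J : Set ℝ) : Nice J fun _ => 0 := by
  refine ⟨continuousOn_const, differentiableOn_const 0, ⟨0, by simp⟩, fun c _ => ?_,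
    ⟨0, by simp, fun c _ => ?_⟩⟩
  · refine classZero_iff.2 ⟨(MemLp.zero' : MemLp (fun _ : ℝ => (0:ℂ)) 2 volume), HolderBdd.const 0, 0, 1, one_pos, le_rfl, ?_⟩
    simp [onLine]
  · have : onLine c (fun _ => (0:ℂ)) = 0 := rfl
    simp [lineNorm, this]

/-- A multiplier dominated by a nice function is nice. -/
theorem Nice.of_le_mul (hG : Nice J G) (hF : Multiplier J F) {K : ℝ}
    (h : ∀ z : ℂ, z.im ∈ J → ‖F z‖ ≤ K * ‖G z‖) : Nice J F := by
  obtain ⟨N, hN, hN'⟩ := hG.unif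
  refine ⟨hF.cont, hF.diff, hF.bdd, fun c hc => (hG.lines c hc).of_le_mul (hF.lines c hc)
    (fun x => h _ (by rwa [onLine_im])), ⟨ENNReal.ofReal K * N,
      ENNReal.mul_ne_top ENNReal.ofReal_ne_top hN, fun c hc => ?_⟩⟩
  refine (eLpNorm_le_mul_eLpNorm_of_ae_le_mul (g := onLine c G)
    (Eventually.of_forall fun x => h _ (by rwa [onLine_im])) 2).trans ?_
  exact mul_le_mul_right (hN' c hc) _

/-! ### Reflection z ↦ −z of functions on lines. -/

theorem onLine_comp_neg (c : ℝ) (F : ℂ → ℂ) (x : ℝ) :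
    onLine c (fun z => F (-z)) x = onLine (-c) F (-x) := by
  simp only [onLine]
  congr 1
  push_cast
  ring

theorem lineNorm_comp_neg {c : ℝ} (h : AEStronglyMeasurable (onLine (-c) F) volume) :
    lineNorm c (fun z => F (-z)) = lineNorm (-c) F := by
  have : onLine c (fun z => F (-z)) = onLine (-c) F ∘ fun x => -x := by
    ext x; exact onLine_comp_neg c F x
  rw [lineNorm, this, eLpNorm_comp_measurePreserving h (Measure.measurePreserving_neg _), lineNorm]

theorem interior_neg_preimage (J : Set ℝ) :
    interior ((fun c : ℝ => -c) ⁻¹' J) = (fun c => -c) ⁻¹' interior J :=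
  ((Homeomorph.neg ℝ).preimage_interior J).symm

theorem Multiplier.comp_neg (h : Multiplier J F) :
    Multiplier ((fun c => -c) ⁻¹' J) fun z => F (-z) := by
  refine ⟨h.cont.comp continuous_neg.continuousOn fun z hz => by simpa using hz,
    ?_, h.bdd.imp fun M hM z hz => hM _ (by simpa using hz), fun c hc => ?_⟩
  · rw [interior_neg_preimage]
    exact h.diff.comp differentiable_neg.differentiableOn fun z hz => by simpa using hz
  · have : onLine c (fun z => F (-z)) = fun x => onLine (-c) F (-x) := by
      ext x; exact onLine_comp_neg c F x
    rw [this]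
    exact (h.lines _ hc).comp_neg

theorem Nice.comp_neg (h : Nice J F) : Nice ((fun c => -c) ⁻¹' J) fun z => F (-z) := by
  have h1 := h.multiplier.comp_neg
  refine ⟨h1.cont, h1.diff, h1.bdd, fun c hc => ?_, h.unif.imp fun N hN => ⟨hN.1, fun c hc => ?_⟩⟩
  · have : onLine c (fun z => F (-z)) = fun x => onLine (-c) F (-x) := by
      ext x; exact onLine_comp_neg c F x
    rw [this]
    exact (h.lines _ hc).comp_neg
  · rw [lineNorm_comp_neg (h.lines _ hc).1.1]
    exact hN.2 _ hc

/-! ### Exponentials of nice functions and of linear functions. -/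

theorem norm_exp_sub_exp_le {M : ℝ} {z w : ℂ} (hz : ‖z‖ ≤ M) (hw : ‖w‖ ≤ M) :
    ‖Complex.exp z - Complex.exp w‖ ≤ Real.exp (3 * M) * ‖z - w‖ := by
  have h1 : Complex.exp z - Complex.exp w = Complex.exp w * (Complex.exp (z - w) - 1) := by
    rw [mul_sub, ← Complex.exp_add]; ring_nf
  have h2 : ‖Complex.exp (z - w) - 1‖ ≤ ‖z - w‖ * Real.exp ‖z - w‖ := by
    simpa using Complex.norm_exp_sub_sum_le_norm_mul_exp (z - w) 1
  have h3 : ‖Complex.exp w‖ ≤ Real.exp M :=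
    (Complex.norm_exp_le_exp_norm w).trans (Real.exp_le_exp.2 hw)
  have h4 : ‖z - w‖ ≤ 2 * M := (norm_sub_le _ _).trans (by linarith)
  rw [h1, norm_mul]
  calc ‖Complex.exp w‖ * ‖Complex.exp (z - w) - 1‖
      ≤ Real.exp M * (‖z - w‖ * Real.exp (2 * M)) := by
        gcongr
        exact h2.trans (by gcongr)
    _ = Real.exp (3 * M) * ‖z - w‖ := by
      rw [show 3 * M = M + 2 * M by ring, Real.exp_add]; ring

theorem Multiplier.exp (h : Multiplier J F) : Multiplier J fun z => Complex.exp (F z) := by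
  obtain ⟨M, hM⟩ := h.bdd
  refine ⟨h.cont.cexp, h.diff.cexp, ⟨Real.exp M, fun z hz =>
    (Complex.norm_exp_le_exp_norm _).trans (Real.exp_le_exp.2 (hM z hz))⟩, fun c hc => ?_⟩
  have hMc : ∀ x, ‖onLine c F x‖ ≤ M := fun x => hM _ (by rwa [onLine_im])
  exact (h.lines c hc).comp_lipschitz (φ := Complex.exp) (M := Real.exp M) (K := Real.exp (3 * M))
    (fun x => (Complex.norm_exp_le_exp_norm _).trans (Real.exp_le_exp.2 (hMc x)))
    fun x y => norm_exp_sub_exp_le (hMc x) (hMc y)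

theorem Nice.exp_sub_one (h : Nice J F) : Nice J fun z => Complex.exp (F z) - 1 := by
  obtain ⟨M, hM⟩ := h.bdd
  refine h.of_le_mul (K := Real.exp (3 * |M|)) ((h.multiplier.exp.add (Multiplier.const J (-1))).congr
    fun z _ => by ring) fun z hz => ?_
  simpa using norm_exp_sub_exp_le ((hM z hz).trans (le_abs_self M)) (w := 0) (by simp)

theorem norm_exp_ofReal_mul_I_sub_le (s t : ℝ) :
    ‖Complex.exp (Complex.I * s) - Complex.exp (Complex.I * t)‖ ≤ |s - t| := by
  have h1 : Complex.exp (Complex.I * s) - Complex.exp (Complex.I * t)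
      = Complex.exp (Complex.I * t) * (Complex.exp (Complex.I * ((s - t : ℝ) : ℂ)) - 1) := by
    rw [mul_sub, ← Complex.exp_add]; push_cast; ring_nf
  rw [h1, norm_mul, mul_comm Complex.I (t:ℂ), Complex.norm_exp_ofReal_mul_I, one_mul]
  exact Real.norm_exp_I_mul_ofReal_sub_one_le

theorem multiplier_exp_I_mul {L m : ℝ} (h : ∀ c ∈ J, m ≤ c * L) :
    Multiplier J fun z => Complex.exp (Complex.I * z * L) := by
  have hn : ∀ z : ℂ, ‖Complex.exp (Complex.I * z * L)‖ = Real.exp (-(z.im * L)) := fun z => by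
    rw [norm_exp_I_mul]; ring_nf
  refine ⟨by fun_prop, by fun_prop, ⟨Real.exp (-m), fun z hz => ?_⟩, fun c hc => ?_⟩
  · rw [hn]; exact Real.exp_le_exp.2 (neg_le_neg (h _ hz))
  · have he : ∀ x : ℝ, onLine c (fun z => Complex.exp (Complex.I * z * L)) x
        = Complex.exp (-(c * L : ℝ)) * Complex.exp (Complex.I * ((L * x : ℝ) : ℂ)) := fun x => by
      rw [onLine, ← Complex.exp_add]
      congr 1
      push_cast
      linear_combination (c * L : ℂ) * Complex.I_mul_I
    refine HolderBdd.of_lipschitz (C := Real.exp (-(c * L))) (K := Real.exp (-(c * L)) * |L|)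
      (fun x => ?_) fun x y => ?_
    · rw [onLine, hn, onLine_im]
    · rw [he, he, ← mul_sub, norm_mul, ← Complex.ofReal_neg, ← Complex.ofReal_exp, Complex.norm_real,
        Real.norm_of_nonneg (Real.exp_pos _).le, mul_assoc]
      refine mul_le_mul_of_nonneg_left ((norm_exp_ofReal_mul_I_sub_le _ _).trans_eq ?_)
        (Real.exp_pos _).le
      rw [← mul_sub, abs_mul]

end

section

variable {a b c : ℝ} {F G : ℂ → ℂ}

/-! ## Plus functions -/

/-- The density on the line `Im z = c` of the plus function with density `f`. -/
noncomputable def plusDensity (f : ℝ → ℂ) (c : ℝ) : ℝ → ℂ :=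
  (Set.Ioi (0:ℝ)).indicator fun x => (Real.exp (-c * x) : ℂ) * f x

theorem memLp_plusDensity_edge {f : ℝ → ℂ}
    (hf : MemLp (fun x : ℝ => (Real.exp (-a * x) : ℂ) * f x) 2 (volume.restrict (Set.Ioi 0))) :
    MemLp (plusDensity f a) 2 volume :=
  (memLp_indicator_iff_restrict measurableSet_Ioi).2 hf

theorem plusDensity_eq (f : ℝ → ℂ) (a c x : ℝ) :
    plusDensity f c x = (Real.exp (-(c - a) * x) : ℂ) * plusDensity f a x := by
  simp only [plusDensity, Set.indicator_apply]
  split_ifs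
  · rw [← mul_assoc, ← Complex.ofReal_mul, ← Real.exp_add]
    congr 3; ring
  · simp

theorem plusDensity_eq_halfExp (f : ℝ → ℂ) (a c x : ℝ) :
    plusDensity f c x = halfExp (((c - a : ℝ) : ℂ) * Complex.I) x * plusDensity f a x := by
  rw [plusDensity_eq f a c]
  simp only [halfExp, plusDensity, Set.indicator_apply]
  split_ifs
  · congr 1
    rw [Complex.ofReal_exp]
    congr 1
    push_cast
    linear_combination (-(c - a) * x : ℂ) * Complex.I_mul_I
  · simp

theorem norm_plusDensity_le (f : ℝ → ℂ) (hc : a ≤ c) (x : ℝ) :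
    ‖plusDensity f c x‖ ≤ ‖plusDensity f a x‖ := by
  by_cases hx : x ∈ Set.Ioi (0:ℝ)
  · rw [plusDensity_eq f a c, norm_mul, Complex.norm_real, Real.norm_of_nonneg (Real.exp_pos _).le]
    refine mul_le_of_le_one_left (norm_nonneg _) (Real.exp_le_one_iff.2 ?_)
    have : (0:ℝ) < x := hx
    nlinarith
  · simp [plusDensity, hx]

theorem memLp_plusDensity {f : ℝ → ℂ} (hf : MemLp (plusDensity f a) 2 volume) (hc : a ≤ c) :
    MemLp (plusDensity f c) 2 volume := by
  refine hf.of_le ?_ (Eventually.of_forall (norm_plusDensity_le f hc))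
  have : plusDensity f c = fun x => (Real.exp (-(c - a) * x) : ℂ) * plusDensity f a x := by
    ext x; exact plusDensity_eq f a c x
  rw [this]
  exact (Continuous.aestronglyMeasurable (by fun_prop)).mul hf.1

/-- Strictly above the edge the density gains a decaying exponential, so it is a product of two
square integrable functions. -/
theorem integrable_plusDensity {f : ℝ → ℂ} (hf : MemLp (plusDensity f a) 2 volume) (hc : a < c) :
    Integrable (plusDensity f c) := by
  have h := (memLp_halfExp (w := ((c - a : ℝ) : ℂ) * Complex.I) (by simpa using hc)).integrable_mul hf
  exact h.congr (Eventually.of_forall fun x => (plusDensity_eq_halfExp f a c x).symm)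

theorem ft_plusDensity (f : ℝ → ℂ) (c t : ℝ) :
    ft (plusDensity f c) t = ∫ x in Set.Ioi (0:ℝ),
      f x * Complex.exp (Complex.I * ((t:ℂ) + (c:ℂ) * Complex.I) * x) := by
  rw [ft, ← integral_indicator measurableSet_Ioi]
  refine integral_congr_ae (Eventually.of_forall fun x => ?_)
  simp only [plusDensity, Set.indicator_apply]
  split_ifs
  · rw [Complex.ofReal_exp, mul_comm (Complex.exp _) (f x), mul_assoc, ← Complex.exp_add]
    congr 2
    push_cast
    linear_combination (-(c:ℂ) * x) * Complex.I_mul_I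
  · simp

theorem integral_plusDensity_mul_exp (f : ℝ → ℂ) (c : ℝ) (z : ℂ) :
    ∫ x in Set.Ioi (0:ℝ), plusDensity f c x * Complex.exp (Complex.I * (z - c * Complex.I) * x)
      = ∫ x in Set.Ioi (0:ℝ), f x * Complex.exp (Complex.I * z * x) := by
  refine setIntegral_congr_fun measurableSet_Ioi fun x hx => ?_
  simp only [plusDensity, Set.indicator_of_mem hx]
  rw [Complex.ofReal_exp, mul_comm (Complex.exp _) (f x), mul_assoc, ← Complex.exp_add]
  congr 2
  push_cast
  linear_combination (-(c:ℂ) * x) * Complex.I_mul_I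

/-- A plus function is on each line the Fourier transform of its damped density. -/
theorem PlusClass.exists_density (hF : PlusClass a F) :
    ∃ f : ℝ → ℂ, MemLp (plusDensity f a) 2 volume ∧
      (∀ c, a ≤ c → IsFT (plusDensity f c) (onLine c F)) ∧
      ∀ z : ℂ, a < z.im → F z = ∫ x in Set.Ioi (0 : ℝ), f x * Complex.exp (Complex.I * z * x) := by
  obtain ⟨f, hf, hz⟩ := hF.fourier
  have hm := memLp_plusDensity_edge hf
  have hin : ∀ c, a < c → IsFT (plusDensity f c) (onLine c F) := by
    intro c hc
    have h := isFT_ft (integrable_plusDensity hm hc) (memLp_plusDensity hm hc.le)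
    convert h using 1
    ext t
    rw [ft_plusDensity, onLine, hz _ (by rwa [onLine_im])]
  refine ⟨f, hm, fun c hc => ?_, hz⟩
  rcases hc.eq_or_lt with rfl | hc
  swap
  · exact hin c hc
  -- On the edge itself the density need not be integrable. Along the lines at height a + 1/(n + 1)
  -- the densities converge in L² and the values converge by continuity of `F`.
  have hδ : ∀ n : ℕ, a < a + 1 / ((n:ℝ) + 1) := fun n => lt_add_of_pos_right _ (by positivity)
  have hlim : Tendsto (fun n : ℕ => a + 1 / ((n:ℝ) + 1)) atTop (𝓝 a) := by
    simpa using tendsto_one_div_add_atTop_nhds_zero_nat.const_add a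
  refine IsFT.of_tendsto (G := fun n : ℕ => plusDensity f (a + 1 / ((n:ℝ) + 1)))
    (U := fun n => onLine (a + 1 / ((n:ℝ) + 1)) F) hm (fun n => hin _ (hδ n))
    (tendsto_eLpNorm_sub_of_dominated hm (fun n => (memLp_plusDensity hm (hδ n).le).1)
      (fun n x => norm_plusDensity_le f (hδ n).le x) fun x => ?_) (Eventually.of_forall fun t => ?_)
  · simp only [plusDensity, Set.indicator_apply]
    split_ifs
    · refine Tendsto.mul_const _ ?_
      have hc : Continuous fun c : ℝ => ((Real.exp (-c * x) : ℝ) : ℂ) := by fun_prop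
      exact (hc.tendsto a).comp hlim
    · exact tendsto_const_nhds
  · have hc : ContinuousOn (fun c : ℝ => onLine c F t) (Set.Ici a) := by
      refine hF.cont.comp (by fun_prop) fun c hc => ?_
      simpa using hc
    refine (hc a Set.self_mem_Ici).tendsto.comp (tendsto_nhdsWithin_iff.2 ⟨hlim, ?_⟩)
    exact Eventually.of_forall fun n => (hδ n).le

theorem PlusClass.cauchy_formula (hF : PlusClass a F) (hc : a ≤ c) {z : ℂ} (hz : c < z.im) :
    cauchyInt (onLine c F) (z - c * Complex.I) = 2 * Real.pi * Complex.I * F z := by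
  obtain ⟨f, hm, hft, hrep⟩ := hF.exists_density
  rw [(hft c hc).cauchyInt_of_pos (by simpa using hz), integral_plusDensity_mul_exp,
    hrep z (hc.trans_lt hz)]

/-- Below the line the Cauchy integral sees only the density on x < 0, which vanishes. -/
theorem PlusClass.cauchyInt_below (hF : PlusClass a F) (hc : a ≤ c) {w : ℂ} (hw : w.im < 0) :
    cauchyInt (onLine c F) w = 0 := by
  obtain ⟨f, hm, hft, hrep⟩ := hF.exists_density
  rw [(hft c hc).cauchyInt_of_neg hw, setIntegral_eq_zero_of_forall_eq_zero, mul_zero, neg_zero]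
  intro x hx
  have : x ∉ Set.Ioi (0:ℝ) := by
    simp only [Set.mem_Iio, Set.mem_Ioi, not_lt] at hx ⊢
    exact hx.le
  simp [plusDensity, this]

theorem PlusClass.lineNorm_le (hF : PlusClass a F) (hc : a ≤ c) :
    lineNorm c F ≤ lineNorm a F := by
  obtain ⟨f, hm, hft, hrep⟩ := hF.exists_density
  rw [lineNorm, lineNorm, (hft c hc).eLpNorm_eq, (hft a le_rfl).eLpNorm_eq]
  exact mul_le_mul_right (eLpNorm_mono (norm_plusDensity_le f hc)) _

/-- Inside the half-plane `F` is the Cauchy integral of its edge values, which gives holomorphy and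
the regularity on each inner line. Since the Cauchy integral at the conjugate point vanishes, `F` is
also a Poisson integral, hence bounded by the supremum on the edge. The L² norms decrease upwards by
Plancherel. -/
theorem PlusClass.nice (hF : PlusClass a F) : Nice (Set.Ici a) F := by
  have hpi : (2 * Real.pi * Complex.I : ℂ) ≠ 0 := by
    simp [Real.pi_ne_zero]
  have hu2 := hF.edge.1
  obtain ⟨-, huh, hud⟩ := classZero_iff.1 hF.edge
  have hrep : ∀ z : ℂ, a < z.im →
      F z = (2 * Real.pi * Complex.I)⁻¹ * cauchyInt (onLine a F) (z - a * Complex.I) := by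
    intro z hz
    rw [hF.cauchy_formula le_rfl hz, inv_mul_cancel_left₀ hpi]
  obtain ⟨M, _, _, _, hM, _⟩ := huh
  have hnorm : ‖(2 * Real.pi * Complex.I : ℂ)‖ = 2 * Real.pi := by
    simp [abs_of_pos Real.pi_pos]
  have hbdd : ∀ z : ℂ, a ≤ z.im → ‖F z‖ ≤ M := by
    intro z hz
    rcases hz.eq_or_lt with h | h
    · have := hM z.re
      rwa [onLine, h, Complex.re_add_im] at this
    · have hw : 0 < (z - a * Complex.I).im := by simpa using h
      have h1 := norm_cauchyInt_sub_conj_le hu2 hM hw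
      rw [hF.cauchy_formula le_rfl h, hF.cauchyInt_below le_rfl (by simpa using h), sub_zero,
        norm_mul, hnorm] at h1
      exact le_of_mul_le_mul_left h1 (by positivity)
  refine ⟨hF.cont, ?_, ⟨M, hbdd⟩, fun c hc => ?_, lineNorm a F, hu2.2.ne,
    fun c hc => hF.lineNorm_le hc⟩
  · rw [interior_Ici]
    intro z hz
    have hz' : a < z.im := hz
    have hw : (z - a * Complex.I).im ≠ 0 := by simpa [sub_eq_zero] using hz'.ne'
    have h1 : DifferentiableAt ℂ (fun z : ℂ =>
        (2 * Real.pi * Complex.I)⁻¹ * cauchyInt (onLine a F) (z - a * Complex.I)) z :=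
      (DifferentiableAt.comp (g := cauchyInt (onLine a F)) (f := fun z : ℂ => z - a * Complex.I) z
        (hasDerivAt_cauchyInt hu2 hw).differentiableAt (by fun_prop)).const_mul _
    refine (h1.congr_of_eventuallyEq ?_).differentiableWithinAt
    filter_upwards [(isOpen_lt continuous_const Complex.continuous_im).mem_nhds hz'] with w hw
    exact hrep w hw
  · rcases (show a ≤ c from hc).eq_or_lt with rfl | hc
    · exact hF.edge
    obtain ⟨f, hm, hft, -⟩ := hF.exists_density
    have hδ : c - a ≠ 0 := sub_ne_zero.2 hc.ne'
    have e : onLine c F = fun x : ℝ => (2 * Real.pi * Complex.I)⁻¹ *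
        cauchyInt (onLine a F) (x + ((c - a : ℝ) : ℂ) * Complex.I) := by
      ext x
      rw [onLine, hrep _ (by rwa [onLine_im])]
      congr 2
      push_cast; ring
    refine classZero_iff.2 ⟨(hft c hc.le).right, ?_, ?_⟩
    · rw [e]
      exact (HolderBdd.const _).mul (holderBdd_cauchyInt hu2 hF.edge.holderBdd hud hδ)
    · rw [e]
      exact (powerDecay_cauchyInt hud hδ).of_le_mul (K := ‖(2 * Real.pi * Complex.I : ℂ)⁻¹‖)
        fun x => (norm_mul _ _).le

/-! ## Reflection -/

/-- Transfers every statement about plus functions to minus functions, so that each is proved on one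
side only. -/
theorem MinusClass.comp_neg (hF : MinusClass b F) : PlusClass (-b) fun z => F (-z) := by
  refine ⟨?_, ?_, ?_⟩
  · have : onLine (-b) (fun z => F (-z)) = fun x => onLine b F (-x) := by
      ext x; rw [onLine_comp_neg, neg_neg]
    rw [this]
    exact hF.edge.comp_neg
  · refine hF.cont.comp continuous_neg.continuousOn fun z hz => ?_
    have : -b ≤ z.im := hz
    simp only [Set.mem_ofPred_eq, Complex.neg_im]
    linarith
  · obtain ⟨f, hf, hrep⟩ := hF.fourier
    refine ⟨fun x => f (-x), ?_, fun z hz => ?_⟩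
    · rw [← memLp_indicator_iff_restrict measurableSet_Ioi]
      rw [← memLp_indicator_iff_restrict measurableSet_Iio] at hf
      convert hf.comp_measurePreserving (Measure.measurePreserving_neg volume) using 1
      ext x
      simp [Set.indicator_apply]
    · rw [hrep (-z) (by simp only [Complex.neg_im]; linarith), ← integral_Iic_eq_integral_Iio]
      have h := integral_comp_neg_Ioi (0:ℝ) fun x => f x * Complex.exp (Complex.I * -z * x)
      rw [neg_zero] at h
      rw [← h]
      simp

theorem PlusClass.comp_neg (hF : PlusClass a F) : MinusClass (-a) fun z => F (-z) := by
  refine ⟨?_, ?_, ?_⟩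
  · have : onLine (-a) (fun z => F (-z)) = fun x => onLine a F (-x) := by
      ext x; rw [onLine_comp_neg, neg_neg]
    rw [this]
    exact hF.edge.comp_neg
  · refine hF.cont.comp continuous_neg.continuousOn fun z hz => ?_
    have : z.im ≤ -a := hz
    simp only [Set.mem_ofPred_eq, Complex.neg_im]
    linarith
  · obtain ⟨f, hf, hrep⟩ := hF.fourier
    refine ⟨fun x => f (-x), ?_, fun z hz => ?_⟩
    · rw [← memLp_indicator_iff_restrict measurableSet_Iio]
      rw [← memLp_indicator_iff_restrict measurableSet_Ioi] at hf
      convert hf.comp_measurePreserving (Measure.measurePreserving_neg volume) using 1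
      ext x
      simp [Set.indicator_apply]
    · rw [hrep (-z) (by simp only [Complex.neg_im]; linarith), ← integral_Iic_eq_integral_Iio]
      have h := integral_comp_neg_Ioi (0:ℝ) fun x => f (-x) * Complex.exp (Complex.I * z * x)
      rw [neg_zero] at h
      rw [← h]
      simp

theorem plusClass_comp_neg_iff : PlusClass (-b) (fun z => F (-z)) ↔ MinusClass b F :=
  ⟨fun h => by simpa using h.comp_neg, fun h => h.comp_neg⟩

theorem neg_preimage_Ici (b : ℝ) : (fun c : ℝ => -c) ⁻¹' Set.Ici (-b) = Set.Iic b := by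
  ext x; simp

theorem neg_preimage_Iic (b : ℝ) : (fun c : ℝ => -c) ⁻¹' Set.Iic b = Set.Ici (-b) := by
  ext x; simp

theorem neg_preimage_Icc (a b : ℝ) :
    (fun c : ℝ => -c) ⁻¹' Set.Icc a b = Set.Icc (-b) (-a) := by
  ext x; simp [and_comm]

theorem MinusClass.nice (hF : MinusClass b F) : Nice (Set.Iic b) F := by
  have := hF.comp_neg.nice.comp_neg
  rw [neg_preimage_Ici] at this
  simpa using this

/-! ## Uniqueness of splittings and projection bounds -/

/-- On each line of the strip, plus and minus functions are orthogonal, so that the norm of each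
part of a sum is at most the norm of the sum. -/
theorem lineNorm_le_add {P M : ℂ → ℂ} (hP : PlusClass a P) (hM : MinusClass b M) (hac : a ≤ c)
    (hcb : c ≤ b) :
    lineNorm c P ≤ lineNorm c (fun z => P z + M z) ∧
      lineNorm c M ≤ lineNorm c fun z => P z + M z := by
  obtain ⟨f, -, hf, -⟩ := hP.exists_density
  obtain ⟨g, -, hg, -⟩ := hM.comp_neg.exists_density
  have h1 := hf c hac
  have h2 := (hg (-c) (neg_le_neg hcb)).comp_neg
  have e : (fun t => onLine (-c) (fun z => M (-z)) (-t)) = onLine c M := by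
    ext t; rw [onLine_comp_neg]; simp
  rw [e] at h2
  have h3 := h1.add h2
  have h4 : onLine c (fun z => P z + M z) = fun x => onLine c P x + onLine c M x := rfl
  -- The two densities live on opposite half-lines, so each is pointwise at most their sum in norm;
  -- Plancherel turns this into the claim.
  rw [lineNorm, lineNorm, lineNorm, h4, h1.eLpNorm_eq, h2.eLpNorm_eq, h3.eLpNorm_eq]
  constructor
  · refine mul_le_mul_right (eLpNorm_mono fun x => ?_) _
    by_cases hx : x ∈ Set.Ioi (0:ℝ)
    · have : -x ∉ Set.Ioi (0:ℝ) := by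
        have : (0:ℝ) < x := hx
        simp only [Set.mem_Ioi, not_lt]; linarith
      simp [plusDensity, this]
    · simp [plusDensity, hx]
  · refine mul_le_mul_right (eLpNorm_mono fun x => ?_) _
    by_cases hx : -x ∈ Set.Ioi (0:ℝ)
    · have : x ∉ Set.Ioi (0:ℝ) := by
        have : (0:ℝ) < -x := hx
        simp only [Set.mem_Ioi, not_lt]; linarith
      simp [plusDensity, this]
    · simp [plusDensity, hx]

/-- A vanishing norm on one line kills the density almost everywhere, hence `P` inside the
half-plane, and by continuity on its edge. -/
theorem PlusClass.eq_zero_of_lineNorm {P : ℂ → ℂ} (hP : PlusClass a P) (hc : a ≤ c)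
    (h : lineNorm c P = 0) : ∀ z : ℂ, a ≤ z.im → P z = 0 := by
  obtain ⟨f, hm, hf, hrep⟩ := hP.exists_density
  have h1 := (hf c hc).eLpNorm_eq
  rw [← lineNorm, h, eq_comm, mul_eq_zero, eLpNorm_eq_zero_iff (hf c hc).left.1 (by norm_num)] at h1
  have h2 : plusDensity f c =ᵐ[volume] 0 := by
    rcases h1 with h1 | h1
    · rw [ENNReal.ofReal_eq_zero] at h1
      exact absurd h1 (not_le.2 (by positivity))
    · exact h1
  have hin : ∀ z : ℂ, a < z.im → P z = 0 := by
    intro z hz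
    rw [hrep z hz, ← integral_plusDensity_mul_exp f c z, ← integral_indicator measurableSet_Ioi]
    refine integral_eq_zero_of_ae ?_
    filter_upwards [h2] with x hx
    simp [Set.indicator_apply, hx]
  intro z hz
  have hcl : z ∈ closure {w : ℂ | a < w.im} := by
    rw [Complex.closure_setOfPred_lt_im]; exact hz
  have hsub : {w : ℂ | a < w.im} ⊆ {w : ℂ | a ≤ w.im} := by
    intro w hw
    simp only [Set.mem_ofPred_eq] at hw ⊢
    exact hw.le
  have hE : Set.EqOn P (fun _ => 0) {w : ℂ | a < w.im} := fun w hw => hin w hw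
  refine hE.of_subset_closure hP.cont continuousOn_const hsub ?_ hz
  rw [Complex.closure_setOfPred_lt_im]

theorem MinusClass.eq_zero_of_lineNorm {M : ℂ → ℂ} (hM : MinusClass b M) (hc : c ≤ b)
    (h : lineNorm c M = 0) : ∀ z : ℂ, z.im ≤ b → M z = 0 := by
  intro z hz
  have h1 := hM.comp_neg.eq_zero_of_lineNorm (c := -c) (neg_le_neg hc) (by
    rw [lineNorm_comp_neg, neg_neg, h]
    rw [neg_neg]; exact (hM.nice.lines c hc).1.1) (-z) (by simpa using hz)
  simpa using h1

theorem lineNorm_eq_zero_of_forall (h : ∀ z : ℂ, z.im = c → F z = 0) : lineNorm c F = 0 := by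
  have : onLine c F = 0 := by
    ext x; exact h _ (onLine_im c x)
  rw [lineNorm, this, eLpNorm_zero]

/-- Uniqueness of the additive splitting, given on one line of the strip. -/
theorem eq_zero_of_add_eq_zero {P M : ℂ → ℂ} (hP : PlusClass a P) (hM : MinusClass b M)
    (hac : a ≤ c) (hcb : c ≤ b) (h : ∀ z : ℂ, z.im = c → P z + M z = 0) :
    (∀ z : ℂ, a ≤ z.im → P z = 0) ∧ ∀ z : ℂ, z.im ≤ b → M z = 0 := by
  have h0 := lineNorm_le_add hP hM hac hcb
  rw [lineNorm_eq_zero_of_forall h, nonpos_iff_eq_zero, nonpos_iff_eq_zero] at h0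
  exact ⟨hP.eq_zero_of_lineNorm hac h0.1, hM.eq_zero_of_lineNorm hcb h0.2⟩

end

section

variable {a b c : ℝ} {F G : ℂ → ℂ}

/-! ## The Cauchy formula in a strip -/

theorem two_pi_I_ne_zero : (2 * Real.pi * Complex.I : ℂ) ≠ 0 := by
  simp [Real.pi_ne_zero]

/-- Cauchy's theorem on the rectangle |Re z| ≤ R; the 1/|Re z| decay makes the two vertical sides
vanish as R → ∞. -/
theorem integral_line_eq_of_decay (hab : a ≤ b) {H : ℂ → ℂ}
    (hc : ContinuousOn H (Complex.im ⁻¹' Set.Icc a b))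
    (hd : DifferentiableOn ℂ H (Complex.im ⁻¹' Set.Ioo a b)) {K x₀ : ℝ}
    (hK : ∀ z : ℂ, z.im ∈ Set.Icc a b → 1 ≤ |z.re - x₀| → ‖H z‖ ≤ K / |z.re - x₀|)
    (ha : Integrable (onLine a H)) (hb : Integrable (onLine b H)) :
    ∫ x, onLine a H x = ∫ x, onLine b H x := by
  have hrect : ∀ R : ℝ, (∫ x : ℝ in (-R)..R, onLine a H x) - (∫ x : ℝ in (-R)..R, onLine b H x)
      = Complex.I * (∫ y : ℝ in a..b, H (((-R : ℝ) : ℂ) + y * Complex.I))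
        - Complex.I * ∫ y : ℝ in a..b, H ((R : ℂ) + y * Complex.I) := by
    intro R
    have h := Complex.integral_boundary_rect_eq_zero_of_continuousOn_of_differentiableOn H
      (((-R : ℝ) : ℂ) + a * Complex.I) ((R : ℂ) + b * Complex.I) ?_ ?_
    · simp only [onLine_im, onLine_re, smul_eq_mul] at h
      simp only [onLine]
      linear_combination h
    · refine hc.mono fun z hz => ?_
      simp only [onLine_im] at hz
      have := hz.2
      rwa [Set.mem_preimage, Set.uIcc_of_le hab] at this
    · refine hd.mono fun z hz => ?_
      simp only [onLine_im, min_eq_left hab, max_eq_right hab] at hz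
      exact hz.2
  have hvert : ∀ s : ℝ, 1 ≤ |s - x₀| →
      ‖∫ y : ℝ in a..b, H ((s : ℂ) + y * Complex.I)‖ ≤ K / |s - x₀| * |b - a| := by
    intro s hs
    refine intervalIntegral.norm_integral_le_of_norm_le_const fun y hy => ?_
    have h1 := hK ((s : ℂ) + y * Complex.I) (by
      rw [onLine_im]
      rw [Set.uIoc_of_le hab] at hy
      exact ⟨hy.1.le, hy.2⟩) (by rwa [onLine_re])
    rwa [onLine_re] at h1
  have hK0 : Tendsto (fun R : ℝ => K / R * |b - a|) atTop (𝓝 0) := by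
    have : Tendsto (fun R : ℝ => K / R) atTop (𝓝 0) := tendsto_const_nhds.div_atTop tendsto_id
    simpa using this.mul_const |b - a|
  have htop : Tendsto (fun R : ℝ => |R - x₀|) atTop atTop :=
    tendsto_abs_atTop_atTop.comp (tendsto_atTop_add_const_right _ _ tendsto_id)
  have hbot : Tendsto (fun R : ℝ => |-R - x₀|) atTop atTop :=
    tendsto_abs_atBot_atTop.comp
      (tendsto_atBot_add_const_right _ (-x₀) tendsto_neg_atTop_atBot)
  have hv1 : Tendsto (fun R : ℝ => ∫ y : ℝ in a..b, H ((R : ℂ) + y * Complex.I)) atTop (𝓝 0) := by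
    refine squeeze_zero_norm' ?_ (hK0.comp htop)
    filter_upwards [htop.eventually_ge_atTop 1] with R hR
    exact hvert R hR
  have hv2 : Tendsto (fun R : ℝ => ∫ y : ℝ in a..b, H (((-R : ℝ) : ℂ) + y * Complex.I)) atTop
      (𝓝 0) := by
    refine squeeze_zero_norm' ?_ (hK0.comp hbot)
    filter_upwards [hbot.eventually_ge_atTop 1] with R hR
    exact hvert (-R) hR
  have hl1 := intervalIntegral_tendsto_integral ha tendsto_neg_atTop_atBot tendsto_id
  have hl2 := intervalIntegral_tendsto_integral hb tendsto_neg_atTop_atBot tendsto_id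
  have h1 := hl1.sub hl2
  have h2 := (hv2.const_mul Complex.I).sub (hv1.const_mul Complex.I)
  rw [mul_zero, sub_zero] at h2
  have h3 := tendsto_nhds_unique (h1.congr fun R => hrect R) h2
  exact sub_eq_zero.1 h3

theorem isFT_cauchyKernel {v : ℂ} (hv : v.im < 0) :
    IsFT (fun x => -Complex.I * halfExp (-v) x) fun t : ℝ => 1 / ((t:ℂ) - v) := by
  have hv' : 0 < (-v).im := by simpa using hv
  refine ((isFT_ft (integrable_halfExp hv') (memLp_halfExp hv')).const_mul
    (-Complex.I)).congr_right (Eventually.of_forall fun t => ?_)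
  simp only [ft_halfExp hv']
  rw [← mul_div_assoc, sub_eq_add_neg]
  simp

theorem cauchyInt_cauchyKernel_of_pos {v w : ℂ} (hv : v.im < 0) (hw : 0 < w.im) :
    cauchyInt (fun t : ℝ => 1 / ((t:ℂ) - v)) w = 2 * Real.pi * Complex.I / (w - v) := by
  have hne : w - v ≠ 0 := fun h => by
    have := congrArg Complex.im h
    simp at this; linarith
  rw [(isFT_cauchyKernel hv).cauchyInt_of_pos hw]
  have e : ∫ x in Set.Ioi (0:ℝ), -Complex.I * halfExp (-v) x * Complex.exp (Complex.I * w * x)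
      = -Complex.I * ∫ x in Set.Ioi (0:ℝ), Complex.exp (Complex.I * (w - v) * x) := by
    rw [← integral_const_mul]
    refine setIntegral_congr_fun measurableSet_Ioi fun x hx => ?_
    simp only [halfExp, Set.indicator_of_mem hx]
    rw [mul_assoc, ← Complex.exp_add]
    congr 2
    ring
  rw [e, integral_exp_mul_complex_Ioi (by simp; linarith)]
  simp only [Complex.ofReal_zero, mul_zero, Complex.exp_zero]
  field_simp

theorem cauchyInt_cauchyKernel_of_neg {v w : ℂ} (hv : v.im < 0) (hw : w.im < 0) :
    cauchyInt (fun t : ℝ => 1 / ((t:ℂ) - v)) w = 0 := by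
  rw [(isFT_cauchyKernel hv).cauchyInt_of_neg hw, setIntegral_eq_zero_of_forall_eq_zero, mul_zero,
    neg_zero]
  intro x hx
  have : x ∉ Set.Ioi (0:ℝ) := by
    simp only [Set.mem_Iio, Set.mem_Ioi, not_lt] at hx ⊢
    exact hx.le
  simp [halfExp, this]

/-- The values of `G` are only bounded and L² on the edges. Dividing by ζ − z supplies both the
decay on the vertical sides and integrability on the lines, after the pole at z has been removed. -/
theorem cauchy_formula_strip (hc : ContinuousOn G (Complex.im ⁻¹' Set.Icc a b))
    (hd : DifferentiableOn ℂ G (Complex.im ⁻¹' Set.Ioo a b)) {M : ℝ}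
    (hM : ∀ z : ℂ, z.im ∈ Set.Icc a b → ‖G z‖ ≤ M) (ha : MemLp (onLine a G) 2 volume)
    (hb : MemLp (onLine b G) 2 volume) {z : ℂ} (hza : a < z.im) (hzb : z.im < b) :
    cauchyInt (onLine a G) (z - a * Complex.I) - cauchyInt (onLine b G) (z - b * Complex.I)
      = 2 * Real.pi * Complex.I * G z := by
  -- A point below the strip. The multiple of 1/(ζ − p) that agrees with `G` at z is subtracted;
  -- unlike a constant it is square integrable on lines, and its Cauchy integrals are explicit.
  set p : ℂ := ((a - 1 : ℝ) : ℂ) * Complex.I with hp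
  have hpim : p.im = a - 1 := by simp [hp]
  have hzp : z - p ≠ 0 := fun h => by
    have := congrArg Complex.im h
    rw [Complex.sub_im, hpim, Complex.zero_im] at this; linarith
  have hζp : ∀ ζ : ℂ, ζ.im ∈ Set.Icc a b → 1 ≤ ‖ζ - p‖ := fun ζ hζ => by
    have h1 := Complex.abs_im_le_norm (ζ - p)
    rw [Complex.sub_im, hpim] at h1
    have h2 := le_abs_self (ζ.im - (a - 1))
    linarith [hζ.1]
  have hζp0 : ∀ ζ : ℂ, ζ.im ∈ Set.Icc a b → ζ - p ≠ 0 := fun ζ hζ =>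
    norm_pos_iff.1 (one_pos.trans_le (hζp ζ hζ))
  set N : ℂ → ℂ := fun ζ => G ζ - G z * ((z - p) / (ζ - p)) with hN
  have hNz : N z = 0 := by simp [hN, div_self hzp]
  have hSopen : IsOpen (Complex.im ⁻¹' Set.Ioo a b) := isOpen_Ioo.preimage Complex.continuous_im
  have hzmem : z ∈ Complex.im ⁻¹' Set.Ioo a b := ⟨hza, hzb⟩
  have hsub : Complex.im ⁻¹' Set.Ioo a b ⊆ Complex.im ⁻¹' Set.Icc a b :=
    Set.preimage_mono Set.Ioo_subset_Icc_self
  have hNc : ContinuousOn N (Complex.im ⁻¹' Set.Icc a b) :=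
    hc.sub (continuousOn_const.mul (continuousOn_const.div (by fun_prop) hζp0))
  have hNd : DifferentiableOn ℂ N (Complex.im ⁻¹' Set.Ioo a b) :=
    hd.sub ((differentiableOn_const _).mul ((differentiableOn_const _).div (by fun_prop)
      fun ζ hζ => hζp0 ζ (hsub hζ)))
  have hnhds := hSopen.mem_nhds hzmem
  -- The quotient N(ζ)/(ζ − z), holomorphic also at z since N vanishes there.
  set H : ℂ → ℂ := dslope N z with hH
  have hHc : ContinuousOn H (Complex.im ⁻¹' Set.Icc a b) :=
    (continuousOn_dslope (mem_of_superset hnhds hsub)).2 ⟨hNc, hNd.differentiableAt hnhds⟩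
  have hHd : DifferentiableOn ℂ H (Complex.im ⁻¹' Set.Ioo a b) :=
    (Complex.differentiableOn_dslope hnhds).2 hNd
  have hHeq : ∀ ζ : ℂ, ζ ≠ z → H ζ = N ζ / (ζ - z) := by
    intro ζ hζ
    rw [hH, dslope_of_ne _ hζ, slope_def_field, hNz, sub_zero]
  have hline : ∀ c : ℝ, c ≠ z.im → ∀ t : ℝ, onLine c H t = onLine c G t / ((t:ℂ) - (z - c * Complex.I))
      - G z * (z - p) * (1 / ((t:ℂ) - (p - c * Complex.I)) / ((t:ℂ) - (z - c * Complex.I))) := by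
    intro c hcz t
    have hne : (t:ℂ) + c * Complex.I ≠ z := fun h => hcz (by rw [← h, onLine_im])
    have h1 : (t:ℂ) + c * Complex.I - z ≠ 0 := sub_ne_zero.2 hne
    rw [onLine, hHeq _ hne, hN, onLine]
    have e1 : (t:ℂ) - (z - c * Complex.I) = (t:ℂ) + c * Complex.I - z := by ring
    have e2 : (t:ℂ) - (p - c * Complex.I) = (t:ℂ) + c * Complex.I - p := by ring
    rw [e1, e2, sub_div]
    ring
  have hwim : ∀ c : ℝ, c ≠ z.im → (z - c * Complex.I).im ≠ 0 := fun c hc => by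
    simpa [sub_eq_zero] using hc.symm
  have hvim : ∀ c : ℝ, a ≤ c → (p - c * Complex.I).im < 0 := fun c hc => by
    have : (p - c * Complex.I).im = a - 1 - c := by simp [hpim]
    rw [this]; linarith
  have hint1 : ∀ c : ℝ, a ≤ c → c ≠ z.im → Integrable fun t : ℝ =>
      1 / ((t:ℂ) - (p - c * Complex.I)) / ((t:ℂ) - (z - c * Complex.I)) := fun c hac hc =>
    integrable_div_sub (memLp_cauchyKernel (hvim c hac).ne) (hwim c hc)
  have hint : ∀ c : ℝ, a ≤ c → c ≠ z.im → MemLp (onLine c G) 2 volume →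
      Integrable (onLine c H) ∧ ∫ t, onLine c H t = cauchyInt (onLine c G) (z - c * Complex.I)
        - G z * (z - p) * cauchyInt (fun t : ℝ => 1 / ((t:ℂ) - (p - c * Complex.I)))
            (z - c * Complex.I) := by
    intro c hac hc hG
    have e : onLine c H = fun t => onLine c G t / ((t:ℂ) - (z - c * Complex.I))
      - G z * (z - p) * (1 / ((t:ℂ) - (p - c * Complex.I)) / ((t:ℂ) - (z - c * Complex.I))) :=
      funext (hline c hc)
    have i1 := integrable_div_sub hG (hwim c hc)
    have i2 := (hint1 c hac hc).const_mul (G z * (z - p))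
    rw [e]
    refine ⟨i1.sub i2, ?_⟩
    rw [integral_sub i1 i2, integral_const_mul]
    rfl
  have hab : a ≤ b := (hza.trans hzb).le
  obtain ⟨ia, ea⟩ := hint a le_rfl hza.ne ha
  obtain ⟨ib, eb⟩ := hint b hab hzb.ne' hb
  have key := integral_line_eq_of_decay hab hHc hHd (K := M + ‖G z‖ * ‖z - p‖) (x₀ := z.re)
    (fun ζ hζ h1 => ?_) ia ib
  · rw [ea, eb, cauchyInt_cauchyKernel_of_pos (hvim a le_rfl) (by simpa using hza),
      cauchyInt_cauchyKernel_of_neg (hvim b hab) (by simpa using hzb), sub_sub_sub_cancel_right,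
      mul_zero, sub_zero] at key
    have e3 : G z * (z - p) * (2 * Real.pi * Complex.I / (z - p)) = 2 * Real.pi * Complex.I * G z := by
      field_simp
    rw [e3] at key
    linear_combination key
  · have hne : ζ ≠ z := by
      rintro rfl
      simp at h1
      linarith
    have h2 : |ζ.re - z.re| ≤ ‖ζ - z‖ := by simpa using Complex.abs_re_le_norm (ζ - z)
    have h3 : 0 < |ζ.re - z.re| := one_pos.trans_le h1
    rw [hHeq ζ hne, norm_div]
    have h4 : ‖N ζ‖ ≤ M + ‖G z‖ * ‖z - p‖ := by
      refine (norm_sub_le _ _).trans (add_le_add (hM ζ hζ) ?_)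
      rw [norm_mul, norm_div]
      gcongr
      exact div_le_self (norm_nonneg _) (hζp ζ hζ)
    exact div_le_div₀ ((norm_nonneg _).trans h4) h4 h3 h2

/-! ## The Paley-Wiener theorem and the additive splitting -/

/-- Cauchy-Schwarz: the squared L² norm of the kernel is the Poisson mass π divided by |Im w|. -/
theorem enorm_cauchyInt_le {u : ℝ → ℂ} (hu : MemLp u 2 volume) {w : ℂ} (hw : w.im ≠ 0) :
    ‖cauchyInt u w‖ₑ ≤ eLpNorm u 2 volume * ENNReal.ofReal (Real.sqrt (Real.pi / |w.im|)) := by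
  have hk := memLp_cauchyKernel hw
  have hw' : 0 < |w.im| := abs_pos.2 hw
  have e1 : eLpNorm (fun t : ℝ => 1 / ((t:ℂ) - w)) 2 volume
      = ENNReal.ofReal (Real.sqrt (Real.pi / |w.im|)) := by
    rw [hk.eLpNorm_eq_integral_rpow_norm (by norm_num) (by norm_num), Real.sqrt_eq_rpow]
    have e2 : ∫ t : ℝ, ‖1 / ((t:ℂ) - w)‖ ^ (2 : ENNReal).toReal = Real.pi / |w.im| := by
      rw [div_eq_inv_mul, ← integral_poisson hw' w.re, ← integral_const_mul]
      refine integral_congr_ae (Eventually.of_forall fun t => ?_)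
      simp only [ENNReal.toReal_ofNat, Real.rpow_ofNat, one_div, norm_inv]
      rw [inv_pow, normSq_ofReal_sub, sq_abs, div_eq_mul_inv, ← mul_assoc,
        inv_mul_cancel₀ hw'.ne', one_mul]
    rw [e2]
    norm_num
  have h1 : ‖cauchyInt u w‖ₑ ≤ ∫⁻ t : ℝ, ‖(u • fun t : ℝ => 1 / ((t:ℂ) - w)) t‖ₑ := by
    have : cauchyInt u w = ∫ t : ℝ, (u • fun t : ℝ => 1 / ((t:ℂ) - w)) t := by
      simp [cauchyInt, div_eq_mul_inv]
    rw [this]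
    exact enorm_integral_le_lintegral_enorm _
  rw [← e1]
  refine h1.trans ?_
  rw [← eLpNorm_one_eq_lintegral_enorm]
  exact eLpNorm_smul_le_mul_eLpNorm (p := 2) (q := 2) (r := 1) hk.1 hu.1

/-- The upper Cauchy integral of an `L²` function is a Fourier integral over `x > 0`. -/
theorem exists_fourier_of_cauchyInt {u : ℝ → ℂ} (hu : MemLp u 2 volume) (a : ℝ) :
    ∃ f : ℝ → ℂ,
      MemLp (fun x : ℝ => (Real.exp (-a * x) : ℂ) * f x) 2 (volume.restrict (Set.Ioi 0)) ∧
      ∀ z : ℂ, a < z.im → (2 * Real.pi * Complex.I)⁻¹ * cauchyInt u (z - a * Complex.I)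
        = ∫ x in Set.Ioi (0 : ℝ), f x * Complex.exp (Complex.I * z * x) := by
  obtain ⟨g, hg⟩ := exists_isFT_left hu
  refine ⟨fun x => (Real.exp (a * x) : ℂ) * g x, ?_, fun z hz => ?_⟩
  · refine (hg.left.restrict _).ae_eq (Eventually.of_forall fun x => ?_)
    simp only
    rw [← mul_assoc, ← Complex.ofReal_mul, ← Real.exp_add]
    simp
  · rw [hg.cauchyInt_of_pos (by simpa using hz), inv_mul_cancel_left₀ two_pi_I_ne_zero]
    refine integral_congr_ae (Eventually.of_forall fun x => ?_)
    simp only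
    rw [Complex.ofReal_exp, mul_comm (Complex.exp (a * x : ℝ)) (g x), mul_assoc (g x),
      ← Complex.exp_add]
    congr 2
    push_cast
    linear_combination (-(a:ℂ) * x) * Complex.I_mul_I

/-- A Paley-Wiener theorem. -/
theorem Nice.plusClass (hF : Nice (Set.Ici a) F) : PlusClass a F := by
  have hedge := hF.lines a Set.self_mem_Ici
  refine ⟨hedge, hF.cont, ?_⟩
  obtain ⟨f, hf, hrep⟩ := exists_fourier_of_cauchyInt hedge.1 a
  refine ⟨f, hf, fun z hz => ?_⟩
  rw [← hrep z hz]
  obtain ⟨M, hM⟩ := hF.bdd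
  obtain ⟨N, hN, hN'⟩ := hF.unif
  have hIci : ∀ b, Set.Icc a b ⊆ Set.Ici a := fun b => Set.Icc_subset_Ici_self
  have hIoo : ∀ b, Set.Ioo a b ⊆ interior (Set.Ici a) := fun b => by
    rw [interior_Ici]; exact Set.Ioo_subset_Ioi_self
  -- The strip formula with variable upper edge. The uniform L² bound makes the integral over that
  -- edge vanish as it moves to infinity.
  have hC : ∀ b, z.im < b → cauchyInt (onLine a F) (z - a * Complex.I)
      - cauchyInt (onLine b F) (z - b * Complex.I) = 2 * Real.pi * Complex.I * F z := fun b hb =>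
    cauchy_formula_strip (hF.cont.mono (Set.preimage_mono (hIci b)))
      (hF.diff.mono (Set.preimage_mono (hIoo b))) (fun z hz => hM z (hIci b hz)) hedge.1
      (hF.lines b (hz.trans hb).le).1 hz hb
  have hlim : Tendsto (fun b : ℝ => cauchyInt (onLine b F) (z - b * Complex.I)) atTop (𝓝 0) := by
    rw [tendsto_zero_iff_enorm_tendsto_zero]
    have h1 : Tendsto (fun b : ℝ => N * ENNReal.ofReal (Real.sqrt (Real.pi / |z.im - b|))) atTop
        (𝓝 0) := by
      have h2 : Tendsto (fun b : ℝ => Real.sqrt (Real.pi / |z.im - b|)) atTop (𝓝 0) := by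
        rw [← Real.sqrt_zero]
        refine (Real.continuous_sqrt.tendsto 0).comp (tendsto_const_nhds.div_atTop ?_)
        exact tendsto_abs_atBot_atTop.comp (tendsto_atBot_add_const_left _ _ tendsto_neg_atTop_atBot)
      have h3 := ENNReal.Tendsto.const_mul (a := N) (ENNReal.tendsto_ofReal h2) (Or.inr hN)
      simpa using h3
    refine tendsto_of_tendsto_of_tendsto_of_le_of_le' tendsto_const_nhds h1
      (Eventually.of_forall fun _ => zero_le) ?_
    filter_upwards [eventually_gt_atTop z.im] with b hb
    have him : (z - b * Complex.I).im = z.im - b := by simp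
    have h4 := enorm_cauchyInt_le (hF.lines b (hz.trans hb).le).1 (w := z - b * Complex.I)
      (by rw [him]; exact (sub_neg.2 hb).ne)
    rw [him] at h4
    refine h4.trans ?_
    gcongr
    exact hN' b (hz.trans hb).le
  have h5 : Tendsto (fun b : ℝ => cauchyInt (onLine a F) (z - a * Complex.I)
      - cauchyInt (onLine b F) (z - b * Complex.I)) atTop
      (𝓝 (cauchyInt (onLine a F) (z - a * Complex.I) - 0)) := hlim.const_sub _
  have h6 := tendsto_nhds_unique (h5.congr' (by
    filter_upwards [eventually_gt_atTop z.im] with b hb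
    exact hC b hb)) tendsto_const_nhds
  rw [sub_zero] at h6
  rw [h6, inv_mul_cancel_left₀ two_pi_I_ne_zero]

theorem plusClass_iff_nice : PlusClass a F ↔ Nice (Set.Ici a) F :=
  ⟨PlusClass.nice, Nice.plusClass⟩

theorem minusClass_iff_nice : MinusClass b F ↔ Nice (Set.Iic b) F := by
  refine ⟨MinusClass.nice, fun h => ?_⟩
  rw [← plusClass_comp_neg_iff, plusClass_iff_nice]
  simpa only [neg_preimage_Iic] using h.comp_neg

theorem cauchyInt_comp_neg (u : ℝ → ℂ) (w : ℂ) :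
    cauchyInt (fun t => u (-t)) w = -cauchyInt u (-w) := by
  rw [cauchyInt, cauchyInt, ← integral_neg_eq_self, ← integral_neg]
  refine integral_congr_ae (Eventually.of_forall fun t => ?_)
  simp only [Complex.ofReal_neg, neg_neg]
  rw [← div_neg]
  ring_nf

theorem memLp_cauchyInt {u : ℝ → ℂ} (hu : MemLp u 2 volume) {δ : ℝ} (hδ : δ ≠ 0) :
    MemLp (fun x : ℝ => cauchyInt u (x + δ * Complex.I)) 2 volume := by
  have key : ∀ {u : ℝ → ℂ}, MemLp u 2 volume → ∀ {δ : ℝ}, 0 < δ →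
      MemLp (fun x : ℝ => cauchyInt u (x + δ * Complex.I)) 2 volume := by
    intro u hu δ hδ
    obtain ⟨g, hg⟩ := exists_isFT_left hu
    have hm : MemLp (plusDensity g 0) 2 volume := by
      refine (hg.left.indicator (measurableSet_Ioi (a := (0:ℝ)))).ae_eq (Eventually.of_forall fun x => ?_)
      simp [plusDensity]
    have h := ((isFT_ft (integrable_plusDensity hm hδ) (memLp_plusDensity hm hδ.le)).const_mul
      (2 * Real.pi * Complex.I)).right
    refine h.ae_eq (Eventually.of_forall fun t => ?_)
    simp only
    rw [ft_plusDensity, hg.cauchyInt_of_pos (by simpa using hδ)]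
  rcases lt_or_gt_of_ne hδ with h | h
  · have h1 := key (hu.comp_measurePreserving (Measure.measurePreserving_neg volume))
      (δ := -δ) (by linarith)
    have h2 := (h1.comp_measurePreserving (Measure.measurePreserving_neg volume)).const_mul (-1)
    refine h2.ae_eq (Eventually.of_forall fun x => ?_)
    have h3 := cauchyInt_comp_neg u (((-x : ℝ) : ℂ) + ((-δ : ℝ) : ℂ) * Complex.I)
    simp only [Function.comp_def]
    rw [h3]
    push_cast
    ring_nf
  · exact key hu h

/-- The part of a strip function that is holomorphic above the line `Im z = a`. -/
noncomputable def upperPart (a b : ℝ) (G : ℂ → ℂ) (z : ℂ) : ℂ :=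
  if a < z.im then (2 * Real.pi * Complex.I)⁻¹ * cauchyInt (onLine a G) (z - a * Complex.I)
  else G z + (2 * Real.pi * Complex.I)⁻¹ * cauchyInt (onLine b G) (z - b * Complex.I)

/-- By the strip formula the two branches agree inside the strip, so the second one continues the
first down to the edge. There it is `G` plus a Cauchy integral at positive distance b − a from its
line, so the edge regularity follows without singular integrals. -/
theorem Nice.plusClass_upperPart (hab : a < b) (hG : Nice (Set.Icc a b) G) :
    PlusClass a (upperPart a b G) := by
  have ha := hG.lines a (Set.left_mem_Icc.2 hab.le)
  have hb := hG.lines b (Set.right_mem_Icc.2 hab.le)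
  obtain ⟨M, hM⟩ := hG.bdd
  obtain ⟨hb2, hbh, hbd⟩ := classZero_iff.1 hb
  have hd := hG.diff
  rw [interior_Icc] at hd
  have hstrip : ∀ z : ℂ, a ≤ z.im → z.im < b → upperPart a b G z
      = G z + (2 * Real.pi * Complex.I)⁻¹ * cauchyInt (onLine b G) (z - b * Complex.I) := by
    intro z hz hzb
    unfold upperPart
    split_ifs with h
    · have h1 := cauchy_formula_strip hG.cont hd hM ha.1 hb.1 h hzb
      rw [sub_eq_iff_eq_add] at h1
      rw [h1, mul_add, inv_mul_cancel_left₀ two_pi_I_ne_zero]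
    · rfl
  have hdiffC : ∀ {c : ℝ}, MemLp (onLine c G) 2 volume → ∀ {z : ℂ}, z.im ≠ c →
      DifferentiableAt ℂ (fun z : ℂ =>
        (2 * Real.pi * Complex.I)⁻¹ * cauchyInt (onLine c G) (z - c * Complex.I)) z := by
    intro c hc z hz
    have hw : (z - c * Complex.I).im ≠ 0 := by simpa [sub_eq_zero] using hz
    exact (DifferentiableAt.comp (g := cauchyInt (onLine c G)) (f := fun z : ℂ => z - c * Complex.I) z
        (hasDerivAt_cauchyInt hc hw).differentiableAt (by fun_prop)).const_mul _
  refine ⟨?_, ?_, ?_⟩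
  · have hδ : a - b ≠ 0 := sub_ne_zero.2 hab.ne
    have e : onLine a (upperPart a b G) = fun x : ℝ => onLine a G x
        + (2 * Real.pi * Complex.I)⁻¹ * cauchyInt (onLine b G) (x + ((a - b : ℝ) : ℂ) * Complex.I) := by
      ext x
      rw [onLine, hstrip _ (onLine_im a x).ge (by rwa [onLine_im])]
      congr 3
      push_cast
      ring
    rw [e]
    refine ha.add (ClassZero.mul_holderBdd (v := fun _ => (2 * Real.pi * Complex.I)⁻¹)
      (classZero_iff.2 ⟨memLp_cauchyInt hb2 hδ, holderBdd_cauchyInt hb2 hbh hbd hδ,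
        powerDecay_cauchyInt hbd hδ⟩) (HolderBdd.const _))
  · intro z hz
    have hz' : a ≤ z.im := hz
    rcases hz'.eq_or_lt with h | h
    · have h1 : ContinuousWithinAt (fun z : ℂ => G z
          + (2 * Real.pi * Complex.I)⁻¹ * cauchyInt (onLine b G) (z - b * Complex.I))
          (Complex.im ⁻¹' Set.Icc a b) z :=
        (hG.cont z ⟨hz', h ▸ hab.le⟩).add
          (hdiffC hb2 (by rw [← h]; exact hab.ne)).continuousAt.continuousWithinAt
      have hmem : {w : ℂ | w.im < b} ∈ 𝓝 z :=
        (isOpen_lt Complex.continuous_im continuous_const).mem_nhds (by rw [Set.mem_ofPred_eq, ← h]; exact hab)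
      have h2 : ContinuousWithinAt (fun z : ℂ => G z
          + (2 * Real.pi * Complex.I)⁻¹ * cauchyInt (onLine b G) (z - b * Complex.I))
          {z : ℂ | a ≤ z.im} z := by
        refine h1.mono_of_mem_nhdsWithin ?_
        filter_upwards [self_mem_nhdsWithin, mem_nhdsWithin_of_mem_nhds hmem] with w hw1 hw2
        exact ⟨hw1, le_of_lt hw2⟩
      refine h2.congr_of_eventuallyEq ?_ (hstrip z hz' (h ▸ hab))
      filter_upwards [self_mem_nhdsWithin, mem_nhdsWithin_of_mem_nhds hmem] with w hw1 hw2
      exact hstrip w hw1 hw2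
    · refine ((hdiffC ha.1 h.ne').continuousAt.congr ?_).continuousWithinAt
      filter_upwards [(isOpen_lt continuous_const Complex.continuous_im).mem_nhds h] with w hw
      unfold upperPart
      rw [if_pos hw]
  · obtain ⟨f, hf, hrep⟩ := exists_fourier_of_cauchyInt ha.1 a
    refine ⟨f, hf, fun z hz => ?_⟩
    rw [← hrep z hz, upperPart, if_pos hz]

/-- The minus part is the upper part of the reflected function, reflected back. Inside the strip the
sum is the Cauchy formula; on either edge the Cauchy integrals cancel and leave `G`. -/
theorem Nice.stripClass (hab : a < b) (hG : Nice (Set.Icc a b) G) : StripClass a b G := by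
  have hG' := hG.comp_neg
  rw [neg_preimage_Icc] at hG'
  have hM := (hG'.plusClass_upperPart (neg_lt_neg hab)).comp_neg
  rw [neg_neg] at hM
  refine ⟨_, _, hG.plusClass_upperPart hab, hM, fun z hza hzb => ?_⟩
  have e : ∀ c : ℝ, cauchyInt (onLine (-c) fun z => G (-z)) (-z - ((-c : ℝ) : ℂ) * Complex.I)
      = -cauchyInt (onLine c G) (z - c * Complex.I) := by
    intro c
    have : onLine (-c) (fun z => G (-z)) = fun x => onLine c G (-x) := by
      ext x; rw [onLine_comp_neg, neg_neg]
    rw [this, cauchyInt_comp_neg]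
    congr 2
    push_cast
    ring
  have hd := hG.diff
  rw [interior_Icc] at hd
  obtain ⟨M, hM⟩ := hG.bdd
  unfold upperPart
  simp only [e, Complex.neg_im, neg_lt_neg_iff, neg_neg]
  split_ifs with h1 h2 h2
  · have h3 := cauchy_formula_strip hG.cont hd hM (hG.lines a (Set.left_mem_Icc.2 hab.le)).1
      (hG.lines b (Set.right_mem_Icc.2 hab.le)).1 h1 h2
    rw [mul_neg, ← sub_eq_add_neg, ← mul_sub, h3, inv_mul_cancel_left₀ two_pi_I_ne_zero]
  · ring
  · ring
  · exact absurd (hza.antisymm (not_lt.1 h1)) (by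
      rintro rfl
      exact h2 hab)

theorem StripClass.nice (hG : StripClass a b G) : Nice (Set.Icc a b) G := by
  obtain ⟨P, M, hP, hM, h⟩ := hG
  refine ((hP.nice.mono Set.Icc_subset_Ici_self).add
    (hM.nice.mono Set.Icc_subset_Iic_self)).congr fun z hz => (h z hz.1 hz.2).symm

end

section

variable {a b c : ℝ} {F G K : ℂ → ℂ}

/-! ## Logarithms of the coefficients -/

theorem PowerDecay.tendsto_cocompact {u : ℝ → ℂ} (h : PowerDecay u) :
    Tendsto u (cocompact ℝ) (𝓝 0) := by
  obtain ⟨C, r, hr, hr1, hb⟩ := h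
  have h1 : Tendsto (fun x : ℝ => C * (1 + |x|) ^ (-r)) (cocompact ℝ) (𝓝 (C * 0)) :=
    ((tendsto_rpow_neg_atTop hr).comp
      (tendsto_atTop_add_const_left _ 1 (tendsto_norm_cocompact_atTop (E := ℝ)))).const_mul C
  rw [mul_zero] at h1
  exact squeeze_zero_norm hb h1

/-- A nice function on a strip decays uniformly at infinity. -/
theorem Nice.exists_decay (hab : a < b) (hF : Nice (Set.Icc a b) F) :
    ∃ C s : ℝ, 0 < s ∧ ∀ z : ℂ, z.im ∈ Set.Icc a b → ‖F z‖ ≤ C * (1 + |z.re|) ^ (-s) := by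
  obtain ⟨C, r, hr, hr1, hC, hCb⟩ :=
    ((classZero_iff.1 (hF.lines a (Set.left_mem_Icc.2 hab.le))).2.2).exists_exponent_le
  obtain ⟨D, t, ht, ht1, hD, hDb⟩ :=
    ((classZero_iff.1 (hF.lines b (Set.right_mem_Icc.2 hab.le))).2.2).exists_exponent_le
  obtain ⟨M, hM⟩ := hF.bdd
  set s := min r t with hs
  have hs0 : 0 < s := lt_min hr ht
  have hs1 : s ≤ 1 := (min_le_left _ _).trans hr1
  set m : ℝ := b - a + 1 with hm
  have hm1 : 1 ≤ m := by linarith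
  set p : ℂ := ((a - 1 : ℝ) : ℂ) * Complex.I with hp
  have hpim : ∀ z : ℂ, (z - p).im = z.im - (a - 1) := fun z => by simp [hp]
  have hpre : ∀ z : ℂ, (z - p).re = z.re := fun z => by simp [hp]
  have hlow : ∀ z : ℂ, z.im ∈ Set.Icc a b → 1 ≤ ‖z - p‖ := fun z hz => by
    have h1 := Complex.abs_im_le_norm (z - p)
    rw [hpim] at h1
    have h2 := le_abs_self (z.im - (a - 1))
    linarith [hz.1]
  have hlow' : ∀ z : ℂ, z.im ∈ Set.Icc a b → (1 + |z.re|) / 2 ≤ ‖z - p‖ := fun z hz => by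
    have h1 := Complex.abs_re_le_norm (z - p)
    rw [hpre] at h1
    linarith [hlow z hz]
  have hup : ∀ z : ℂ, z.im ∈ Set.Icc a b → ‖z - p‖ ≤ m * (1 + |z.re|) := fun z hz => by
    have h1 := Complex.norm_le_abs_re_add_abs_im (z - p)
    rw [hpre, hpim, abs_of_nonneg (by linarith [hz.1] : 0 ≤ z.im - (a - 1))] at h1
    nlinarith [hz.2, abs_nonneg z.re]
  have hslit : ∀ z : ℂ, z.im ∈ Set.Icc a b → z - p ∈ Complex.slitPlane := fun z hz => by
    right
    rw [hpim]; linarith [hz.1]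
  -- Phragmén-Lindelöf is applied to this product: the decay on the two edges makes it bounded
  -- there, hence throughout the strip.
  set W : ℂ → ℂ := fun z => F z * (z - p) ^ (s : ℂ) with hW
  have hWn : ∀ z, ‖W z‖ = ‖F z‖ * ‖z - p‖ ^ s := fun z => by
    rw [hW, norm_mul, Complex.norm_cpow_real]
  have hbd : ∀ {z : ℂ} {E : ℝ}, z.im ∈ Set.Icc a b → 0 ≤ E → ‖F z‖ ≤ E * (1 + |z.re|) ^ (-s) →
      ‖W z‖ ≤ E * m ^ s := by
    intro z E hz hE h
    have h0 : 0 < 1 + |z.re| := by positivity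
    rw [hWn]
    calc ‖F z‖ * ‖z - p‖ ^ s ≤ E * (1 + |z.re|) ^ (-s) * (m * (1 + |z.re|)) ^ s := by
          gcongr
          exact hup z hz
      _ = E * m ^ s := by
        rw [Real.mul_rpow (by linarith) h0.le, Real.rpow_neg h0.le]
        have := (Real.rpow_pos_of_pos h0 s).ne'
        field_simp
  have hE : ∀ z : ℂ, z.im ∈ Set.Icc a b → ‖W z‖ ≤ max C D * m ^ s := by
    intro z hz
    refine PhragmenLindelof.horizontal_strip (a := a) (b := b) (f := W) ⟨?_, ?_⟩ ?_ ?_ ?_ hz.1 hz.2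
    · have hd := hF.diff
      rw [interior_Icc] at hd
      refine hd.mul fun w hw => DifferentiableAt.differentiableWithinAt ?_
      exact DifferentiableAt.cpow_const (by fun_prop) (hslit w ⟨le_of_lt hw.1, le_of_lt hw.2⟩)
    · refine (hF.cont.mul (g := fun z => (z - p) ^ (s : ℂ)) fun w hw =>
        (DifferentiableAt.cpow_const (f := fun z : ℂ => z - p) (x := w) (by fun_prop)
          (hslit w hw)).continuousAt.continuousWithinAt).mono ?_
      exact closure_minimal (Set.preimage_mono Set.Ioo_subset_Icc_self)
        (isClosed_Icc.preimage Complex.continuous_im)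
    · have hba : 0 < b - a := by linarith
      -- Half the critical rate π/(b − a). The product grows at most linearly, far below the double
      -- exponential growth allowed.
      set k : ℝ := Real.pi / (2 * (b - a)) with hk
      have hk0 : 0 < k := by positivity
      refine ⟨k, ?_, 1 / k, ?_⟩
      · rw [hk]
        exact div_lt_div_of_pos_left Real.pi_pos hba (by linarith)
      · refine Asymptotics.IsBigO.of_bound (M * m) ?_
        refine eventually_inf_principal.2 (Eventually.of_forall fun w hw => ?_)
        have hw' : w.im ∈ Set.Icc a b := Set.Ioo_subset_Icc_self hw
        have hM0 : 0 ≤ M := (norm_nonneg _).trans (hM w hw')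
        rw [hWn, Real.norm_of_nonneg (Real.exp_pos _).le]
        calc ‖F w‖ * ‖w - p‖ ^ s ≤ M * ‖w - p‖ ^ (1 : ℝ) := by
              gcongr
              · exact hM w hw'
              · exact hlow w hw'
          _ ≤ M * (m * (1 + |w.re|)) := by
              rw [Real.rpow_one]
              gcongr
              exact hup w hw'
          _ ≤ M * (m * Real.exp (1 / k * Real.exp (k * |w.re|))) := by
              gcongr
              have h1 := Real.add_one_le_exp (1 / k * Real.exp (k * |w.re|))
              have h2 : k * |w.re| ≤ Real.exp (k * |w.re|) := by
                linarith [Real.add_one_le_exp (k * |w.re|)]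
              have h3 : |w.re| ≤ 1 / k * Real.exp (k * |w.re|) := by
                rw [one_div, inv_mul_eq_div, le_div_iff₀ hk0, mul_comm]
                exact h2
              linarith
          _ = _ := by ring
    · intro w hw
      refine hbd (by rw [hw]; exact Set.left_mem_Icc.2 hab.le) (hC.trans (le_max_left _ _)) ?_
      have h1 := hCb s (min_le_left _ _) w.re
      have h2 : (w.re : ℂ) + a * Complex.I = w := by rw [← hw]; exact Complex.re_add_im w
      rw [onLine, h2] at h1
      exact h1.trans (by gcongr; exact le_max_left _ _)
    · intro w hw
      refine hbd (by rw [hw]; exact Set.right_mem_Icc.2 hab.le) (hC.trans (le_max_left _ _)) ?_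
      have h1 := hDb s (min_le_right _ _) w.re
      have h2 : (w.re : ℂ) + b * Complex.I = w := by rw [← hw]; exact Complex.re_add_im w
      rw [onLine, h2] at h1
      exact h1.trans (by gcongr; exact le_max_right _ _)
  refine ⟨max C D * m ^ s * 2 ^ s, s, hs0, fun z hz => ?_⟩
  have h0 : 0 < 1 + |z.re| := by positivity
  have h1 := hE z hz
  rw [hWn] at h1
  have h2 : ((1 + |z.re|) / 2) ^ s ≤ ‖z - p‖ ^ s :=
    Real.rpow_le_rpow (by positivity) (hlow' z hz) hs0.le
  rw [Real.div_rpow h0.le (by norm_num)] at h2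
  rw [Real.rpow_neg h0.le, ← div_eq_mul_inv, le_div_iff₀ (Real.rpow_pos_of_pos h0 s)]
  have h3 : (0:ℝ) < 2 ^ s := by positivity
  calc ‖F z‖ * (1 + |z.re|) ^ s = ‖F z‖ * ((1 + |z.re|) ^ s / 2 ^ s) * 2 ^ s := by field_simp
    _ ≤ ‖F z‖ * ‖z - p‖ ^ s * 2 ^ s := by gcongr
    _ ≤ _ := by gcongr

/-- The function takes values in the discrete set 2πiℤ on a connected set. -/
theorem eqOn_const_of_exp_eq_one {X : Type*} [TopologicalSpace X] {S : Set X}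
    (hS : IsPreconnected S) {h : X → ℂ} (hc : ContinuousOn h S)
    (h1 : ∀ x ∈ S, Complex.exp (h x) = 1) {x y : X} (hx : x ∈ S) (hy : y ∈ S) : h x = h y := by
  have : DiscreteTopology (Set.range ((↑) : ℤ → ℝ)) :=
    (Int.isClosedEmbedding_coe_real.isEmbedding.toHomeomorph.symm.isEmbedding).discreteTopology
  have hT : ∀ z ∈ S, ∃ n : ℤ, h z = n * (2 * Real.pi * Complex.I) := fun z hz =>
    Complex.exp_eq_one_iff.1 (h1 z hz)
  have hmaps : Set.MapsTo (fun z => (h z).im / (2 * Real.pi)) S (Set.range ((↑) : ℤ → ℝ)) := by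
    intro z hz
    obtain ⟨n, hn⟩ := hT z hz
    refine ⟨n, ?_⟩
    simp only [hn]
    have : ((n : ℂ) * (2 * Real.pi * Complex.I)).im = n * (2 * Real.pi) := by simp
    rw [this]
    field_simp
  obtain ⟨k, -, hk⟩ := hS.eqOn_const_of_mapsTo (T := Set.range ((↑) : ℤ → ℝ)) ⟨this⟩
    ((Complex.continuous_im.comp_continuousOn hc).div_const _) hmaps ⟨0, 0, by simp⟩
  obtain ⟨n, hn⟩ := hT x hx
  obtain ⟨m, hm⟩ := hT y hy
  have e := (hk hx).trans (hk hy).symm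
  simp only [Function.comp_apply, hn, hm] at e
  have hi : ∀ n : ℤ, ((n : ℂ) * (2 * Real.pi * Complex.I)).im = n * (2 * Real.pi) := by simp
  rw [hi, hi, div_left_inj' (by positivity), mul_left_inj' (by positivity)] at e
  rw [hn, hm, Int.cast_injective e]

theorem norm_le_two_mul_norm_exp_sub_one {w : ℂ} (hw : ‖w‖ ≤ 1 / 2) :
    ‖w‖ ≤ 2 * ‖Complex.exp w - 1‖ := by
  have h1 := Complex.norm_exp_sub_one_sub_id_le (x := w) (by linarith)
  have h2 : ‖w‖ ≤ ‖Complex.exp w - 1‖ + ‖Complex.exp w - 1 - w‖ := by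
    have := norm_sub_le (Complex.exp w - 1) (Complex.exp w - 1 - w)
    simpa using this
  nlinarith [norm_nonneg w]

/-- A continuous logarithm of a Hölder function is Hölder, if it tends to `0` at infinity. -/
theorem HolderBdd.of_exp {u : ℝ → ℂ} (hu : Continuous u) (h0 : Tendsto u (cocompact ℝ) (𝓝 0))
    {M : ℝ} (hM : ∀ x, ‖u x‖ ≤ M) (h : HolderBdd fun x => Complex.exp (u x)) : HolderBdd u := by
  obtain ⟨C, r, hr, hr1, hb, hh⟩ := h
  have hC : 0 ≤ C := (norm_nonneg _).trans (hb 0)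
  have hM0 : 0 ≤ M := (norm_nonneg _).trans (hM 0)
  -- Within distance δ the increments of `u` are at most 1/2 and can be recovered from their
  -- exponentials with a Lipschitz loss; beyond δ boundedness suffices.
  obtain ⟨δ, hδ, hunif⟩ := Metric.uniformContinuous_iff.1
    (hu.uniformContinuous_of_tendsto_cocompact h0) (1 / 2) (by norm_num)
  refine ⟨M + 2 * (Real.exp M * C) + 2 * M * δ ^ (-r), r, hr, hr1, fun x => ?_, fun x y => ?_⟩
  · have : 0 ≤ 2 * (Real.exp M * C) + 2 * M * δ ^ (-r) := by positivity
    linarith [hM x]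
  · have hp : 0 ≤ |x - y| ^ r := by positivity
    rcases lt_or_ge |x - y| δ with hd | hd
    · have h1 := (hunif (a := x) (b := y) (by rwa [Real.dist_eq])).le
      rw [dist_eq_norm] at h1
      have h2 : Complex.exp (u x - u y) - 1
          = Complex.exp (-u y) * (Complex.exp (u x) - Complex.exp (u y)) := by
        rw [mul_sub, ← Complex.exp_add, ← Complex.exp_add, neg_add_cancel, Complex.exp_zero]
        ring_nf
      have h3 : ‖Complex.exp (-u y)‖ ≤ Real.exp M :=
        (Complex.norm_exp_le_exp_norm _).trans (Real.exp_le_exp.2 (by simpa using hM y))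
      calc ‖u x - u y‖ ≤ 2 * ‖Complex.exp (u x - u y) - 1‖ := norm_le_two_mul_norm_exp_sub_one h1
        _ ≤ 2 * (Real.exp M * (C * |x - y| ^ r)) := by
          rw [h2, norm_mul]
          gcongr
          exact hh x y
        _ = 2 * (Real.exp M * C) * |x - y| ^ r := by ring
        _ ≤ _ := by
          gcongr
          have : 0 ≤ M + 2 * M * δ ^ (-r) := by positivity
          linarith
    · have h1 : 1 ≤ δ ^ (-r) * |x - y| ^ r := by
        rw [Real.rpow_neg hδ.le, inv_mul_eq_div, one_le_div (Real.rpow_pos_of_pos hδ r)]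
        exact Real.rpow_le_rpow hδ.le hd hr.le
      calc ‖u x - u y‖ ≤ 2 * M := (norm_sub_le _ _).trans (by linarith [hM x, hM y])
        _ ≤ 2 * M * (δ ^ (-r) * |x - y| ^ r) := le_mul_of_one_le_right (by positivity) h1
        _ = 2 * M * δ ^ (-r) * |x - y| ^ r := by ring
        _ ≤ _ := by
          gcongr
          have : 0 ≤ M + 2 * (Real.exp M * C) := by positivity
          linarith

/-- A continuous logarithm of a holomorphic function is holomorphic. -/
theorem differentiableAt_of_exp {ℓ : ℂ → ℂ} {z : ℂ} (hc : ContinuousAt ℓ z)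
    (hd : DifferentiableAt ℂ (fun z => Complex.exp (ℓ z)) z) : DifferentiableAt ℂ ℓ z := by
  -- Near z the increment of ℓ has small imaginary part, so the principal logarithm of its
  -- exponential returns it.
  have h1 : DifferentiableAt ℂ (fun w => ℓ z + Complex.log (Complex.exp (ℓ w) * Complex.exp (-ℓ z)))
      z := by
    refine (DifferentiableAt.clog (hd.mul_const _) ?_).const_add _
    rw [← Complex.exp_add, add_neg_cancel, Complex.exp_zero]
    exact Complex.one_mem_slitPlane
  refine h1.congr_of_eventuallyEq ?_
  filter_upwards [hc.eventually (Metric.ball_mem_nhds _ one_pos)] with w hw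
  have h2 : ‖ℓ w - ℓ z‖ < 1 := by rwa [← dist_eq_norm]
  have h3 := (Complex.abs_im_le_norm _).trans_lt h2
  rw [← Complex.exp_add, ← sub_eq_add_neg, Complex.log_exp]
  · ring
  · linarith [(abs_lt.1 h3).1, Real.pi_gt_three]
  · linarith [(abs_lt.1 h3).2, Real.pi_gt_three]

end

section

variable {a b c : ℝ} {F G K : ℂ → ℂ}

/-- A continuous function that is dominated by a nice function outside a bounded set, and whose
exponential is Hölder on every line, is nice. -/
theorem Nice.of_exp_of_le {ℓ : ℂ → ℂ} (hF : Nice (Set.Icc a b) F)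
    (hc : ContinuousOn ℓ (Complex.im ⁻¹' Set.Icc a b))
    (he : ∀ z : ℂ, z.im ∈ Set.Icc a b → Complex.exp (ℓ z) = 1 + F z) {R D : ℝ}
    (hR : ∀ z : ℂ, z.im ∈ Set.Icc a b → R ≤ |z.re| → ‖ℓ z‖ ≤ D * ‖F z‖) :
    Nice (Set.Icc a b) ℓ := by
  obtain ⟨N, hN⟩ := hF.bdd
  obtain ⟨U, hU, hU'⟩ := hF.unif
  obtain ⟨M, hM⟩ := (isCompact_Icc (a := -R) (b := R)).reProdIm (isCompact_Icc (a := a) (b := b))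
    |>.exists_bound_of_continuousOn (hc.mono fun z hz => hz.2)
  have hle : ∀ z : ℂ, z.im ∈ Set.Icc a b →
      ‖ℓ z‖ ≤ |D| * ‖F z‖ + (Set.Icc (-R) R).indicator (fun _ => |M|) z.re := by
    intro z hz
    by_cases hzR : z.re ∈ Set.Icc (-R) R
    · rw [Set.indicator_of_mem hzR]
      have h1 := (hM z ⟨hzR, hz⟩).trans (le_abs_self M)
      have : 0 ≤ |D| * ‖F z‖ := by positivity
      linarith
    · rw [Set.indicator_of_notMem hzR, add_zero]
      refine (hR z hz ?_).trans (by gcongr; exact le_abs_self D)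
      rw [Set.mem_Icc, ← abs_le, not_le] at hzR
      exact hzR.le
  have hind : ∀ x, (Set.Icc (-R) R).indicator (fun _ => |M|) x ≤ |M| := fun x =>
    Set.indicator_le_self' (fun _ _ => abs_nonneg M) x
  have hb : ∀ z : ℂ, z.im ∈ Set.Icc a b → ‖ℓ z‖ ≤ |D| * N + |M| := fun z hz =>
    (hle z hz).trans (add_le_add (by gcongr; exact hN z hz) (hind _))
  -- A constant bump that dominates ℓ on the compact part of the strip, where the comparison with
  -- `F` is not available.
  set j : ℝ → ℂ := (Set.Icc (-R) R).indicator fun _ => ((|M| : ℝ) : ℂ) with hj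
  have hjn : ∀ x, ‖j x‖ = (Set.Icc (-R) R).indicator (fun _ => |M|) x := fun x => by
    rw [hj, norm_indicator_eq_indicator_norm]
    simp
  have hjL : MemLp j 2 volume := memLp_indicator_const 2 measurableSet_Icc _ (Or.inr (by
    rw [Real.volume_Icc]; exact ENNReal.ofReal_ne_top))
  have hjD : PowerDecay j := by
    refine ⟨|M| * (1 + |R|), 1, one_pos, le_rfl, fun x => ?_⟩
    rw [hjn, Real.rpow_neg_one, ← div_eq_mul_inv, le_div_iff₀ (by positivity)]
    by_cases hx : x ∈ Set.Icc (-R) R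
    · rw [Set.indicator_of_mem hx]
      exact mul_le_mul_of_nonneg_left (by linarith [(abs_le.2 hx).trans (le_abs_self R)])
        (abs_nonneg M)
    · rw [Set.indicator_of_notMem hx, zero_mul]; positivity
  have hpt : ∀ c ∈ Set.Icc a b, ∀ x, ‖onLine c ℓ x‖ ≤ |D| * ‖onLine c F x‖ + ‖j x‖ := by
    intro c hc x
    have := hle ((x:ℂ) + c * Complex.I) (by rwa [onLine_im])
    rwa [onLine_re, ← hjn] at this
  have hlc : ∀ c ∈ Set.Icc a b, Continuous (onLine c ℓ) := fun c hcm =>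
    hc.comp_continuous (by fun_prop) fun x => by
      rw [Set.mem_preimage, onLine_im]; exact hcm
  set v : ℝ → ℝ → ℂ := fun c x => ((|D| * ‖onLine c F x‖ : ℝ) : ℂ) with hv
  have hvn : ∀ c x, ‖v c x‖ = |D| * ‖onLine c F x‖ := fun c x => by
    rw [hv]
    simp
  have hdec : ∀ c ∈ Set.Icc a b, PowerDecay (onLine c ℓ) := by
    intro c hc
    have h1 : PowerDecay (v c) := (classZero_iff.1 (hF.lines c hc)).2.2.of_le_mul (K := |D|)
      fun x => (hvn c x).le
    have h2 : PowerDecay fun x => ((‖j x‖ : ℝ) : ℂ) := hjD.of_le_mul (K := 1) fun x => by simp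
    refine (h1.add h2).of_le_mul (K := 1) fun x => ?_
    rw [one_mul]
    refine (hpt c hc x).trans (le_of_eq ?_)
    rw [hv]
    simp only
    rw [← Complex.ofReal_add, Complex.norm_real, Real.norm_of_nonneg (by positivity)]
  have hLp : ∀ c ∈ Set.Icc a b, lineNorm c ℓ ≤ ENNReal.ofReal |D| * U + eLpNorm j 2 volume := by
    intro c hc
    have h1 : AEStronglyMeasurable (fun x => |D| * ‖onLine c F x‖) volume :=
      (hF.lines c hc).1.1.norm.const_mul _
    have h2 : lineNorm c ℓ ≤ eLpNorm ((fun x => |D| * ‖onLine c F x‖) + fun x => ‖j x‖) 2 volume :=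
      eLpNorm_mono_real (hpt c hc)
    refine h2.trans ((eLpNorm_add_le h1 hjL.1.norm (by norm_num)).trans ?_)
    rw [eLpNorm_norm]
    refine add_le_add_left ?_ _
    refine (eLpNorm_le_mul_eLpNorm_of_ae_le_mul (g := onLine c F) (c := |D|)
      (Eventually.of_forall fun x => ?_) 2).trans (mul_le_mul_right (hU' c hc) _)
    rw [Real.norm_of_nonneg (by positivity)]
  have hfin : ENNReal.ofReal |D| * U + eLpNorm j 2 volume ≠ ⊤ :=
    ENNReal.add_ne_top.2 ⟨ENNReal.mul_ne_top ENNReal.ofReal_ne_top hU, hjL.2.ne⟩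
  refine ⟨hc, fun z hz => ?_, ⟨_, hb⟩, fun c hcm => ?_, ⟨_, hfin, hLp⟩⟩
  · have hnh : Complex.im ⁻¹' interior (Set.Icc a b) ∈ 𝓝 z :=
      (isOpen_interior.preimage Complex.continuous_im).mem_nhds hz
    have hd : DifferentiableAt ℂ (fun z => Complex.exp (ℓ z)) z := by
      refine ((hF.diff.differentiableAt hnh).const_add 1).congr_of_eventuallyEq ?_
      filter_upwards [hnh] with w hw
      exact he w (interior_subset hw)
    exact (differentiableAt_of_exp (hc.continuousAt
      (mem_of_superset hnh (Set.preimage_mono interior_subset))) hd).differentiableWithinAt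
  · refine classZero_iff.2 ⟨⟨(hlc c hcm).aestronglyMeasurable,
      lt_of_le_of_lt (hLp c hcm) (lt_top_iff_ne_top.2 hfin)⟩, ?_, hdec c hcm⟩
    refine HolderBdd.of_exp (hlc c hcm) (hdec c hcm).tendsto_cocompact (M := |D| * N + |M|)
      (fun x => hb _ (by rwa [onLine_im])) ?_
    have e : (fun x => Complex.exp (onLine c ℓ x)) = fun x => 1 + onLine c F x := by
      ext x
      exact he _ (by rwa [onLine_im])
    rw [e]
    exact (HolderBdd.const 1).add (hF.lines c hcm).holderBdd

theorem exists_continuousOn_log (hab : a ≤ b) (hc : ContinuousOn K (Complex.im ⁻¹' Set.Icc a b))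
    (hne : ∀ z : ℂ, z.im ∈ Set.Icc a b → K z ≠ 0) :
    ∃ ℓ : ℂ → ℂ, ContinuousOn ℓ (Complex.im ⁻¹' Set.Icc a b) ∧
      ∀ z : ℂ, z.im ∈ Set.Icc a b → Complex.exp (ℓ z) = K z := by
  -- The retraction of the plane onto the closed strip; it extends `K` without zeros to a simply
  -- connected open set.
  set r : ℂ → ℂ := fun z => (z.re : ℂ) + ((max a (min b z.im) : ℝ) : ℂ) * Complex.I with hr
  have hrc : Continuous r := by fun_prop
  have hrm : ∀ z, (r z).im ∈ Set.Icc a b := fun z => by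
    rw [hr, onLine_im]
    exact ⟨le_max_left _ _, max_le hab (min_le_left _ _)⟩
  have hre : ∀ z : ℂ, z.im ∈ Set.Icc a b → r z = z := fun z hz => by
    rw [hr]
    simp only [min_eq_right hz.2, max_eq_right hz.1]
    exact Complex.re_add_im z
  have hsc : IsSimplyConnected (Set.univ : Set ℂ) := by
    have : ContractibleSpace (Set.univ : Set ℂ) :=
      (convex_univ (𝕜 := ℝ) (E := ℂ)).contractibleSpace Set.univ_nonempty
    exact SimplyConnectedSpace.ofContractible _
  obtain ⟨f, hf, hfe⟩ := Complex.exists_continuousOn_eqOn_exp_comp hsc isOpen_univ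
    (g := fun z => K (r z)) (hc.comp_continuous hrc hrm).continuousOn (by
      rintro ⟨z, -, hz⟩
      exact hne _ (hrm z) hz)
  refine ⟨f, hf.mono (Set.subset_univ _), fun z hz => ?_⟩
  have := hfe (Set.mem_univ z)
  simp only [Function.comp_apply, hre z hz] at this
  exact this

/-- The imaginary part of any continuous logarithm differs from the given argument by a constant.
Index zero means that the argument has the same limit at both ends, so the logarithm has a single
limit at infinity. -/
theorem HasIndex.tendsto_log {k u : ℝ → ℂ} (h : HasIndex k 0) (hu : Continuous u)
    (he : ∀ t, Complex.exp (u t) = k t) (hk : Tendsto k (cocompact ℝ) (𝓝 1)) :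
    ∃ w : ℂ, Complex.exp w = 1 ∧ Tendsto u (cocompact ℝ) (𝓝 w) := by
  obtain ⟨θ, hθ, hkθ, m, p, hm, hp, hmp⟩ := h
  rw [Int.cast_zero, mul_zero, sub_eq_zero] at hmp
  have hn : ∀ t, ‖k t‖ = Real.exp (u t).re := fun t => by rw [← he, Complex.norm_exp]
  have h1 : ∀ t, Complex.exp ((((u t).im - θ t : ℝ) : ℂ) * Complex.I) = 1 := by
    intro t
    have e1 := hkθ t
    rw [hn, ← he] at e1
    have e2 : Complex.exp (u t) = (Real.exp (u t).re : ℂ) * Complex.exp ((u t).im * Complex.I) := by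
      rw [Complex.ofReal_exp, ← Complex.exp_add, Complex.re_add_im]
    rw [e2] at e1
    have e3 := mul_left_cancel₀ (Complex.ofReal_ne_zero.2 (Real.exp_pos _).ne') e1
    rw [Complex.ofReal_sub, sub_mul, Complex.exp_sub, e3, div_self (Complex.exp_ne_zero _)]
  have h2 : ∀ t, (u t).im = θ t + ((u 0).im - θ 0) := by
    intro t
    have h3 := eqOn_const_of_exp_eq_one isPreconnected_univ
      (h := fun t : ℝ => (((u t).im - θ t : ℝ) : ℂ) * Complex.I) (by fun_prop) (fun t _ => h1 t)
      (Set.mem_univ t) (Set.mem_univ 0)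
    have h4 := Complex.ofReal_injective (mul_right_cancel₀ Complex.I_ne_zero h3)
    linarith
  have hθc : Tendsto θ (cocompact ℝ) (𝓝 p) := by
    rw [cocompact_eq_atBot_atTop]
    exact (hmp ▸ hm).sup hp
  have him : Tendsto (fun t => (u t).im) (cocompact ℝ) (𝓝 (p + ((u 0).im - θ 0))) :=
    (hθc.add_const _).congr fun t => (h2 t).symm
  have hre : Tendsto (fun t => (u t).re) (cocompact ℝ) (𝓝 0) := by
    have h5 : Tendsto (fun t => Real.log ‖k t‖) (cocompact ℝ) (𝓝 (Real.log ‖(1:ℂ)‖)) :=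
      hk.norm.log (by simp)
    rw [norm_one, Real.log_one] at h5
    refine h5.congr fun t => ?_
    rw [hn, Real.log_exp]
  have hlim : Tendsto u (cocompact ℝ) (𝓝 (((0:ℝ) : ℂ) + (p + ((u 0).im - θ 0) : ℝ) * Complex.I)) := by
    refine (((Complex.continuous_ofReal.tendsto _).comp hre).add
      (((Complex.continuous_ofReal.tendsto _).comp him).mul_const Complex.I)).congr fun t => ?_
    exact Complex.re_add_im _
  refine ⟨_, ?_, hlim⟩
  have h6 := ((Complex.continuous_exp.tendsto _).comp hlim).congr fun t => (he t)
  exact tendsto_nhds_unique h6 hk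

/-- Coefficients have a logarithm in the class of the strip. -/
theorem Coefficient.exists_log (ha : a < 0) (hb : 0 < b) (hK : Coefficient a b K) :
    ∃ ℓ : ℂ → ℂ, Nice (Set.Icc a b) ℓ ∧ ∀ z : ℂ, z.im ∈ Set.Icc a b → K z = Complex.exp (ℓ z) := by
  have hF := hK.mem.nice
  have hKc : ContinuousOn K (Complex.im ⁻¹' Set.Icc a b) :=
    (hF.cont.add (continuousOn_const (c := (1:ℂ)))).congr fun z _ => (sub_add_cancel _ _).symm
  obtain ⟨ℓ, hℓ, hℓe⟩ := exists_continuousOn_log (ha.trans hb).le hKc fun z hz => hK.ne z hz.1 hz.2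
  have h0 : (0:ℝ) ∈ Set.Icc a b := ⟨ha.le, hb.le⟩
  have hreal : ∀ t : ℝ, (t:ℂ).im ∈ Set.Icc a b := fun t => by rwa [Complex.ofReal_im]
  have hk : Tendsto (fun t : ℝ => K t) (cocompact ℝ) (𝓝 1) := by
    have := (classZero_iff.1 (hF.lines 0 h0)).2.2.tendsto_cocompact.add_const 1
    rw [zero_add] at this
    refine this.congr fun t => ?_
    simp [onLine]
  obtain ⟨w, hw, hlim⟩ := hK.index.tendsto_log (u := fun t : ℝ => ℓ t)
    (hℓ.comp_continuous Complex.continuous_ofReal hreal) (fun t => hℓe t (hreal t)) hk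
  have hwe : ∀ z : ℂ, z.im ∈ Set.Icc a b → Complex.exp (ℓ z - w) = K z := fun z hz => by
    rw [Complex.exp_sub, hw, div_one, hℓe z hz]
  obtain ⟨C, s, hs, hdec⟩ := hF.exists_decay (ha.trans hb)
  obtain ⟨R, hR0, hR⟩ : ∃ R : ℝ, 0 ≤ R ∧ ∀ z : ℂ, z.im ∈ Set.Icc a b → R ≤ |z.re| →
      ‖K z - 1‖ ≤ 1 / 2 := by
    have h1 : Tendsto (fun r : ℝ => C * (1 + r) ^ (-s)) atTop (𝓝 (C * 0)) :=
      ((tendsto_rpow_neg_atTop hs).comp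
        (tendsto_atTop_add_const_left _ 1 tendsto_id)).const_mul C
    rw [mul_zero] at h1
    obtain ⟨R, hR⟩ := ((h1.eventually (gt_mem_nhds (by norm_num : (0:ℝ) < 1 / 2))).and
      (eventually_ge_atTop 0)).exists_forall_of_atTop
    exact ⟨R, (hR R le_rfl).2, fun z hz hzR => (hdec z hz).trans (hR _ hzR).1.le⟩
  have hslit : ∀ z : ℂ, z.im ∈ Set.Icc a b → R ≤ |z.re| → K z ∈ Complex.slitPlane := by
    intro z hz hzR
    have h1 := (Complex.abs_re_le_norm _).trans (hR z hz hzR)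
    rw [Complex.sub_re, Complex.one_re, abs_le] at h1
    left
    linarith [h1.1]
  -- On each half-strip with |Re z| ≥ R, the functions ℓ − w and log K differ by a constant, and the
  -- constant is 0 because both tend to 0 along the real line. Index zero lets one w serve both
  -- ends.
  have hlog : ∀ S : Set ℂ, Convex ℝ S → (∀ z ∈ S, z.im ∈ Set.Icc a b ∧ R ≤ |z.re|) →
      ∀ l : Filter ℝ, l.NeBot → l ≤ cocompact ℝ → (∀ᶠ t : ℝ in l, (t:ℂ) ∈ S) →
      ∀ z ∈ S, ℓ z - w = Complex.log (K z) := by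
    intro S hS hSm l hl hlc hlS z hz
    have hcont : ContinuousOn (fun z => ℓ z - w - Complex.log (K z)) S :=
      ((hℓ.mono fun z hz => (hSm z hz).1).sub continuousOn_const).sub
        ((hKc.mono fun z hz => (hSm z hz).1).clog fun z hz => hslit z (hSm z hz).1 (hSm z hz).2)
    have hexp : ∀ z ∈ S, Complex.exp (ℓ z - w - Complex.log (K z)) = 1 := fun z hz => by
      have hne := hK.ne z (hSm z hz).1.1 (hSm z hz).1.2
      rw [Complex.exp_sub, hwe z (hSm z hz).1, Complex.exp_log hne, div_self hne]
    have hl1 : Tendsto (fun t : ℝ => ℓ t - w - Complex.log (K t)) l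
        (𝓝 (w - w - Complex.log 1)) :=
      ((hlim.mono_left hlc).sub_const w).sub ((hk.mono_left hlc).clog Complex.one_mem_slitPlane)
    rw [sub_self, Complex.log_one, sub_zero] at hl1
    have hl2 : Tendsto (fun t : ℝ => ℓ t - w - Complex.log (K t)) l
        (𝓝 (ℓ z - w - Complex.log (K z))) := by
      refine tendsto_const_nhds.congr' ?_
      filter_upwards [hlS] with t ht
      exact eqOn_const_of_exp_eq_one hS.isPreconnected hcont hexp hz ht
    exact sub_eq_zero.1 (tendsto_nhds_unique hl2 hl1)
  have hlog' : ∀ z : ℂ, z.im ∈ Set.Icc a b → R ≤ |z.re| → ℓ z - w = Complex.log (K z) := by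
    intro z hz hzR
    have hcs : Convex ℝ (Complex.im ⁻¹' Set.Icc a b) :=
      (convex_Icc a b).is_linear_preimage Complex.imLm.isLinear
    rcases le_abs.1 hzR with h | h
    · refine hlog (Complex.re ⁻¹' Set.Ici R ∩ Complex.im ⁻¹' Set.Icc a b)
        (((convex_Ici R).is_linear_preimage Complex.reLm.isLinear).inter hcs)
        (fun z hz => ⟨hz.2, le_abs.2 (Or.inl hz.1)⟩) atTop inferInstance atTop_le_cocompact ?_ z
        ⟨h, hz⟩
      filter_upwards [eventually_ge_atTop R] with t ht
      exact ⟨by simpa using ht, hreal t⟩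
    · refine hlog (Complex.re ⁻¹' Set.Iic (-R) ∩ Complex.im ⁻¹' Set.Icc a b)
        (((convex_Iic (-R)).is_linear_preimage Complex.reLm.isLinear).inter hcs)
        (fun z hz => ⟨hz.2, le_abs.2 (Or.inr (le_neg_of_le_neg hz.1))⟩) atBot inferInstance
        atBot_le_cocompact ?_ z ⟨by
          simp only [Set.mem_preimage, Set.mem_Iic]; linarith, hz⟩
      filter_upwards [eventually_le_atBot (-R)] with t ht
      exact ⟨by simpa using ht, hreal t⟩
  refine ⟨fun z => ℓ z - w, hF.of_exp_of_le (R := R) (D := 3 / 2) (hℓ.sub continuousOn_const)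
    (fun z hz => by rw [hwe z hz]; ring) fun z hz hzR => ?_, fun z hz => (hwe z hz).symm⟩
  rw [hlog' z hz hzR]
  have := Complex.norm_log_one_add_half_le_self (hR z hz hzR)
  rwa [add_sub_cancel] at this

end

section

variable {a b c : ℝ} {F G K : ℂ → ℂ}

/-! ## Tails of the densities -/

/-- Bounded holomorphic functions are multipliers away from the boundary. -/
theorem multiplier_of_bounded {J U : Set ℝ} (hU : IsOpen U) {δ M : ℝ} (hδ : 0 < δ)
    (hJU : ∀ c ∈ J, Metric.ball c δ ⊆ U) (hd : DifferentiableOn ℂ F (Complex.im ⁻¹' U))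
    (hM : ∀ z : ℂ, z.im ∈ U → ‖F z‖ ≤ M) : Multiplier J F := by
  have hsub : J ⊆ U := fun c hc => hJU c hc (Metric.mem_ball_self hδ)
  have hUo : IsOpen (Complex.im ⁻¹' U) := hU.preimage Complex.continuous_im
  have hball : ∀ z : ℂ, z.im ∈ J → Metric.closedBall z (δ / 2) ⊆ Complex.im ⁻¹' U := by
    intro z hz w hw
    refine hJU _ hz ?_
    rw [Metric.mem_closedBall, dist_eq_norm] at hw
    have h1 := (Complex.abs_im_le_norm (w - z)).trans hw
    rw [Complex.sub_im] at h1
    rw [Metric.mem_ball, Real.dist_eq]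
    linarith
  have hder : ∀ z : ℂ, z.im ∈ J → ‖deriv F z‖ ≤ M / (δ / 2) := by
    intro z hz
    refine Complex.norm_deriv_le_of_forall_mem_sphere_norm_le (half_pos hδ) ?_ fun w hw =>
      hM w (hball z hz (Metric.sphere_subset_closedBall hw))
    exact (hd.mono (by
      rw [closure_ball z (half_pos hδ).ne']; exact hball z hz)).diffContOnCl
  refine ⟨(hd.mono (Set.preimage_mono hsub)).continuousOn,
    hd.mono (Set.preimage_mono (interior_subset.trans hsub)), ⟨M, fun z hz => hM z (hsub hz)⟩,
    fun c hc => ?_⟩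
  refine HolderBdd.of_lipschitz (C := M) (K := M / (δ / 2))
    (fun x => hM _ (by rw [onLine_im]; exact hsub hc)) fun x y => ?_
  have hcv : Convex ℝ (Complex.im ⁻¹' {c}) :=
    (convex_singleton c).is_linear_preimage Complex.imLm.isLinear
  have := hcv.norm_image_sub_le_of_norm_deriv_le (𝕜 := ℂ) (f := F) (C := M / (δ / 2))
    (x := (y : ℂ) + c * Complex.I) (y := (x : ℂ) + c * Complex.I)
    (fun z hz => hd.differentiableAt (hUo.mem_nhds (by
      rw [Set.mem_preimage, show z.im = c from hz]; exact hsub hc)))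
    (fun z hz => hder z (by rw [show z.im = c from hz]; exact hc)) (onLine_im c y) (onLine_im c x)
  refine this.trans_eq ?_
  rw [add_sub_add_right_eq_sub, ← Complex.ofReal_sub, Complex.norm_real, Real.norm_eq_abs]

theorem differentiable_bandLimited {f : ℝ → ℂ} {L : ℝ} (hf : IntegrableOn f (Set.Ioc 0 L)) :
    Differentiable ℂ fun z : ℂ => ∫ x in Set.Ioc 0 L, f x * Complex.exp (Complex.I * z * x) := by
  intro z
  have hexp : ∀ w ∈ Metric.ball z 1, ∀ x ∈ Set.Ioc 0 L,
      ‖Complex.exp (Complex.I * w * x)‖ ≤ Real.exp ((|z.im| + 1) * L) := by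
    intro w hw x hx
    rw [norm_exp_I_mul]
    refine Real.exp_le_exp.2 ?_
    rw [Metric.mem_ball, dist_eq_norm] at hw
    have h1 := (Complex.abs_im_le_norm (w - z)).trans hw.le
    rw [Complex.sub_im] at h1
    have h2 : -w.im ≤ |z.im| + 1 := by
      linarith [neg_abs_le z.im, (abs_le.1 h1).1]
    have h3 : 0 ≤ |z.im| + 1 := by positivity
    nlinarith [hx.1, hx.2]
  have hm : ∀ w : ℂ, AEStronglyMeasurable (fun x : ℝ => f x * Complex.exp (Complex.I * w * x))
      (volume.restrict (Set.Ioc 0 L)) := fun w =>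
    hf.1.mul (Continuous.aestronglyMeasurable (by fun_prop))
  refine (hasDerivAt_integral_of_dominated_loc_of_deriv_le
    (μ := volume.restrict (Set.Ioc 0 L))
    (F := fun (w : ℂ) (x : ℝ) => f x * Complex.exp (Complex.I * w * x))
    (F' := fun w x => f x * (Complex.exp (Complex.I * w * x) * (Complex.I * x)))
    (bound := fun x => ‖f x‖ * (Real.exp ((|z.im| + 1) * L) * |L|))
    (Metric.ball_mem_nhds z one_pos) (Eventually.of_forall hm) ?_ ?_ ?_ ?_ ?_).2.differentiableAt
  · exact Integrable.mono' (hf.norm.mul_const (Real.exp ((|z.im| + 1) * L))) (hm z)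
      (ae_restrict_of_forall_mem measurableSet_Ioc fun x hx => by
        rw [norm_mul]
        gcongr
        exact hexp z (Metric.mem_ball_self one_pos) x hx)
  · exact hf.1.mul (Continuous.aestronglyMeasurable (by fun_prop))
  · refine ae_restrict_of_forall_mem measurableSet_Ioc fun x hx w hw => ?_
    rw [norm_mul, norm_mul]
    gcongr
    · exact hexp w hw x hx
    · rw [norm_mul, Complex.norm_I, one_mul, Complex.norm_real, Real.norm_of_nonneg hx.1.le]
      exact hx.2.trans (le_abs_self L)
  · exact hf.norm.mul_const _
  · refine ae_restrict_of_forall_mem measurableSet_Ioc fun x _ w _ => ?_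
    have h1 : HasDerivAt (fun w : ℂ => Complex.I * w * x) (Complex.I * x) w := by
      simpa using ((hasDerivAt_id w).const_mul Complex.I).mul_const (x:ℂ)
    exact h1.cexp.const_mul (f x)

/-- The factor e^{−izL} shifts the frequencies from (0, L] to (−L, 0], so the product is entire and
bounded on every lower half-plane. -/
theorem multiplier_exp_neg_mul_bandLimited {f : ℝ → ℂ} {L : ℝ} (b : ℝ)
    (hf : IntegrableOn f (Set.Ioc 0 L)) :
    Multiplier (Set.Iic b) fun z => Complex.exp (-Complex.I * z * L)
      * ∫ x in Set.Ioc 0 L, f x * Complex.exp (Complex.I * z * x) := by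
  refine multiplier_of_bounded (U := Set.Iio (b + 1)) isOpen_Iio (δ := 1)
    (M := ∫ x in Set.Ioc 0 L, ‖f x‖ * Real.exp ((|b| + 1) * L)) one_pos ?_ ?_ ?_
  · intro c hc x hx
    rw [Metric.mem_ball, Real.dist_eq] at hx
    have h1 : c ≤ b := hc
    have h2 := (abs_lt.1 hx).2
    simp only [Set.mem_Iio]
    linarith
  · exact (Differentiable.mul (by fun_prop) (differentiable_bandLimited hf)).differentiableOn
  · intro z hz
    rw [← integral_const_mul]
    refine norm_integral_le_of_norm_le (hf.norm.mul_const _)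
      (ae_restrict_of_forall_mem measurableSet_Ioc fun x hx => ?_)
    rw [mul_left_comm, norm_mul, ← Complex.exp_add,
      show -Complex.I * z * L + Complex.I * z * x = Complex.I * z * ((x - L : ℝ) : ℂ) by
        push_cast; ring, norm_exp_I_mul]
    refine mul_le_mul_of_nonneg_left (Real.exp_le_exp.2 ?_) (norm_nonneg _)
    have h1 : z.im ≤ |b| + 1 := by
      have : z.im < b + 1 := hz
      linarith [le_abs_self b]
    have h2 : 0 ≤ |b| + 1 := by positivity
    nlinarith [hx.1, hx.2]

theorem tendsto_integral_sq_tail {g : ℝ → ℂ} (hg : MemLp g 2 volume) :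
    Tendsto (fun L : ℝ => ∫ x in Set.Ioi L, ‖g x‖ ^ 2) atTop (𝓝 0) := by
  have hi : Integrable fun x => ‖g x‖ ^ 2 := (memLp_two_iff_integrable_sq_norm hg.1).1 hg
  have h1 := intervalIntegral_tendsto_integral_Ioi 0 hi.integrableOn tendsto_id
  have h2 := h1.const_sub (∫ x in Set.Ioi (0:ℝ), ‖g x‖ ^ 2)
  rw [sub_self] at h2
  refine h2.congr' ?_
  filter_upwards [eventually_ge_atTop 0] with L hL
  rw [sub_eq_iff_eq_add, id, add_comm]
  exact (intervalIntegral.integral_interval_add_Ioi hi.integrableOn hi.integrableOn).symm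

/-- A plus function on a line above the edge is, up to a small error, the transform of a function
supported on a long interval. -/
theorem PlusClass.exists_bandLimited_approx (hF : PlusClass a F) (hab : a < b) {ε : ℝ}
    (hε : 0 < ε) :
    ∃ L₀ : ℝ, 0 < L₀ ∧ ∀ L, L₀ ≤ L → ∃ G : ℂ → ℂ,
      Multiplier (Set.Iic b) (fun z => Complex.exp (-Complex.I * z * L) * G z) ∧
      ∀ x : ℝ, ‖onLine b F x - onLine b G x‖ ≤ ε * Real.exp ((a - b) * L) := by
  obtain ⟨f, hm, hft, hrep⟩ := hF.exists_density
  set d : ℝ := b - a with hd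
  have hd0 : 0 < d := sub_pos.2 hab
  have hT := tendsto_integral_sq_tail hm
  -- Weight for a Cauchy-Schwarz estimate done by completing the square: with it the density tail
  -- and the exponential tail each contribute half of ε e^{−dL}.
  set e : ℝ := 2 * d * ε with he
  have he0 : 0 < e := by positivity
  obtain ⟨L₀, hL₀⟩ := ((hT.eventually (gt_mem_nhds (by positivity : (0:ℝ) < ε * e))).and
    (eventually_gt_atTop 0)).exists_forall_of_atTop
  refine ⟨L₀, (hL₀ L₀ le_rfl).2, fun L hL => ?_⟩
  have hL0 : 0 < L := (hL₀ L hL).2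
  have hTL := (hL₀ L hL).1.le
  have hint : ∀ c, a < c → IntegrableOn (fun x : ℝ => (Real.exp (-c * x) : ℂ) * f x) (Set.Ioi 0) :=
    fun c hc => (integrable_indicator_iff measurableSet_Ioi).1 (integrable_plusDensity hm hc)
  have hfi : IntegrableOn f (Set.Ioc 0 L) := by
    have h1 := ((hint b hab).mono_set Set.Ioc_subset_Ioi_self).mul_continuousOn_of_subset
      (g' := fun x : ℝ => (Real.exp (b * x) : ℂ)) (K := Set.Icc 0 L) (by fun_prop) measurableSet_Ioc
      isCompact_Icc Set.Ioc_subset_Icc_self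
    refine h1.congr_fun (fun x _ => ?_) measurableSet_Ioc
    simp only
    rw [mul_right_comm, ← Complex.ofReal_mul, ← Real.exp_add]
    simp
  refine ⟨_, multiplier_exp_neg_mul_bandLimited b hfi, fun x => ?_⟩
  have hz : ∀ t : ℝ, f t * Complex.exp (Complex.I * ((x:ℂ) + b * Complex.I) * t)
      = (Real.exp (-b * t) : ℂ) * f t * Complex.exp ((x * t : ℝ) * Complex.I) := by
    intro t
    rw [mul_comm _ (f t), mul_assoc (f t), Complex.ofReal_exp, ← Complex.exp_add]
    congr 2
    push_cast
    linear_combination (b * t : ℂ) * Complex.I_mul_I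
  have hie : IntegrableOn (fun t : ℝ => f t * Complex.exp (Complex.I * ((x:ℂ) + b * Complex.I) * t))
      (Set.Ioi 0) := by
    simp only [hz]
    refine Integrable.mul_bdd (c := 1) (hint b hab)
      (Continuous.aestronglyMeasurable (by fun_prop)) (Eventually.of_forall fun t => ?_)
    rw [Complex.norm_exp_ofReal_mul_I]
  have hsplit : onLine b F x - ∫ t in Set.Ioc 0 L,
        f t * Complex.exp (Complex.I * ((x:ℂ) + b * Complex.I) * t)
      = ∫ t in Set.Ioi L, f t * Complex.exp (Complex.I * ((x:ℂ) + b * Complex.I) * t) := by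
    rw [onLine, hrep _ (by rwa [onLine_im]), ← Set.Ioc_union_Ioi_eq_Ioi hL0.le,
      setIntegral_union Set.Ioc_disjoint_Ioi_same measurableSet_Ioi
        (hie.mono_set Set.Ioc_subset_Ioi_self) (hie.mono_set (Set.Ioi_subset_Ioi hL0.le)),
      add_sub_cancel_left]
  have hsq : Integrable fun t => ‖plusDensity f a t‖ ^ 2 :=
    (memLp_two_iff_integrable_sq_norm hm.1).1 hm
  have hki : IntegrableOn (fun t : ℝ => Real.exp (-(2 * d) * t)) (Set.Ioi L) :=
    exp_neg_integrableOn_Ioi L (by positivity)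
  have hk : ∫ t in Set.Ioi L, Real.exp (-(2 * d) * t) = Real.exp (-(2 * d) * L) / (2 * d) := by
    rw [integral_exp_mul_Ioi (by linarith), neg_div_neg_eq]
  set E : ℝ := Real.exp (-d * L) with hE
  have hE0 : 0 < E := Real.exp_pos _
  have hE2 : Real.exp (-(2 * d) * L) = E ^ 2 := by
    rw [hE, ← Real.exp_nat_mul]; congr 1; push_cast; ring
  have hpt : ∀ t ∈ Set.Ioi L, ‖f t * Complex.exp (Complex.I * ((x:ℂ) + b * Complex.I) * t)‖
      ≤ E / (2 * e) * ‖plusDensity f a t‖ ^ 2 + e / (2 * E) * Real.exp (-(2 * d) * t) := by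
    intro t ht
    have ht0 : t ∈ Set.Ioi (0:ℝ) := hL0.trans ht
    have h1 : ‖plusDensity f a t‖ = Real.exp (-a * t) * ‖f t‖ := by
      rw [plusDensity, Set.indicator_of_mem ht0, norm_mul, Complex.norm_real,
        Real.norm_of_nonneg (Real.exp_pos _).le]
    have h2 : ‖f t * Complex.exp (Complex.I * ((x:ℂ) + b * Complex.I) * t)‖
        = Real.exp (-d * t) * ‖plusDensity f a t‖ := by
      rw [hz, norm_mul, Complex.norm_exp_ofReal_mul_I, mul_one, norm_mul, Complex.norm_real,
        Real.norm_of_nonneg (Real.exp_pos _).le, h1, ← mul_assoc, ← Real.exp_add]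
      congr 2
      rw [hd]; ring
    have h3 : Real.exp (-(2 * d) * t) = Real.exp (-d * t) ^ 2 := by
      rw [← Real.exp_nat_mul]; congr 1; push_cast; ring
    rw [h2, h3]
    set p := Real.exp (-d * t)
    set q := ‖plusDensity f a t‖
    have h4 : E / (2 * e) * q ^ 2 + e / (2 * E) * p ^ 2 - p * q
        = (E * q - e * p) ^ 2 / (2 * e * E) := by
      field_simp; ring
    have h5 : 0 ≤ (E * q - e * p) ^ 2 / (2 * e * E) := by positivity
    linarith
  simp only [onLine] at hsplit ⊢
  rw [hsplit]
  refine (norm_integral_le_of_norm_le ((hsq.integrableOn.const_mul _).add (hki.const_mul _))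
    (ae_restrict_of_forall_mem measurableSet_Ioi hpt)).trans ?_
  simp only [Pi.add_apply]
  rw [integral_add (hsq.integrableOn.const_mul _) (hki.const_mul _), integral_const_mul,
    integral_const_mul, hk, hE2]
  have h6 : (a - b) * L = -d * L := by rw [hd]; ring
  rw [h6]
  calc E / (2 * e) * (∫ t in Set.Ioi L, ‖plusDensity f a t‖ ^ 2) + e / (2 * E) * (E ^ 2 / (2 * d))
      ≤ E / (2 * e) * (ε * e) + e / (2 * E) * (E ^ 2 / (2 * d)) := by gcongr
    _ = ε * E := by
      rw [he]
      field_simp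
      ring

end

section

variable {a b c L : ℝ} {F G K Kp Km : ℂ → ℂ}

/-! ## Factorisation -/

/-- Factorisations with the properties of the inverse factors. -/
structure Factorisation (a b : ℝ) (K Kp Km : ℂ → ℂ) : Prop where
  plus : Nice (Set.Ici a) fun z => Kp z - 1
  plus_inv : Nice (Set.Ici a) fun z => (Kp z)⁻¹ - 1
  minus : Nice (Set.Iic b) fun z => Km z - 1
  minus_inv : Nice (Set.Iic b) fun z => (Km z)⁻¹ - 1
  plus_ne : ∀ z : ℂ, a ≤ z.im → Kp z ≠ 0
  minus_ne : ∀ z : ℂ, z.im ≤ b → Km z ≠ 0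
  eq : ∀ z : ℂ, a ≤ z.im → z.im ≤ b → K z = Kp z * Km z

/-- Split the logarithm additively and exponentiate. The inverse factors are exponentials of the
negated parts, so they are of the same kind. -/
theorem exists_factorisation (hab : a < b) {ℓ : ℂ → ℂ} (hℓ : Nice (Set.Icc a b) ℓ)
    (hK : ∀ z : ℂ, z.im ∈ Set.Icc a b → K z = Complex.exp (ℓ z)) :
    ∃ lp lm : ℂ → ℂ, Nice (Set.Ici a) lp ∧ Nice (Set.Iic b) lm ∧
      Factorisation a b K (fun z => Complex.exp (lp z)) fun z => Complex.exp (lm z) := by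
  obtain ⟨lp, lm, hp, hm, he⟩ := hℓ.stripClass hab
  refine ⟨lp, lm, hp.nice, hm.nice, hp.nice.exp_sub_one, ?_, hm.nice.exp_sub_one, ?_,
    fun _ _ => Complex.exp_ne_zero _, fun _ _ => Complex.exp_ne_zero _, fun z hza hzb => ?_⟩
  · exact hp.nice.neg.exp_sub_one.congr fun z _ => by rw [Complex.exp_neg]
  · exact hm.nice.neg.exp_sub_one.congr fun z _ => by rw [Complex.exp_neg]
  · rw [hK z ⟨hza, hzb⟩, he z hza hzb, Complex.exp_add]

theorem Nice.multiplier_of_sub_one {J : Set ℝ} (h : Nice J fun z => F z - 1) : Multiplier J F :=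
  (h.multiplier.add (Multiplier.const J 1)).congr fun z _ => by ring

namespace Factorisation

theorem isMulSplit (h : Factorisation a b K Kp Km) : IsMulSplit a b K Kp Km :=
  ⟨h.plus.plusClass, minusClass_iff_nice.2 h.minus, h.plus_ne, h.minus_ne, h.eq⟩

theorem comp_neg (h : Factorisation a b K Kp Km) :
    Factorisation (-b) (-a) (fun z => K (-z)) (fun z => Km (-z)) fun z => Kp (-z) := by
  refine ⟨?_, ?_, ?_, ?_, fun z hz => h.minus_ne _ (by simpa using neg_le_neg hz),
    fun z hz => h.plus_ne _ (by simpa using neg_le_neg hz), fun z hza hzb => ?_⟩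
  · simpa only [neg_preimage_Iic] using h.minus.comp_neg
  · simpa only [neg_preimage_Iic] using h.minus_inv.comp_neg
  · simpa only [← neg_preimage_Ici, neg_neg] using h.plus.comp_neg
  · simpa only [← neg_preimage_Ici, neg_neg] using h.plus_inv.comp_neg
  · rw [h.eq _ (by simpa using neg_le_neg hzb) (by simpa using neg_le_neg hza), mul_comm]

end Factorisation

theorem norm_exp_neg_I_mul (z : ℂ) (L : ℝ) :
    ‖Complex.exp (-Complex.I * z * L)‖ = Real.exp (z.im * L) := by
  rw [show -Complex.I * z * L = Complex.I * z * ((-L : ℝ) : ℂ) by push_cast; ring, norm_exp_I_mul]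
  ring_nf

theorem multiplier_exp_plus (a : ℝ) (hL : 0 ≤ L) :
    Multiplier (Set.Ici a) fun z => Complex.exp (Complex.I * z * L) :=
  multiplier_exp_I_mul (m := a * L) fun _ hc => mul_le_mul_of_nonneg_right hc hL

theorem multiplier_exp_minus (b : ℝ) (hL : 0 ≤ L) :
    Multiplier (Set.Iic b) fun z => Complex.exp (-Complex.I * z * L) := by
  refine (multiplier_exp_I_mul (J := Set.Iic b) (L := -L) (m := -(b * L)) fun c hc => ?_).congr
    fun z _ => ?_
  · have : c ≤ b := hc
    nlinarith
  · congr 1; push_cast; ring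

theorem lineNorm_congr (h : ∀ z : ℂ, z.im = c → F z = G z) : lineNorm c F = lineNorm c G := by
  have : onLine c F = onLine c G := by
    ext x; exact h _ (onLine_im c x)
  rw [lineNorm, this, lineNorm]

theorem lineNorm_mul_le_of_bound {J : Set ℝ} {M : ℝ} (h : ∀ z : ℂ, z.im ∈ J → ‖F z‖ ≤ M)
    (hc : c ∈ J) : lineNorm c (fun z => F z * G z) ≤ ENNReal.ofReal M * lineNorm c G :=
  lineNorm_mul_le fun _ => h _ (by rwa [onLine_im])

theorem lineNorm_neg (c : ℝ) (F : ℂ → ℂ) : lineNorm c (fun z => -F z) = lineNorm c F :=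
  eLpNorm_neg (onLine c F) 2 volume

/-! ## A single step of the scheme -/

theorem PlusClass.mul (hF : Multiplier (Set.Ici a) F) (hG : PlusClass a G) :
    PlusClass a fun z => F z * G z :=
  (hF.mul_nice hG.nice).plusClass

theorem MinusClass.mul (hF : Multiplier (Set.Iic b) F) (hG : MinusClass b G) :
    MinusClass b fun z => F z * G z :=
  minusClass_iff_nice.2 (hF.mul_nice hG.nice)

theorem PlusClass.add (hF : PlusClass a F) (hG : PlusClass a G) : PlusClass a fun z => F z + G z :=
  (hF.nice.add hG.nice).plusClass

theorem PlusClass.sub (hF : PlusClass a F) (hG : PlusClass a G) : PlusClass a fun z => F z - G z :=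
  (hF.nice.sub hG.nice).plusClass

theorem PlusClass.neg (hF : PlusClass a F) : PlusClass a fun z => -F z :=
  hF.nice.neg.plusClass

theorem MinusClass.add (hF : MinusClass b F) (hG : MinusClass b G) :
    MinusClass b fun z => F z + G z :=
  minusClass_iff_nice.2 (hF.nice.add hG.nice)

theorem MinusClass.sub (hF : MinusClass b F) (hG : MinusClass b G) :
    MinusClass b fun z => F z - G z :=
  minusClass_iff_nice.2 (hF.nice.sub hG.nice)

theorem MinusClass.neg (hF : MinusClass b F) : MinusClass b fun z => -F z :=
  minusClass_iff_nice.2 hF.nice.neg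

/-- `Φ` and `X` solve the scalar Wiener-Hopf equation `K Φ = X + R` on the strip. -/
structure MinusSolves (a b : ℝ) (K R Φ X : ℂ → ℂ) : Prop where
  minus : MinusClass b Φ
  plus : PlusClass a X
  eq : ∀ z : ℂ, a ≤ z.im → z.im ≤ b → K z * Φ z = X z + R z

/-- `Ψ` and `Y` solve the scalar Wiener-Hopf equation `K Ψ = Y + R` on the strip. -/
structure PlusSolves (a b : ℝ) (K R Ψ Y : ℂ → ℂ) : Prop where
  plus : PlusClass a Ψ
  minus : MinusClass b Y
  eq : ∀ z : ℂ, a ≤ z.im → z.im ≤ b → K z * Ψ z = Y z + R z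

variable {R R' Φ Φ' Ψ Ψ' X X' Y Y' : ℂ → ℂ}

theorem PlusSolves.comp_neg (h : PlusSolves a b K R Ψ Y) :
    MinusSolves (-b) (-a) (fun z => K (-z)) (fun z => R (-z)) (fun z => Ψ (-z)) fun z => Y (-z) :=
  ⟨h.plus.comp_neg, h.minus.comp_neg, fun z hza hzb =>
    h.eq _ (by simpa using neg_le_neg hzb) (by simpa using neg_le_neg hza)⟩

theorem MinusSolves.comp_neg (h : MinusSolves a b K R Φ X) :
    PlusSolves (-b) (-a) (fun z => K (-z)) (fun z => R (-z)) (fun z => Φ (-z)) fun z => X (-z) :=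
  ⟨h.minus.comp_neg, h.plus.comp_neg, fun z hza hzb =>
    h.eq _ (by simpa using neg_le_neg hzb) (by simpa using neg_le_neg hza)⟩

theorem MinusSolves.sub (h : MinusSolves a b K R Φ X) (h' : MinusSolves a b K R' Φ' X') :
    MinusSolves a b K (fun z => R z - R' z) (fun z => Φ z - Φ' z) fun z => X z - X' z :=
  ⟨h.minus.sub h'.minus, h.plus.sub h'.plus, fun z hza hzb => by
    linear_combination h.eq z hza hzb - h'.eq z hza hzb⟩

theorem PlusSolves.sub (h : PlusSolves a b K R Ψ Y) (h' : PlusSolves a b K R' Ψ' Y') :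
    PlusSolves a b K (fun z => R z - R' z) (fun z => Ψ z - Ψ' z) fun z => Y z - Y' z :=
  ⟨h.plus.sub h'.plus, h.minus.sub h'.minus, fun z hza hzb => by
    linear_combination h.eq z hza hzb - h'.eq z hza hzb⟩

theorem MinusSolves.congr (h : MinusSolves a b K R Φ X)
    (hR : ∀ z : ℂ, a ≤ z.im → z.im ≤ b → R z = R' z) : MinusSolves a b K R' Φ X :=
  ⟨h.minus, h.plus, fun z hza hzb => by rw [h.eq z hza hzb, hR z hza hzb]⟩

theorem PlusSolves.congr (h : PlusSolves a b K R Ψ Y)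
    (hR : ∀ z : ℂ, a ≤ z.im → z.im ≤ b → R z = R' z) : PlusSolves a b K R' Ψ Y :=
  ⟨h.plus, h.minus, fun z hza hzb => by rw [h.eq z hza hzb, hR z hza hzb]⟩

/-- Divide by the plus factor and split the right-hand side R/K₊ = P + M; then Φ = M/K₋ and X =
−K₊P. -/
theorem Factorisation.exists_minusSolves (h : Factorisation a b K Kp Km) (hab : a < b)
    (hR : Nice (Set.Icc a b) R) : ∃ Φ X, MinusSolves a b K R Φ X := by
  obtain ⟨P, M, hP, hM, he⟩ := ((h.plus_inv.multiplier_of_sub_one.mono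
    Set.Icc_subset_Ici_self).mul_nice hR).stripClass hab
  refine ⟨_, _, hM.mul h.minus_inv.multiplier_of_sub_one,
    (hP.mul h.plus.multiplier_of_sub_one).neg, fun z hza hzb => ?_⟩
  have e := he z hza hzb
  have h1 := h.plus_ne z hza
  have h2 := h.minus_ne z hzb
  rw [h.eq z hza hzb]
  field_simp
  field_simp at e
  linear_combination -e

theorem Factorisation.exists_plusSolves (h : Factorisation a b K Kp Km) (hab : a < b)
    (hR : Nice (Set.Icc a b) R) : ∃ Ψ Y, PlusSolves a b K R Ψ Y := by
  have hR' := hR.comp_neg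
  rw [neg_preimage_Icc] at hR'
  obtain ⟨Φ, X, hs⟩ := h.comp_neg.exists_minusSolves (neg_lt_neg hab) hR'
  have h1 := hs.comp_neg
  simp only [neg_neg] at h1
  exact ⟨_, _, h1⟩

/-- The first term on the left is a plus function and the second a minus function, so the projection
bounds estimate both by the right-hand side. -/
theorem MinusSolves.split (h : MinusSolves a b K R Φ X) (hK : Factorisation a b K Kp Km) {z : ℂ}
    (hza : a ≤ z.im) (hzb : z.im ≤ b) :
    -((Kp z)⁻¹ * X z) + Km z * Φ z = (Kp z)⁻¹ * R z := by
  have e := h.eq z hza hzb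
  rw [hK.eq z hza hzb] at e
  have h1 := hK.plus_ne z hza
  field_simp
  linear_combination e

/-- The solution operator of a scalar equation is bounded on the lines of the strip. -/
theorem Factorisation.exists_bound_minus (h : Factorisation a b K Kp Km) :
    ∃ C : ℝ, 0 ≤ C ∧ ∀ R Φ X, MinusSolves a b K R Φ X → ∀ c ∈ Set.Icc a b,
      lineNorm c Φ ≤ ENNReal.ofReal C * lineNorm c R ∧
      lineNorm c X ≤ ENNReal.ofReal C * lineNorm c R := by
  obtain ⟨M₁, hM₁⟩ := h.plus.multiplier_of_sub_one.bdd
  obtain ⟨M₂, hM₂⟩ := h.plus_inv.multiplier_of_sub_one.bdd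
  obtain ⟨M₃, hM₃⟩ := h.minus_inv.multiplier_of_sub_one.bdd
  refine ⟨max M₁ 0 * max M₂ 0 + max M₃ 0 * max M₂ 0, by positivity, fun R Φ X hs c hc => ?_⟩
  have h1 := lineNorm_le_add (hs.plus.mul h.plus_inv.multiplier_of_sub_one).neg
    (hs.minus.mul h.minus.multiplier_of_sub_one) hc.1 hc.2
  rw [lineNorm_congr (G := fun z => (Kp z)⁻¹ * R z) fun z hz =>
    hs.split h (by rw [hz]; exact hc.1) (by rw [hz]; exact hc.2), lineNorm_neg] at h1
  have h2 : lineNorm c (fun z => (Kp z)⁻¹ * R z) ≤ ENNReal.ofReal (max M₂ 0) * lineNorm c R :=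
    (lineNorm_mul_le_of_bound hM₂ hc.1).trans
      (mul_le_mul_left (ENNReal.ofReal_le_ofReal (le_max_left _ _)) _)
  have key : ∀ {H V G : ℂ → ℂ} {J : Set ℝ} {M : ℝ}, c ∈ J → (∀ z : ℂ, z.im ∈ J → ‖H z‖ ≤ M) →
      lineNorm c V ≤ lineNorm c (fun z => (Kp z)⁻¹ * R z) → (∀ z : ℂ, z.im = c → G z = H z * V z) →
      lineNorm c G ≤ ENNReal.ofReal (max M 0 * max M₂ 0) * lineNorm c R := by
    intro H V G J M hcJ hM hV hG
    rw [lineNorm_congr hG, ENNReal.ofReal_mul (le_max_right _ _), mul_assoc]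
    refine (lineNorm_mul_le_of_bound hM hcJ).trans ?_
    exact mul_le_mul' (ENNReal.ofReal_le_ofReal (le_max_left _ _)) (hV.trans h2)
  refine ⟨?_, ?_⟩
  · refine (key (J := Set.Iic b) (G := Φ) hc.2 hM₃ h1.2 fun z hz => ?_).trans
      (mul_le_mul_left (ENNReal.ofReal_le_ofReal (le_add_of_nonneg_left (by positivity))) _)
    rw [inv_mul_cancel_left₀ (h.minus_ne z (by rw [hz]; exact hc.2))]
  · refine (key (J := Set.Ici a) (G := X) hc.1 hM₁ h1.1 fun z hz => ?_).trans
      (mul_le_mul_left (ENNReal.ofReal_le_ofReal (le_add_of_nonneg_right (by positivity))) _)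
    rw [mul_inv_cancel_left₀ (h.plus_ne z (by rw [hz]; exact hc.1))]

/-- A plus function that comes from a strongly shifted minus function is small. -/
theorem Factorisation.exists_tail_bound_minus (h : Factorisation a b K Kp Km) (hab : a < b)
    {ε : ℝ} (hε : 0 < ε) :
    ∃ L₀ : ℝ, 0 < L₀ ∧ ∀ L, L₀ ≤ L → ∀ Φ X Y, MinusClass b Y →
      MinusSolves a b K (fun z => Complex.exp (-Complex.I * z * L) * Y z) Φ X →
      lineNorm b X ≤ ENNReal.ofReal (ε * Real.exp (a * L)) * lineNorm b Y := by
  obtain ⟨M, hM⟩ := h.plus.multiplier_of_sub_one.bdd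
  obtain ⟨L₀, hL₀, H⟩ := h.plus_inv.plusClass.exists_bandLimited_approx hab
    (ε := ε / (|M| + 1)) (by positivity)
  refine ⟨L₀, hL₀, fun L hL Φ X Y hY hs => ?_⟩
  obtain ⟨G, hG, hGb⟩ := H L hL
  have hL0 : 0 ≤ L := hL₀.le.trans hL
  have hb : b ∈ Set.Icc a b := ⟨hab.le, le_rfl⟩
  -- Besides K₋Φ, the minus functions e^{−izL}Y and e^{−izL}GY are moved to the minus side. The sum
  -- is then e^{−izL}Y times the tail of 1/K₊ − 1 that `G` leaves uncovered.
  have h1 := (lineNorm_le_add (hs.plus.mul h.plus_inv.multiplier_of_sub_one).neg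
    (((hs.minus.mul h.minus.multiplier_of_sub_one).sub (hY.mul (multiplier_exp_minus b hL0))).sub
      (hY.mul hG)) hb.1 hb.2).1
  rw [lineNorm_neg, lineNorm_congr (F := fun z => -((Kp z)⁻¹ * X z) + (Km z * Φ z
    - Complex.exp (-Complex.I * z * L) * Y z - Complex.exp (-Complex.I * z * L) * G z * Y z))
    (G := fun z => (Complex.exp (-Complex.I * z * L)
    * ((Kp z)⁻¹ - 1 - G z)) * Y z) fun z hz => by
      linear_combination hs.split h (by rw [hz]; exact hb.1) (by rw [hz])] at h1
  have h2 : lineNorm b (fun z => (Complex.exp (-Complex.I * z * L) * ((Kp z)⁻¹ - 1 - G z)) * Y z)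
      ≤ ENNReal.ofReal (ε / (|M| + 1) * Real.exp (a * L)) * lineNorm b Y := by
    refine lineNorm_mul_le (F := fun z => Complex.exp (-Complex.I * z * L) * ((Kp z)⁻¹ - 1 - G z))
      fun x => ?_
    have h3 := hGb x
    simp only [onLine] at h3 ⊢
    rw [norm_mul, norm_exp_neg_I_mul, onLine_im]
    calc _ ≤ Real.exp (b * L) * (ε / (|M| + 1) * Real.exp ((a - b) * L)) := by gcongr
      _ = ε / (|M| + 1) * Real.exp (a * L) := by
        rw [mul_left_comm, ← Real.exp_add]; ring_nf
  rw [lineNorm_congr (F := X) (G := fun z => Kp z * ((Kp z)⁻¹ * X z)) fun z hz =>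
    (mul_inv_cancel_left₀ (h.plus_ne z (by rw [hz]; exact hb.1)) _).symm]
  refine (lineNorm_mul_le_of_bound hM hb.1).trans ?_
  calc ENNReal.ofReal M * lineNorm b (fun z => (Kp z)⁻¹ * X z)
      ≤ ENNReal.ofReal (|M| + 1)
          * (ENNReal.ofReal (ε / (|M| + 1) * Real.exp (a * L)) * lineNorm b Y) :=
        mul_le_mul' (ENNReal.ofReal_le_ofReal (by linarith [le_abs_self M])) (h1.trans h2)
    _ = ENNReal.ofReal (ε * Real.exp (a * L)) * lineNorm b Y := by
      rw [← mul_assoc, ← ENNReal.ofReal_mul (by positivity)]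
      congr 2
      field_simp

/-- Reflection of the minus case. Niceness of `R` provides the measurability needed to reflect its
norm. -/
theorem Factorisation.exists_bound_plus (h : Factorisation a b K Kp Km) :
    ∃ C : ℝ, 0 ≤ C ∧ ∀ R Ψ Y, Nice (Set.Icc a b) R → PlusSolves a b K R Ψ Y → ∀ c ∈ Set.Icc a b,
      lineNorm c Ψ ≤ ENNReal.ofReal C * lineNorm c R ∧
      lineNorm c Y ≤ ENNReal.ofReal C * lineNorm c R := by
  obtain ⟨C, hC, H⟩ := h.comp_neg.exists_bound_minus
  refine ⟨C, hC, fun R Ψ Y hR hs c hc => ?_⟩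
  have h1 := H _ _ _ hs.comp_neg (-c) ⟨neg_le_neg hc.2, neg_le_neg hc.1⟩
  rw [lineNorm_comp_neg, lineNorm_comp_neg, lineNorm_comp_neg, neg_neg] at h1
  · exact h1
  · rw [neg_neg]; exact (hs.minus.nice.lines c hc.2).1.1
  · rw [neg_neg]; exact (hR.lines c hc).1.1
  · rw [neg_neg]; exact (hs.plus.nice.lines c hc.1).1.1

theorem Factorisation.exists_tail_bound_plus (h : Factorisation a b K Kp Km) (hab : a < b)
    {ε : ℝ} (hε : 0 < ε) :
    ∃ L₀ : ℝ, 0 < L₀ ∧ ∀ L, L₀ ≤ L → ∀ Ψ Y X, PlusClass a X →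
      PlusSolves a b K (fun z => Complex.exp (Complex.I * z * L) * X z) Ψ Y →
      lineNorm a Y ≤ ENNReal.ofReal (ε * Real.exp (-b * L)) * lineNorm a X := by
  obtain ⟨L₀, hL₀, H⟩ := h.comp_neg.exists_tail_bound_minus (neg_lt_neg hab) hε
  refine ⟨L₀, hL₀, fun L hL Ψ Y X hX hs => ?_⟩
  have h1 := H L hL _ _ _ hX.comp_neg (hs.comp_neg.congr fun z _ _ => by
    rw [show Complex.I * -z * L = -Complex.I * z * L by ring])
  rw [lineNorm_comp_neg, lineNorm_comp_neg, neg_neg] at h1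
  · exact h1
  · rw [neg_neg]; exact hX.edge.1.1
  · rw [neg_neg]; exact (hs.minus.nice.lines a hab.le).1.1

end

section

variable {a b c L : ℝ} {F G K Kp Km κp κm N D Φ Ψ Φ' Ψ' P M P' M' X Y : ℂ → ℂ}

/-! ## The equations of the scheme as scalar Wiener-Hopf equations -/

/-- Makes the scheme independent of the splittings that its equations only assert to exist. -/
theorem IsAddSplit.unique (hab : a ≤ b) (h : IsAddSplit a b F P M) (h' : IsAddSplit a b F P' M') :
    (∀ z : ℂ, a ≤ z.im → P z = P' z) ∧ ∀ z : ℂ, z.im ≤ b → M z = M' z := by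
  have h0 := eq_zero_of_add_eq_zero (h.plus.sub h'.plus) (h.minus.sub h'.minus) le_rfl hab
    fun z hz => by
      linear_combination h'.eq z hz.ge (hz.trans_le hab) - h.eq z hz.ge (hz.trans_le hab)
  exact ⟨fun z hz => sub_eq_zero.1 (h0.1 z hz), fun z hz => sub_eq_zero.1 (h0.2 z hz)⟩

theorem PlusClass.eqOn_of_line (hF : PlusClass a F) (hG : PlusClass a G) (hc : a ≤ c)
    (h : ∀ z : ℂ, z.im = c → F z = G z) {z : ℂ} (hz : a ≤ z.im) : F z = G z :=
  sub_eq_zero.1 ((hF.sub hG).eq_zero_of_lineNorm hc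
    (lineNorm_eq_zero_of_forall fun z hz => sub_eq_zero.2 (h z hz)) z hz)

theorem MinusClass.eqOn_of_line (hF : MinusClass b F) (hG : MinusClass b G) (hc : c ≤ b)
    (h : ∀ z : ℂ, z.im = c → F z = G z) {z : ℂ} (hz : z.im ≤ b) : F z = G z :=
  sub_eq_zero.1 ((hF.sub hG).eq_zero_of_lineNorm hc
    (lineNorm_eq_zero_of_forall fun z hz => sub_eq_zero.2 (h z hz)) z hz)

/-- Both sides of the equation on Im z = b are plus functions, so equality on that line extends to
the half-plane. Adding the splitting of κ₋Ψ restores the full coefficient. -/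
theorem plusSolves_of_line (hab : a ≤ b) (hκ : Multiplier (Set.Ici a) κp)
    (hK : ∀ z : ℂ, a ≤ z.im → z.im ≤ b → K z = κp z + κm z) (hΨ : PlusClass a Ψ)
    (hs : IsAddSplit a b (fun z => κm z * Ψ z) P M) (hN : PlusClass a N)
    (h : ∀ z : ℂ, z.im = b → κp z * Ψ z = N z - P z) : PlusSolves a b K N Ψ M :=
  ⟨hΨ, hs.minus, fun z hza hzb => by
    have h1 := (hΨ.mul hκ).eqOn_of_line (hN.sub hs.plus) hab h hza
    rw [hK z hza hzb]
    linear_combination h1 + hs.eq z hza hzb⟩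

theorem minusSolves_of_line (hab : a ≤ b) (hκ : Multiplier (Set.Iic b) κm)
    (hK : ∀ z : ℂ, a ≤ z.im → z.im ≤ b → K z = κp z + κm z) (hΦ : MinusClass b Φ)
    (hs : IsAddSplit a b (fun z => κp z * Φ z) P M) (hN : MinusClass b N)
    (h : ∀ z : ℂ, z.im = a → κm z * Φ z = N z - M z) : MinusSolves a b K N Φ P :=
  ⟨hΦ, hs.plus, fun z hza hzb => by
    have h1 := (hΦ.mul hκ).eqOn_of_line (hN.sub hs.minus) hab h hzb
    rw [hK z hza hzb]
    linear_combination h1 + hs.eq z hza hzb⟩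

/-- The converse: a solution on the strip exhibits the splitting required by the equation on one
line, with the plus part read off from that equation. -/
theorem PlusSolves.isAddSplit (h : PlusSolves a b K N Ψ M) (hN : PlusClass a N)
    (hκ : Multiplier (Set.Ici a) κp)
    (hK : ∀ z : ℂ, a ≤ z.im → z.im ≤ b → K z = κp z + κm z) :
    IsAddSplit a b (fun z => κm z * Ψ z) (fun z => N z - κp z * Ψ z) M :=
  ⟨hN.sub (h.plus.mul hκ), h.minus, fun z hza hzb => by
    have := h.eq z hza hzb
    rw [hK z hza hzb] at this
    linear_combination this⟩

theorem MinusSolves.isAddSplit (h : MinusSolves a b K N Φ P) (hN : MinusClass b N)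
    (hκ : Multiplier (Set.Iic b) κm)
    (hK : ∀ z : ℂ, a ≤ z.im → z.im ≤ b → K z = κp z + κm z) :
    IsAddSplit a b (fun z => κp z * Φ z) P fun z => N z - κm z * Φ z :=
  ⟨h.plus, hN.sub (h.minus.mul hκ), fun z hza hzb => by
    have := h.eq z hza hzb
    rw [hK z hza hzb] at this
    linear_combination this⟩

theorem IsAddSplit.sub {F' : ℂ → ℂ} (h : IsAddSplit a b F P M) (h' : IsAddSplit a b F' P' M') :
    IsAddSplit a b (fun z => F z - F' z) (fun z => P z - P' z) fun z => M z - M' z :=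
  ⟨h.plus.sub h'.plus, h.minus.sub h'.minus, fun z hza hzb => by
    linear_combination h.eq z hza hzb - h'.eq z hza hzb⟩

theorem IsAddSplit.congr {F' : ℂ → ℂ} (h : IsAddSplit a b F P M)
    (he : ∀ z : ℂ, a ≤ z.im → z.im ≤ b → F z = F' z) : IsAddSplit a b F' P M :=
  ⟨h.plus, h.minus, fun z hza hzb => (he z hza hzb).symm.trans (h.eq z hza hzb)⟩

theorem IsAddSplit.lineNorm_le (h : IsAddSplit a b F P M) (hac : a ≤ c) (hcb : c ≤ b) :
    lineNorm c P ≤ lineNorm c F ∧ lineNorm c M ≤ lineNorm c F := by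
  rw [lineNorm_congr (F := F) (G := fun z => P z + M z) fun z hz =>
    h.eq z (by rw [hz]; exact hac) (by rw [hz]; exact hcb)]
  exact lineNorm_le_add h.plus h.minus hac hcb

theorem lineNorm_exp_minus_mul_le (c L : ℝ) (F : ℂ → ℂ) :
    lineNorm c (fun z => Complex.exp (-Complex.I * z * L) * F z)
      ≤ ENNReal.ofReal (Real.exp (c * L)) * lineNorm c F :=
  lineNorm_mul_le (F := fun z => Complex.exp (-Complex.I * z * L)) fun x => by
    rw [onLine, norm_exp_neg_I_mul, onLine_im]

theorem lineNorm_exp_plus_mul_le (c L : ℝ) (F : ℂ → ℂ) :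
    lineNorm c (fun z => Complex.exp (Complex.I * z * L) * F z)
      ≤ ENNReal.ofReal (Real.exp (-c * L)) * lineNorm c F :=
  lineNorm_mul_le (F := fun z => Complex.exp (Complex.I * z * L)) fun x => by
    rw [onLine, norm_exp_I_mul, onLine_im]

/-! ## Contraction -/

/-- Four consecutive half-steps of the homogeneous scheme contract, on the lower line. -/
theorem exists_contraction_minus {K' Kp' Km' : ℂ → ℂ} (hab : a < b)
    (h1 : Factorisation a b K Kp Km) (h3 : Factorisation a b K' Kp' Km') {m : ℝ} (hm : 0 < m) :
    ∃ L₀ : ℝ, 0 < L₀ ∧ ∀ L, L₀ ≤ L → ∀ X Ψ Y Φ X', PlusClass a X →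
      PlusSolves a b K' (fun z => Complex.exp (Complex.I * z * L) * X z) Ψ Y →
      MinusSolves a b K (fun z => Complex.exp (-Complex.I * z * L) * Y z) Φ X' →
      lineNorm a Φ ≤ ENNReal.ofReal (m * Real.exp ((a - b) * L)) * lineNorm a X ∧
      lineNorm a X' ≤ ENNReal.ofReal (m * Real.exp ((a - b) * L)) * lineNorm a X := by
  obtain ⟨C, hC, H⟩ := h1.exists_bound_minus
  -- The tail constant is taken small enough to beat the bound C of the other solution operator; the
  -- +1 allows C = 0.
  obtain ⟨L₀, hL₀, H3⟩ := h3.exists_tail_bound_plus hab (ε := m / (C + 1)) (by positivity)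
  refine ⟨L₀, hL₀, fun L hL X Ψ Y Φ X' hX hΨ hΦ => ?_⟩
  have e1 := H3 L hL Ψ Y X hX hΨ
  have e2 := H _ _ _ hΦ a ⟨le_rfl, hab.le⟩
  have e3 : ENNReal.ofReal C * lineNorm a (fun z => Complex.exp (-Complex.I * z * L) * Y z)
      ≤ ENNReal.ofReal (m * Real.exp ((a - b) * L)) * lineNorm a X := by
    calc _ ≤ ENNReal.ofReal C * (ENNReal.ofReal (Real.exp (a * L))
          * (ENNReal.ofReal (m / (C + 1) * Real.exp (-b * L)) * lineNorm a X)) :=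
          mul_le_mul_right ((lineNorm_exp_minus_mul_le a L Y).trans (mul_le_mul_right e1 _)) _
      _ = ENNReal.ofReal (C * (Real.exp (a * L) * (m / (C + 1) * Real.exp (-b * L))))
          * lineNorm a X := by
        rw [ENNReal.ofReal_mul hC, ENNReal.ofReal_mul (Real.exp_pos _).le, mul_assoc, mul_assoc]
      _ ≤ _ := by
        refine mul_le_mul_left (ENNReal.ofReal_le_ofReal ?_) _
        have : Real.exp ((a - b) * L) = Real.exp (a * L) * Real.exp (-b * L) := by
          rw [← Real.exp_add]; ring_nf
        rw [this]
        have h5 : C * (m / (C + 1)) ≤ m := by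
          rw [← mul_div_assoc, div_le_iff₀ (by positivity)]
          nlinarith
        calc C * (Real.exp (a * L) * (m / (C + 1) * Real.exp (-b * L)))
            = C * (m / (C + 1)) * (Real.exp (a * L) * Real.exp (-b * L)) := by ring
          _ ≤ _ := by gcongr
  exact ⟨e2.1.trans e3, e2.2.trans e3⟩

/-- Four consecutive half-steps of the homogeneous scheme contract, on the upper line. -/
theorem exists_contraction_plus {K' Kp' Km' : ℂ → ℂ} (hab : a < b)
    (h1 : Factorisation a b K Kp Km) (h3 : Factorisation a b K' Kp' Km') {m : ℝ} (hm : 0 < m) :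
    ∃ L₀ : ℝ, 0 < L₀ ∧ ∀ L, L₀ ≤ L → ∀ Y Φ X Ψ Y', MinusClass b Y →
      MinusSolves a b K (fun z => Complex.exp (-Complex.I * z * L) * Y z) Φ X →
      PlusSolves a b K' (fun z => Complex.exp (Complex.I * z * L) * X z) Ψ Y' →
      lineNorm b Ψ ≤ ENNReal.ofReal (m * Real.exp ((a - b) * L)) * lineNorm b Y := by
  obtain ⟨L₀, hL₀, H⟩ := exists_contraction_minus (neg_lt_neg hab) h3.comp_neg h1.comp_neg hm
  refine ⟨L₀, hL₀, fun L hL Y Φ X Ψ Y' hY hΦ hΨ => ?_⟩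
  have e := (H L hL _ _ _ _ _ hY.comp_neg
    (hΦ.comp_neg.congr (R' := fun z => Complex.exp (Complex.I * z * L) * Y (-z)) fun z _ _ => by
      rw [show -Complex.I * -z * L = Complex.I * z * L by ring])
    (hΨ.comp_neg.congr (R' := fun z => Complex.exp (-Complex.I * z * L) * X (-z)) fun z _ _ => by
      rw [show Complex.I * -z * L = -Complex.I * z * L by ring])).1
  rw [lineNorm_comp_neg, lineNorm_comp_neg, neg_neg, neg_sub_neg] at e
  · exact e
  · rw [neg_neg]; exact hY.edge.1.1
  · rw [neg_neg]; exact (hΨ.plus.nice.lines b hab.le).1.1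

/-! ## The ratio -/

theorem norm_le_lineSup (h : ∃ B : ℝ, ∀ x : ℝ, ‖onLine c F x‖ ≤ B) (x : ℝ) :
    ‖onLine c F x‖ ≤ lineSup c F := by
  obtain ⟨B, hB⟩ := h
  exact le_ciSup (f := fun x => ‖onLine c F x‖) ⟨B, by rintro _ ⟨x, rfl⟩; exact hB x⟩ x

theorem lineSup_le {B : ℝ} (h : ∀ x : ℝ, ‖onLine c F x‖ ≤ B) : lineSup c F ≤ B :=
  ciSup_le h

/-- At a single point the product of the two values has modulus |E|, which gives the lower bound.
The bounds on F and 1/F give the upper one with a constant independent of L. -/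
theorem exists_lineSup_mul_bound {E : ℝ → ℂ → ℂ} {e : ℝ → ℝ}
    (hE : ∀ L x, ‖onLine c (E L) x‖ = e L) {J : Set ℝ} (hc : c ∈ J)
    (hF : ∃ M : ℝ, ∀ z : ℂ, z.im ∈ J → ‖F z‖ ≤ M)
    (hF' : ∃ M : ℝ, ∀ z : ℂ, z.im ∈ J → ‖(F z)⁻¹‖ ≤ M)
    (h0 : ∀ z : ℂ, z.im ∈ J → F z ≠ 0) :
    ∃ B : ℝ, 0 ≤ B ∧ ∀ L,
      e L ≤ lineSup c F * lineSup c (fun z => (F z)⁻¹ * E L z) ∧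
      lineSup c F * lineSup c (fun z => (F z)⁻¹ * E L z) ≤ B * e L := by
  obtain ⟨M, hM⟩ := hF
  obtain ⟨M', hM'⟩ := hF'
  have hm : ∀ x, ‖onLine c F x‖ ≤ M := fun x => hM _ (by rwa [onLine_im])
  have hn : ∀ L x, ‖onLine c (fun z => (F z)⁻¹ * E L z) x‖ = ‖(onLine c F x)⁻¹‖ * e L := fun L x => by
    rw [← hE L x, ← norm_mul]; rfl
  have hm' : ∀ L x, ‖onLine c (fun z => (F z)⁻¹ * E L z) x‖ ≤ M' * e L := fun L x => by
    rw [hn, ← hE L x]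
    exact mul_le_mul_of_nonneg_right (hM' _ (by rwa [onLine_im])) (norm_nonneg _)
  have hM0 : 0 ≤ M := (norm_nonneg _).trans (hm 0)
  have hM0' : 0 ≤ M' := (norm_nonneg _).trans (hM' ((0:ℝ) + c * Complex.I) (by rwa [onLine_im]))
  refine ⟨M * M', by positivity, fun L => ⟨?_, ?_⟩⟩
  · have h1 := norm_le_lineSup ⟨M, hm⟩ 0
    have h2 := norm_le_lineSup ⟨_, hm' L⟩ 0
    have h3 : onLine c F 0 ≠ 0 := h0 _ (by rwa [onLine_im])
    refine le_trans (le_of_eq ?_) (mul_le_mul h1 h2 (norm_nonneg _) ((norm_nonneg _).trans h1))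
    rw [hn, ← mul_assoc, ← norm_mul, mul_inv_cancel₀ h3, norm_one, one_mul]
  · have h1 := lineSup_le hm
    have h2 := lineSup_le (hm' L)
    rw [mul_assoc]
    exact mul_le_mul h1 h2 ((norm_nonneg _).trans (norm_le_lineSup ⟨_, hm' L⟩ 0)) hM0

end

section

variable {a b c L : ℝ} {F G H K Kp Km K' Kp' Km' P X f3 f4 : ℂ → ℂ}

/-! ## Existence of the exact solution -/

theorem lineNorm_sub_comm (c : ℝ) (F G : ℂ → ℂ) :
    lineNorm c (fun z => F z - G z) = lineNorm c fun z => G z - F z := by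
  rw [← lineNorm_neg]
  exact lineNorm_congr fun z _ => by ring

theorem lineNorm_sub_le (hF : AEStronglyMeasurable (onLine c F) volume)
    (hG : AEStronglyMeasurable (onLine c G) volume) (hH : AEStronglyMeasurable (onLine c H) volume) :
    lineNorm c (fun z => F z - H z)
      ≤ lineNorm c (fun z => F z - G z) + lineNorm c fun z => G z - H z := by
  rw [lineNorm_congr (F := fun z => F z - H z) (G := (fun z => F z - G z) + fun z => G z - H z)
    fun z _ => by simp]
  exact eLpNorm_add_le (hF.sub hG) (hG.sub hH) (by norm_num)

/-- Cauchy's formula with the L² bound for the Cauchy integral: norm convergence on the edge implies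
uniform convergence strictly above it. -/
theorem PlusClass.enorm_le (hP : PlusClass a P) (hac : a < c) {z : ℂ} (hz : c ≤ z.im) :
    ‖P z‖ₑ ≤ lineNorm a P * ENNReal.ofReal (Real.sqrt (Real.pi / (c - a))) := by
  have him : (z - a * Complex.I).im = z.im - a := by simp
  have h0 : 0 < z.im - a := by linarith
  have h1 := enorm_cauchyInt_le hP.edge.1 (w := z - a * Complex.I) (by rw [him]; exact h0.ne')
  rw [hP.cauchy_formula le_rfl (hac.trans_le hz), him, abs_of_pos h0, enorm_mul] at h1
  have h2 : (1 : ENNReal) ≤ ‖(2 * Real.pi * Complex.I : ℂ)‖ₑ := by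
    rw [← ofReal_norm, ENNReal.one_le_ofReal]
    simp only [norm_mul, Complex.norm_ofNat, Complex.norm_real, Complex.norm_I, mul_one,
      Real.norm_of_nonneg Real.pi_pos.le]
    linarith [Real.pi_gt_three]
  calc ‖P z‖ₑ ≤ ‖(2 * Real.pi * Complex.I : ℂ)‖ₑ * ‖P z‖ₑ := le_mul_of_one_le_left' h2
    _ ≤ _ := h1
    _ ≤ _ := by
      refine mul_le_mul_right (ENNReal.ofReal_le_ofReal (Real.sqrt_le_sqrt ?_)) _
      exact div_le_div_of_nonneg_left Real.pi_pos.le (by linarith) (by linarith)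

/-- Plus functions whose consecutive differences decrease geometrically on the edge converge
uniformly above it, to a multiplier. -/
theorem exists_limit_of_geometric (hac : a < c) {X : ℕ → ℂ → ℂ} (hX : ∀ n, PlusClass a (X n))
    {D : ENNReal} (hD : D ≠ ⊤)
    (hd : ∀ n, lineNorm a (fun z => X (n + 1) z - X n z) ≤ ENNReal.ofReal ((1 / 2) ^ n) * D) :
    ∃ (Y : ℂ → ℂ) (E : ℝ), 0 ≤ E ∧ Multiplier (Set.Ici c) Y ∧
      ∀ n, ∀ z : ℂ, c ≤ z.im → ‖X n z - Y z‖ ≤ E * (1 / 2) ^ n := by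
  -- Convergence is proved above an intermediate line, which leaves the room c − e for Cauchy's
  -- estimate of the derivative of the limit.
  obtain ⟨e, hae, hec⟩ := exists_between hac
  set B : ℝ := D.toReal * Real.sqrt (Real.pi / (e - a)) with hB
  have hB0 : 0 ≤ B := by positivity
  have hdist : ∀ z : ℂ, e ≤ z.im → ∀ n, dist (X n z) (X (n + 1) z) ≤ B * (1 / 2) ^ n := by
    intro z hz n
    have h1 := (((hX (n + 1)).sub (hX n)).enorm_le hae hz).trans (mul_le_mul_left (hd n) _)
    rw [← ENNReal.ofReal_toReal hD, ← ENNReal.ofReal_mul (by positivity),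
      ← ENNReal.ofReal_mul (by positivity), ← ofReal_norm,
      ENNReal.ofReal_le_ofReal_iff (by positivity)] at h1
    rw [dist_comm, dist_eq_norm]
    refine h1.trans_eq ?_
    rw [hB]; ring
  set Y : ℂ → ℂ := fun z => limUnder atTop fun n => X n z with hY
  have hlim : ∀ z : ℂ, e ≤ z.im → Tendsto (fun n => X n z) atTop (𝓝 (Y z)) := fun z hz =>
    tendsto_nhds_limUnder (cauchySeq_tendsto_of_complete
      (cauchySeq_of_le_geometric _ _ (by norm_num) (hdist z hz)))
  have hbd : ∀ n, ∀ z : ℂ, e ≤ z.im → ‖X n z - Y z‖ ≤ 2 * B * (1 / 2) ^ n := by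
    intro n z hz
    have := dist_le_of_le_geometric_of_tendsto _ _ (by norm_num) (hdist z hz) (hlim z hz) n
    rw [dist_eq_norm] at this
    refine this.trans_eq ?_
    ring
  refine ⟨Y, 2 * B, by positivity, ?_, fun n z hz => hbd n z (hec.le.trans hz)⟩
  obtain ⟨M, hM⟩ := (hX 0).nice.bdd
  refine multiplier_of_bounded (U := Set.Ioi e) isOpen_Ioi (δ := c - e) (M := M + 2 * B)
    (sub_pos.2 hec) ?_ ?_ ?_
  · intro x hx y hy
    rw [Metric.mem_ball, Real.dist_eq] at hy
    have h1 : c ≤ x := hx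
    have h2 := (abs_lt.1 hy).1
    simp only [Set.mem_Ioi]
    linarith
  · have hU : IsOpen (Complex.im ⁻¹' Set.Ioi e) := isOpen_Ioi.preimage Complex.continuous_im
    have hu : TendstoUniformlyOn X Y atTop (Complex.im ⁻¹' Set.Ioi e) := by
      rw [Metric.tendstoUniformlyOn_iff]
      intro ε hε
      have h1 : Tendsto (fun n : ℕ => 2 * B * (1 / 2 : ℝ) ^ n) atTop (𝓝 (2 * B * 0)) :=
        (tendsto_pow_atTop_nhds_zero_of_lt_one (by norm_num) (by norm_num)).const_mul _
      rw [mul_zero] at h1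
      filter_upwards [h1.eventually (gt_mem_nhds hε)] with n hn z hz
      rw [dist_comm, dist_eq_norm]
      exact (hbd n z (le_of_lt hz)).trans_lt hn
    refine hu.tendstoLocallyUniformlyOn.differentiableOn (Eventually.of_forall fun n => ?_) hU
    refine (hX n).nice.diff.mono (Set.preimage_mono ?_)
    rw [interior_Ici]
    exact Set.Ioi_subset_Ioi hae.le
  · intro z hz
    have hz' : e ≤ z.im := le_of_lt hz
    have h1 := hbd 0 z hz'
    have h2 := hM z (hae.le.trans hz')
    have h3 := norm_sub_le (X 0 z) (X 0 z - Y z)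
    rw [sub_sub_cancel] at h3
    rw [pow_zero, mul_one] at h1
    linarith

theorem nice_exp_plus_mul (hL : 0 ≤ L) (hX : PlusClass a X) :
    Nice (Set.Icc a b) fun z => Complex.exp (Complex.I * z * L) * X z :=
  ((multiplier_exp_plus a hL).mul_nice hX.nice).mono Set.Icc_subset_Ici_self

theorem nice_exp_minus_mul {Y : ℂ → ℂ} (hL : 0 ≤ L) (hY : MinusClass b Y) :
    Nice (Set.Icc a b) fun z => Complex.exp (-Complex.I * z * L) * Y z :=
  ((multiplier_exp_minus b hL).mul_nice hY.nice).mono Set.Icc_subset_Iic_self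

/-- A pair of coupled scalar equations has a solution if the homogeneous scheme contracts. -/
theorem exists_coupled_solution (hab : a < b) (h1 : Factorisation a b K Kp Km)
    (h3 : Factorisation a b K' Kp' Km') (hL : 0 ≤ L) (hf3 : Nice (Set.Icc a b) f3)
    (hf4 : Nice (Set.Icc a b) f4)
    (hcontr : ∀ X Ψ Y Φ X', PlusClass a X →
      PlusSolves a b K' (fun z => Complex.exp (Complex.I * z * L) * X z) Ψ Y →
      MinusSolves a b K (fun z => Complex.exp (-Complex.I * z * L) * Y z) Φ X' →
      lineNorm a X' ≤ ENNReal.ofReal (1 / 2) * lineNorm a X) :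
    ∃ Φ X Ψ Y,
      MinusSolves a b K (fun z => f3 z + Complex.exp (-Complex.I * z * L) * Y z) Φ X ∧
      PlusSolves a b K' (fun z => Complex.exp (Complex.I * z * L) * X z - f4 z) Ψ Y := by
  have hPlus : ∀ X, PlusClass a X → ∃ Ψ Y,
      PlusSolves a b K' (fun z => Complex.exp (Complex.I * z * L) * X z - f4 z) Ψ Y := fun X hX =>
    h3.exists_plusSolves hab ((nice_exp_plus_mul hL hX).sub hf4)
  have hMinus : ∀ Y, MinusClass b Y → ∃ Φ X,
      MinusSolves a b K (fun z => f3 z + Complex.exp (-Complex.I * z * L) * Y z) Φ X := fun Y hY =>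
    h1.exists_minusSolves hab (hf3.add (nice_exp_minus_mul hL hY))
  have step : ∀ X : {X // PlusClass a X}, ∃ Ψ Y Φ, ∃ X' : {X // PlusClass a X},
      PlusSolves a b K' (fun z => Complex.exp (Complex.I * z * L) * X.1 z - f4 z) Ψ Y ∧
      MinusSolves a b K (fun z => f3 z + Complex.exp (-Complex.I * z * L) * Y z) Φ X'.1 := by
    rintro ⟨X, hX⟩
    obtain ⟨Ψ, Y, hΨ⟩ := hPlus X hX
    obtain ⟨Φ, X', hΦ⟩ := hMinus Y hΨ.minus
    exact ⟨Ψ, Y, Φ, ⟨X', hΦ.plus⟩, hΨ, hΦ⟩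
  choose Ψs Ys Φs T hΨs hΦs using step
  -- The iteration starts from X = 0; one step solves for (Ψ, Y) and then for (Φ, X').
  set x : ℕ → {X // PlusClass a X} := fun n => T^[n] ⟨fun _ => 0, (nice_zero _).plusClass⟩ with hx
  have hxs : ∀ n, x (n + 1) = T (x n) := fun n => Function.iterate_succ_apply' _ _ _
  set Y : ℕ → ℂ → ℂ := fun n => Ys (x n) with hYdef
  have hYs : ∀ n, PlusSolves a b K' (fun z => Complex.exp (Complex.I * z * L) * (x n).1 z - f4 z)
      (Ψs (x n)) (Y n) := fun n => hΨs (x n)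
  have hXs : ∀ n, MinusSolves a b K (fun z => f3 z + Complex.exp (-Complex.I * z * L) * Y n z)
      (Φs (x n)) (x (n + 1)).1 := fun n => by rw [hxs]; exact hΦs (x n)
  have hYm : ∀ n, MinusClass b (Y n) := fun n => (hYs n).minus
  set D := lineNorm a fun z => (x 1).1 z - (x 0).1 z with hD
  have hDtop : D ≠ ⊤ := ((x 1).2.sub (x 0).2).edge.1.2.ne
  have hgeo : ∀ n, lineNorm a (fun z => (x (n + 1)).1 z - (x n).1 z)
      ≤ ENNReal.ofReal ((1 / 2) ^ n) * D := by
    intro n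
    induction n with
    | zero => simp [hD]
    | succ n ih =>
      have e := hcontr _ _ _ _ _ ((x (n + 1)).2.sub (x n).2)
        (((hYs (n + 1)).sub (hYs n)).congr fun z _ _ => by ring)
        (((hXs (n + 1)).sub (hXs n)).congr fun z _ _ => by ring)
      refine e.trans ((mul_le_mul_right ih _).trans_eq ?_)
      rw [← mul_assoc, ← ENNReal.ofReal_mul (by norm_num), pow_succ']
  obtain ⟨c, hac, hcb⟩ := exists_between hab
  have hcI : c ∈ Set.Icc a b := ⟨hac.le, hcb.le⟩
  obtain ⟨Xl, E, hE0, hXl, hE⟩ := exists_limit_of_geometric hac (fun n => (x n).2) hDtop hgeo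
  -- In 1/K'₋ = 1 + h the term 1 may be dropped before projecting, because e^{izL} times an iterate
  -- is a plus function. This matters in the limit: `Xl` is only known to be a multiplier, and the
  -- factor h makes the product nice.
  set h : ℂ → ℂ := fun z => (Km' z)⁻¹ - 1 with hh
  have hsub : Set.Icc c b ⊆ Set.Icc a b := Set.Icc_subset_Icc_left hac.le
  have hnice : Nice (Set.Icc c b) fun z => Complex.exp (Complex.I * z * L) * Xl z * h z
      - (Km' z)⁻¹ * f4 z :=
    ((((multiplier_exp_plus c hL).mul hXl).mono Set.Icc_subset_Ici_self).mul_nice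
      (h3.minus_inv.mono Set.Icc_subset_Iic_self)).sub
      ((h3.minus_inv.multiplier_of_sub_one.mono Set.Icc_subset_Iic_self).mul_nice (hf4.mono hsub))
  obtain ⟨P, M, hP, hM, hPM⟩ := hnice.stripClass hcb
  -- The candidate limit of Y, obtained on the smaller strip c ≤ Im z ≤ b. As a minus function it
  -- still has the full edge regularity at b.
  set Yl : ℂ → ℂ := fun z => -(Km' z * M z) with hYl
  have hYlm : MinusClass b Yl := (hM.mul h3.minus.multiplier_of_sub_one).neg
  obtain ⟨Mk, hMk⟩ := h3.minus.multiplier_of_sub_one.bdd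
  have hhc : lineNorm c h ≠ ⊤ := (h3.minus_inv.lines c hcb.le).1.2.ne
  have hPc : ∀ {X}, PlusClass a X → PlusClass c X := fun hX =>
    (hX.nice.mono (Set.Ici_subset_Ici.2 hac.le)).plusClass
  have hKpc : Multiplier (Set.Ici c) Kp' :=
    h3.plus.multiplier_of_sub_one.mono (Set.Ici_subset_Ici.2 hac.le)
  have hYn : ∀ n, lineNorm c (fun z => Y n z - Yl z) ≤ ENNReal.ofReal Mk
      * (ENNReal.ofReal (Real.exp (-c * L) * (E * (1 / 2) ^ n)) * lineNorm c h) := by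
    intro n
    -- The nth equation divided by K'₋ minus the splitting that defines `Yl`: its plus and minus
    -- parts add up to e^{izL}(Xₙ − Xl)h on the line c.
    have e1 := (lineNorm_le_add (((hPc (hYs n).plus).mul hKpc).sub
      ((hPc (x n).2).mul (multiplier_exp_plus c hL)) |>.sub hP)
      (((hYm n).mul h3.minus_inv.multiplier_of_sub_one).neg.sub hM) le_rfl hcb.le).2
    rw [lineNorm_congr (F := fun z => _ + _)
      (G := fun z => Complex.exp (Complex.I * z * L) * ((x n).1 z - Xl z) * h z) fun z hz => ?_] at e1
    · rw [lineNorm_congr (F := fun z => Y n z - Yl z)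
        (G := fun z => -(Km' z * (-((Km' z)⁻¹ * Y n z) - M z))) fun z hz => ?_, lineNorm_neg]
      · refine (lineNorm_mul_le_of_bound hMk hcb.le).trans (mul_le_mul_right (e1.trans ?_) _)
        refine lineNorm_mul_le (F := fun z => Complex.exp (Complex.I * z * L) * ((x n).1 z - Xl z))
          fun t => ?_
        rw [onLine, norm_mul, norm_exp_I_mul, onLine_im]
        exact mul_le_mul_of_nonneg_left (hE n _ (by rw [onLine_im])) (Real.exp_pos _).le
      · have := h3.minus_ne z (by rw [hz]; exact hcb.le)
        rw [hYl]
        field_simp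
        ring
    · have e2 := (hYs n).eq z (by rw [hz]; exact hac.le) (by rw [hz]; exact hcb.le)
      have e3 := hPM z hz.ge (by rw [hz]; exact hcb.le)
      have hne := h3.minus_ne z (by rw [hz]; exact hcb.le)
      rw [h3.eq z (by rw [hz]; exact hac.le) (by rw [hz]; exact hcb.le)] at e2
      have e4 : Kp' z * Ψs (x n) z = (Km' z)⁻¹
          * (Y n z + (Complex.exp (Complex.I * z * L) * (x n).1 z - f4 z)) := by
        rw [← e2]; field_simp
      simp only [hh] at e3 ⊢
      linear_combination e4 + e3
  have hY0 : Tendsto (fun n => lineNorm c fun z => Y n z - Yl z) atTop (𝓝 0) := by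
    have t1 : Tendsto (fun n : ℕ => Real.exp (-c * L) * (E * (1 / 2 : ℝ) ^ n)) atTop (𝓝 0) := by
      simpa using (((tendsto_pow_atTop_nhds_zero_of_lt_one (r := (1 / 2 : ℝ)) (by norm_num)
        (by norm_num)).const_mul E).const_mul (Real.exp (-c * L)))
    have t2 := ENNReal.Tendsto.const_mul (a := ENNReal.ofReal Mk)
      (ENNReal.Tendsto.mul_const (b := lineNorm c h) (ENNReal.tendsto_ofReal t1) (Or.inr hhc))
      (Or.inr ENNReal.ofReal_ne_top)
    rw [ENNReal.ofReal_zero, zero_mul, mul_zero] at t2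
    exact tendsto_of_tendsto_of_tendsto_of_le_of_le tendsto_const_nhds t2 (fun _ => zero_le) hYn
  -- One exact cycle from `Yl`. It remains to see that it returns `Yl`, and this is tested on the
  -- line c, where the cycle is bounded and Yₙ → Yl.
  obtain ⟨Φ, X', hΦ⟩ := hMinus Yl hYlm
  obtain ⟨Ψ, Y', hΨ⟩ := hPlus X' hΦ.plus
  obtain ⟨C1, hC1, H1⟩ := h1.exists_bound_minus
  obtain ⟨C3, hC3, H3⟩ := h3.exists_bound_plus
  have hbound : ∀ n, lineNorm c (fun z => Y' z - Yl z) ≤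
      ENNReal.ofReal C3 * (ENNReal.ofReal (Real.exp (-c * L)) * (ENNReal.ofReal C1
        * (ENNReal.ofReal (Real.exp (c * L)) * lineNorm c fun z => Y n z - Yl z)))
      + lineNorm c fun z => Y (n + 1) z - Yl z := by
    intro n
    refine (lineNorm_sub_le (G := Y (n + 1)) (hΨ.minus.nice.lines c hcb.le).1.1
      ((hYm (n + 1)).nice.lines c hcb.le).1.1 (hYlm.nice.lines c hcb.le).1.1).trans ?_
    refine add_le_add_left ?_ _
    have s1 := (hXs n).sub hΦ
    have e1 := (H1 _ _ _ (s1.congr (R' := fun z => Complex.exp (-Complex.I * z * L)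
      * (Y n z - Yl z)) fun z _ _ => by ring) c hcI).2
    have s2 := (hΨ.sub (hYs (n + 1))).congr (R' := fun z => Complex.exp (Complex.I * z * L)
      * (X' z - (x (n + 1)).1 z)) fun z _ _ => by ring
    have e2 := (H3 _ _ _ (nice_exp_plus_mul hL (hΦ.plus.sub (x (n + 1)).2)) s2 c hcI).2
    refine e2.trans (mul_le_mul_right ((lineNorm_exp_plus_mul_le c L _).trans
      (mul_le_mul_right ?_ _)) _)
    rw [lineNorm_sub_comm]
    exact e1.trans (mul_le_mul_right (lineNorm_exp_minus_mul_le c L _) _)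
  have hzero : lineNorm c (fun z => Y' z - Yl z) = 0 := by
    have t : Tendsto (fun n => ENNReal.ofReal C3 * (ENNReal.ofReal (Real.exp (-c * L))
        * (ENNReal.ofReal C1 * (ENNReal.ofReal (Real.exp (c * L))
          * lineNorm c fun z => Y n z - Yl z)))
        + lineNorm c fun z => Y (n + 1) z - Yl z) atTop (𝓝 0) := by
      have hm : ∀ {u : ℕ → ENNReal} (r : ℝ), Tendsto u atTop (𝓝 0) →
          Tendsto (fun n => ENNReal.ofReal r * u n) atTop (𝓝 0) := fun r hu => by
        simpa using ENNReal.Tendsto.const_mul (a := ENNReal.ofReal r) hu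
          (Or.inr ENNReal.ofReal_ne_top)
      simpa using (hm C3 (hm _ (hm C1 (hm _ hY0)))).add ((tendsto_add_atTop_iff_nat 1).2 hY0)
    exact le_antisymm (ge_of_tendsto' t hbound) zero_le
  have hYY := (hΨ.minus.sub hYlm).eq_zero_of_lineNorm hcb.le hzero
  exact ⟨Φ, X', Ψ, Y', hΦ.congr fun z _ hzb => by rw [sub_eq_zero.1 (hYY z hzb)], hΨ⟩

end

section

variable {a b L : ℝ} {A B C : ℂ → ℂ} {s : Parts} {g : Forcing}

/-! ## The splittings of the coefficients -/

/-- Parts with well-behaved inverse factors. -/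
structure GoodParts (a b : ℝ) (A B C : ℂ → ℂ) (s : Parts) : Prop extends
    IsParts a b A B C s where
  B_fac : Factorisation a b B s.Bplus s.Bminus
  K1_fac : Factorisation a b (K1 A C s) s.K1plus s.K1minus
  K3_fac : Factorisation a b (K3 A s) s.K3plus s.K3minus

/-- The logarithms of A/(CB₋) and A/B₋ are differences of the logarithms of A, C and B₋, so these
quotients factorise, and their exponentials minus 1 split additively. -/
theorem exists_goodParts (ha : a < 0) (hb : 0 < b) (hA : Coefficient a b A)
    (hB : Coefficient a b B) (hC : Coefficient a b C) : ∃ s, GoodParts a b A B C s := by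
  have hab : a < b := ha.trans hb
  obtain ⟨ℓA, hℓA, hAe⟩ := hA.exists_log ha hb
  obtain ⟨ℓB, hℓB, hBe⟩ := hB.exists_log ha hb
  obtain ⟨ℓC, hℓC, hCe⟩ := hC.exists_log ha hb
  obtain ⟨Bp, Bm, hBp, hBm, hBf⟩ := exists_factorisation hab hℓB hBe
  have hn1 := (hℓA.sub hℓC).sub (hBm.mono (Set.Icc_subset_Iic_self (a := a)))
  have hn3 := hℓA.sub (hBm.mono (Set.Icc_subset_Iic_self (a := a)))
  have hK1 : ∀ z : ℂ, z.im ∈ Set.Icc a b → A z / (C z * Complex.exp (Bm z))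
      = Complex.exp (ℓA z - ℓC z - Bm z) := fun z hz => by
    rw [hAe z hz, hCe z hz, ← Complex.exp_add, ← Complex.exp_sub]
    ring_nf
  have hK3 : ∀ z : ℂ, z.im ∈ Set.Icc a b → A z / Complex.exp (Bm z)
      = Complex.exp (ℓA z - Bm z) := fun z hz => by
    rw [hAe z hz, ← Complex.exp_sub]
  obtain ⟨l1p, l1m, -, -, h1f⟩ := exists_factorisation hab hn1 hK1
  obtain ⟨l3p, l3m, -, -, h3f⟩ := exists_factorisation hab hn3 hK3
  obtain ⟨P1, M1, h1⟩ := hn1.exp_sub_one.stripClass hab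
  obtain ⟨P3, M3, h3⟩ := hn3.exp_sub_one.stripClass hab
  -- The constant 1 is restored to K₁⁻ and to K₃⁺.
  refine ⟨⟨_, _, _, _, _, _, P1, fun z => M1 z + 1, fun z => P3 z + 1, M3⟩,
    ⟨hBf.isMulSplit, h1f.isMulSplit, h3f.isMulSplit, ?_, ?_⟩, hBf, h1f, h3f⟩
  · simp only [add_sub_cancel_right]
    exact h1.congr fun z hza hzb => by rw [← hK1 z ⟨hza, hzb⟩]; rfl
  · simp only [add_sub_cancel_right]
    exact h3.congr fun z hza hzb => by rw [← hK3 z ⟨hza, hzb⟩]; rfl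

namespace GoodParts

theorem K1_eq (hs : GoodParts a b A B C s) (z : ℂ) (hza : a ≤ z.im) (hzb : z.im ≤ b) :
    K1 A C s z = s.K1p z + s.K1m z := by
  linear_combination hs.K1_add.eq z hza hzb

theorem K3_eq (hs : GoodParts a b A B C s) (z : ℂ) (hza : a ≤ z.im) (hzb : z.im ≤ b) :
    K3 A s z = s.K3p z + s.K3m z := by
  linear_combination hs.K3_add.eq z hza hzb

theorem K1p_mul (hs : GoodParts a b A B C s) : Multiplier (Set.Ici a) s.K1p :=
  hs.K1_add.plus.nice.multiplier

theorem K1m_mul (hs : GoodParts a b A B C s) : Multiplier (Set.Iic b) s.K1m :=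
  hs.K1_add.minus.nice.multiplier_of_sub_one

theorem K3p_mul (hs : GoodParts a b A B C s) : Multiplier (Set.Ici a) s.K3p :=
  hs.K3_add.plus.nice.multiplier_of_sub_one

theorem K3m_mul (hs : GoodParts a b A B C s) : Multiplier (Set.Iic b) s.K3m :=
  hs.K3_add.minus.nice.multiplier

theorem exists_forcing (hs : GoodParts a b A B C s) (hab : a < b) (hL : 0 ≤ L) {f1 f2 : ℂ → ℂ}
    (hf1 : StripClass a b f1) (hf2 : StripClass a b f2) :
    ∃ g, IsForcing a b L A C f1 f2 s g := by
  have hBi : Multiplier (Set.Icc a b) fun z => (s.Bminus z)⁻¹ :=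
    hs.B_fac.minus_inv.multiplier_of_sub_one.mono Set.Icc_subset_Iic_self
  have hexp := (multiplier_exp_minus b hL).mono (Set.Icc_subset_Iic_self (a := a))
  have hK1 : Multiplier (Set.Icc a b) fun z => A z / (C z * s.Bminus z) :=
    ((hs.K1p_mul.mono Set.Icc_subset_Ici_self).add
      (hs.K1m_mul.mono Set.Icc_subset_Iic_self)).congr fun z hz => (hs.K1_eq z hz.1 hz.2).symm
  have h4 := hBi.mul_nice hf1.nice
  obtain ⟨P3, M3, h3⟩ := (((hexp.mul_nice h4).neg.add (hK1.mul_nice hf2.nice)).stripClass hab)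
  obtain ⟨P4, M4, h4⟩ := h4.stripClass hab
  refine ⟨⟨P3, M3, P4, M4⟩, h3.congr fun z _ _ => ?_, h4.congr fun z _ _ => ?_⟩
  · rw [div_eq_mul_inv]; ring
  · rw [div_eq_mul_inv, mul_comm]

end GoodParts

/-! ## The scheme -/

/-- The minus half-step, in terms of the parts `Dp` of `K₁⁺ Φ` and `Em` of `K₃⁻ Ψ`. -/
def PhiStep (a b L : ℝ) (A C : ℂ → ℂ) (s : Parts) (g : Forcing) (Em Φ Dp : ℂ → ℂ) : Prop :=
  MinusSolves a b (K1 A C s)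
    (fun z => g.f3m z + Complex.exp (-Complex.I * z * L) * (Em z + g.f4m z)) Φ Dp

/-- The plus half-step, in terms of the parts `Dp` of `K₁⁺ Φ` and `Em` of `K₃⁻ Ψ`. -/
def PsiStep (a b L : ℝ) (A : ℂ → ℂ) (s : Parts) (g : Forcing) (Dp Ψ Em : ℂ → ℂ) : Prop :=
  PlusSolves a b (K3 A s)
    (fun z => -g.f4p z + Complex.exp (Complex.I * z * L) * (Dp z - g.f3p z)) Ψ Em

variable {f1 f2 Φ Φ' Ψ Ψ' Dp Dm Ep Em : ℂ → ℂ}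

/-! ### Half-steps as scalar equations, and their solvability. -/

theorem GoodParts.phiStep (hs : GoodParts a b A B C s) (hg : IsForcing a b L A C f1 f2 s g)
    (hab : a < b) (hL : 0 ≤ L) (hΦ : MinusClass b Φ)
    (hD : IsAddSplit a b (fun z => s.K1p z * Φ z) Dp Dm)
    (hE : IsAddSplit a b (fun z => s.K3m z * Ψ z) Ep Em) (h : PhiEquation a b L s g Ψ Φ) :
    PhiStep a b L A C s g Em Φ Dp := by
  obtain ⟨Dp', Dm', Ep', Em', hD', hE', he⟩ := h
  refine minusSolves_of_line hab.le hs.K1m_mul hs.K1_eq hΦ hD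
    (hg.f3.minus.add ((hE.minus.add hg.f4.minus).mul (multiplier_exp_minus b hL))) fun z hz => ?_
  have hzb : z.im ≤ b := by rw [hz]; exact hab.le
  rw [he z hz, (hD.unique hab.le hD').2 z hzb, (hE.unique hab.le hE').2 z hzb]
  ring

theorem GoodParts.psiStep (hs : GoodParts a b A B C s) (hg : IsForcing a b L A C f1 f2 s g)
    (hab : a < b) (hL : 0 ≤ L) (hΨ : PlusClass a Ψ)
    (hD : IsAddSplit a b (fun z => s.K1p z * Φ z) Dp Dm)
    (hE : IsAddSplit a b (fun z => s.K3m z * Ψ z) Ep Em) (h : PsiEquation a b L s g Φ Ψ) :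
    PsiStep a b L A s g Dp Ψ Em := by
  obtain ⟨Dp', Dm', Ep', Em', hD', hE', he⟩ := h
  refine plusSolves_of_line hab.le hs.K3p_mul hs.K3_eq hΨ hE
    (hg.f4.plus.neg.add ((hD.plus.sub hg.f3.plus).mul (multiplier_exp_plus a hL))) fun z hz => ?_
  have hza : a ≤ z.im := by rw [hz]; exact hab.le
  rw [he z hz, (hD.unique hab.le hD').1 z hza, (hE.unique hab.le hE').1 z hza]
  ring

theorem GoodParts.exists_split_phi (hs : GoodParts a b A B C s) (hab : a < b)
    (hΦ : MinusClass b Φ) : ∃ Dp Dm, IsAddSplit a b (fun z => s.K1p z * Φ z) Dp Dm :=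
  ((hs.K1p_mul.mono Set.Icc_subset_Ici_self).mul_nice
    (hΦ.nice.mono Set.Icc_subset_Iic_self)).stripClass hab

theorem GoodParts.exists_split_psi (hs : GoodParts a b A B C s) (hab : a < b)
    (hΨ : PlusClass a Ψ) : ∃ Ep Em, IsAddSplit a b (fun z => s.K3m z * Ψ z) Ep Em :=
  ((hs.K3m_mul.mono Set.Icc_subset_Iic_self).mul_nice
    (hΨ.nice.mono Set.Icc_subset_Ici_self)).stripClass hab

theorem GoodParts.exists_psiEquation (hs : GoodParts a b A B C s)
    (hg : IsForcing a b L A C f1 f2 s g) (hab : a < b) (hL : 0 ≤ L) (hΦ : MinusClass b Φ) :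
    ∃ Ψ, PlusClass a Ψ ∧ PsiEquation a b L s g Φ Ψ := by
  obtain ⟨Dp, Dm, hD⟩ := hs.exists_split_phi hab hΦ
  have hN := hg.f4.plus.neg.add ((hD.plus.sub hg.f3.plus).mul (multiplier_exp_plus a hL))
  obtain ⟨Ψ, Em, h⟩ := hs.K3_fac.exists_plusSolves hab (hN.nice.mono Set.Icc_subset_Ici_self)
  exact ⟨Ψ, h.plus, Dp, Dm, _, Em, hD, h.isAddSplit hN hs.K3p_mul hs.K3_eq, fun z _ => by ring⟩

theorem GoodParts.exists_phiEquation (hs : GoodParts a b A B C s)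
    (hg : IsForcing a b L A C f1 f2 s g) (hab : a < b) (hL : 0 ≤ L) (hΨ : PlusClass a Ψ) :
    ∃ Φ, MinusClass b Φ ∧ PhiEquation a b L s g Ψ Φ := by
  obtain ⟨Ep, Em, hE⟩ := hs.exists_split_psi hab hΨ
  have hN := hg.f3.minus.add ((hE.minus.add hg.f4.minus).mul (multiplier_exp_minus b hL))
  obtain ⟨Φ, Dp, h⟩ := hs.K1_fac.exists_minusSolves hab (hN.nice.mono Set.Icc_subset_Iic_self)
  exact ⟨Φ, h.minus, Dp, _, Ep, Em, h.isAddSplit hN hs.K1m_mul hs.K1_eq, hE, fun z _ => by ring⟩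

theorem GoodParts.exists_firstApprox (hs : GoodParts a b A B C s)
    (hg : IsForcing a b L A C f1 f2 s g) (hab : a < b) :
    ∃ Φ, MinusClass b Φ ∧ FirstApprox a b s g Φ := by
  obtain ⟨Φ, Dp, h⟩ := hs.K1_fac.exists_minusSolves hab
    (hg.f3.minus.nice.mono Set.Icc_subset_Iic_self)
  exact ⟨Φ, h.minus, Dp, _, h.isAddSplit hg.f3.minus hs.K1m_mul hs.K1_eq, fun z _ => by ring⟩

theorem GoodParts.exists_iteration (hs : GoodParts a b A B C s)
    (hg : IsForcing a b L A C f1 f2 s g) (hab : a < b) (hL : 0 ≤ L) {Φ₀ : ℂ → ℂ}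
    (hΦ₀ : MinusClass b Φ₀) :
    ∃ Φ Ψ : ℕ → ℂ → ℂ, Φ 0 = Φ₀ ∧ IsIteration a b L s g Φ Ψ := by
  have h1 : ∀ Φ : {Φ // MinusClass b Φ}, ∃ Ψ : {Ψ // PlusClass a Ψ},
      PsiEquation a b L s g Φ.1 Ψ.1 := fun Φ => by
    obtain ⟨Ψ, hΨ, h⟩ := hs.exists_psiEquation hg hab hL Φ.2
    exact ⟨⟨Ψ, hΨ⟩, h⟩
  have h2 : ∀ Ψ : {Ψ // PlusClass a Ψ}, ∃ Φ : {Φ // MinusClass b Φ},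
      PhiEquation a b L s g Ψ.1 Φ.1 := fun Ψ => by
    obtain ⟨Φ, hΦ, h⟩ := hs.exists_phiEquation hg hab hL Ψ.2
    exact ⟨⟨Φ, hΦ⟩, h⟩
  choose S hS using h1
  choose T hT using h2
  set x : ℕ → {Φ // MinusClass b Φ} := fun n => (T ∘ S)^[n] ⟨Φ₀, hΦ₀⟩ with hx
  have hxs : ∀ n, x (n + 1) = T (S (x n)) := fun n => Function.iterate_succ_apply' _ _ _
  -- The shift makes Ψ (n + 1) the function computed from Φ n; the value at 0 is a dummy.
  refine ⟨fun n => (x n).1, fun n => (S (x (n - 1))).1, rfl, fun n => (x n).2,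
    fun n => (S _).2, fun n => hS _, fun n => ?_⟩
  simp only [hxs, add_tsub_cancel_right]
  exact hT _

/-- An exact solution is a fixed point of the scheme: it satisfies both half-step equations with the
same auxiliary parts. -/
theorem GoodParts.exact_steps (hs : GoodParts a b A B C s) (hg : IsForcing a b L A C f1 f2 s g)
    (hC : ∀ z : ℂ, a ≤ z.im → z.im ≤ b → C z ≠ 0) {Φ0 ΦL Ψ0 ΨL : ℂ → ℂ} (h : IsExactSolution a b L A B C f1 f2 Φ0 ΦL Ψ0 ΨL) :
    ∃ Dp Em, PsiStep a b L A s g Dp Ψ0 Em ∧ PhiStep a b L A C s g Em ΦL Dp := by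
  have hee : ∀ z : ℂ, Complex.exp (-Complex.I * z * L) * Complex.exp (Complex.I * z * L) = 1 :=
    fun z => by rw [← Complex.exp_add]; ring_nf; exact Complex.exp_zero
  -- Chosen so that Dp − f₃⁺ = −B₊Ψᴸ and Em + f₄⁻ = Φ⁰/B₋, the combinations that occur in the two
  -- rows after division by B₋.
  refine ⟨fun z => g.f3p z - s.Bplus z * ΨL z, fun z => (s.Bminus z)⁻¹ * Φ0 z - g.f4m z,
    ⟨h.Ψ0_mem, (h.Φ0_mem.mul hs.B_fac.minus_inv.multiplier_of_sub_one).sub hg.f4.minus,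
      fun z hza hzb => ?_⟩,
    ⟨h.ΦL_mem, hg.f3.plus.sub (h.ΨL_mem.mul hs.B_fac.plus.multiplier_of_sub_one),
      fun z hza hzb => ?_⟩⟩
  · have e1 := h.row1 z hza hzb
    have e2 := hg.f4.eq z hza hzb
    have hBm := hs.B_fac.minus_ne z hzb
    rw [hs.B_fac.eq z hza hzb] at e1
    rw [K3, e1]
    field_simp at e2 ⊢
    linear_combination -e2
  · have e1 := h.row1 z hza hzb
    have e2 := h.row2 z hza hzb
    have e3 := hg.f3.eq z hza hzb
    have hBm := hs.B_fac.minus_ne z hzb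
    have hCz := hC z hza hzb
    rw [hs.B_fac.eq z hza hzb] at e1
    have e4 := hee z
    simp only
    rw [K1, e2, e1]
    generalize Complex.exp (-Complex.I * z * L) = p at *
    generalize Complex.exp (Complex.I * z * L) = r at *
    field_simp at e3 ⊢
    linear_combination e3 - s.Bplus z * s.Bminus z * C z * ΨL z * e4

/-- Undoing the elimination: Φ⁰ = B₋Y and Ψᴸ = −X/B₊ recover the remaining unknowns from a solution
of the coupled scalar equations. -/
theorem GoodParts.exists_exactSolution (hs : GoodParts a b A B C s)
    (hg : IsForcing a b L A C f1 f2 s g) (hab : a < b) (hL : 0 ≤ L)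
    (hA : ∀ z : ℂ, a ≤ z.im → z.im ≤ b → A z ≠ 0)
    (hC : ∀ z : ℂ, a ≤ z.im → z.im ≤ b → C z ≠ 0)
    (hcontr : ∀ X Ψ Y Φ X', PlusClass a X →
      PlusSolves a b (K3 A s) (fun z => Complex.exp (Complex.I * z * L) * X z) Ψ Y →
      MinusSolves a b (K1 A C s) (fun z => Complex.exp (-Complex.I * z * L) * Y z) Φ X' →
      lineNorm a X' ≤ ENNReal.ofReal (1 / 2) * lineNorm a X) :
    ∃ Φ0 ΦL Ψ0 ΨL, IsExactSolution a b L A B C f1 f2 Φ0 ΦL Ψ0 ΨL := by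
  have hee : ∀ z : ℂ, Complex.exp (-Complex.I * z * L) * Complex.exp (Complex.I * z * L) = 1 :=
    fun z => by rw [← Complex.exp_add]; ring_nf; exact Complex.exp_zero
  obtain ⟨Φ, X, Ψ, Y, hΦ, hΨ⟩ := exists_coupled_solution hab hs.K1_fac hs.K3_fac hL
    (StripClass.nice ⟨_, _, hg.f3⟩) (StripClass.nice ⟨_, _, hg.f4⟩) hcontr
  refine ⟨fun z => s.Bminus z * Y z, Φ, Ψ, fun z => -((s.Bplus z)⁻¹ * X z),
    hΨ.minus.mul hs.B_fac.minus.multiplier_of_sub_one, hΦ.minus, hΨ.plus,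
    (hΦ.plus.mul hs.B_fac.plus_inv.multiplier_of_sub_one).neg, fun z hza hzb => ?_,
    fun z hza hzb => ?_⟩
  · have e1 := hΨ.eq z hza hzb
    have hBm := hs.B_fac.minus_ne z hzb
    have hBp := hs.B_fac.plus_ne z hza
    rw [K3] at e1
    rw [hs.B_fac.eq z hza hzb]
    field_simp at e1 ⊢
    linear_combination -e1
  · have e1 := hΨ.eq z hza hzb
    have e2 := hΦ.eq z hza hzb
    have hBm := hs.B_fac.minus_ne z hzb
    have hCz := hC z hza hzb
    have hAz := hA z hza hzb
    have e4 := hee z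
    rw [K3] at e1
    rw [K1] at e2
    generalize Complex.exp (-Complex.I * z * L) = p at *
    generalize Complex.exp (Complex.I * z * L) = r at *
    field_simp at e1 e2
    -- The combination of the two scalar equations gives the second row only after multiplication by
    -- A.
    refine mul_left_cancel₀ hAz ?_
    linear_combination e2 - C z * p * e1 - C z * s.Bminus z * X z * e4

end

section

variable {a b L : ℝ} {A B C : ℂ → ℂ} {s : Parts} {g : Forcing}

/-! ## Contraction of the scheme and convergence -/

/-- Pairing each supremum of a factor with that of its inverse times an exponential gives e^{aL} and
e^{−bL} up to constants. The lower bound has constant 1, so any cycle of norm o(e^{(a−b)L}) is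
eventually bounded by the ratio. -/
theorem GoodParts.exists_ratio_bound (hs : GoodParts a b A B C s) :
    ∃ R : ℝ, ∀ L, Real.exp ((a - b) * L) ≤ ratio a b L s ∧
      ratio a b L s ≤ R * Real.exp ((a - b) * L) := by
  obtain ⟨R₁, hR₁, H₁⟩ := exists_lineSup_mul_bound (c := a) (J := Set.Ici a)
    (E := fun L z => Complex.exp (-Complex.I * z * L)) (e := fun L => Real.exp (a * L))
    (fun L x => by rw [onLine, norm_exp_neg_I_mul, onLine_im]) Set.self_mem_Ici
    hs.K1_fac.plus.multiplier_of_sub_one.bdd hs.K1_fac.plus_inv.multiplier_of_sub_one.bdd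
    hs.K1_fac.plus_ne
  obtain ⟨R₃, hR₃, H₃⟩ := exists_lineSup_mul_bound (c := b) (J := Set.Iic b)
    (E := fun L z => Complex.exp (Complex.I * z * L)) (e := fun L => Real.exp (-b * L))
    (fun L x => by rw [onLine, norm_exp_I_mul, onLine_im]) Set.self_mem_Iic
    hs.K3_fac.minus.multiplier_of_sub_one.bdd hs.K3_fac.minus_inv.multiplier_of_sub_one.bdd
    hs.K3_fac.minus_ne
  refine ⟨R₁ * R₃, fun L => ?_⟩
  obtain ⟨h1, h1'⟩ := H₁ L
  obtain ⟨h3, h3'⟩ := H₃ L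
  have hE : Real.exp ((a - b) * L) = Real.exp (a * L) * Real.exp (-b * L) := by
    rw [← Real.exp_add]; ring_nf
  have hr : ratio a b L s = (lineSup a s.K1plus
        * lineSup a fun z => (s.K1plus z)⁻¹ * Complex.exp (-Complex.I * z * L))
      * (lineSup b s.K3minus
        * lineSup b fun z => (s.K3minus z)⁻¹ * Complex.exp (Complex.I * z * L)) := by
    rw [ratio]
    simp only [mul_comm (Complex.exp (Complex.I * _ * L))]
    ring
  rw [hr, hE]
  refine ⟨mul_le_mul h1 h3 (Real.exp_pos _).le ((Real.exp_pos _).le.trans h1), ?_⟩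
  refine (mul_le_mul h1' h3' ((Real.exp_pos _).le.trans h3) (by positivity)).trans_eq ?_
  ring

/-- For large `L` the scheme contracts with ratio `q < 1`. -/
theorem GoodParts.exists_threshold (hs : GoodParts a b A B C s) (hab : a < b) :
    ∃ L₀ : ℝ, 0 < L₀ ∧ ∀ L, L₀ ≤ L →
      0 ≤ ratio a b L s ∧ ratio a b L s < 1 ∧
      (∀ Φ₀ X M Ψ Y Φ X', IsAddSplit a b (fun z => s.K1p z * Φ₀ z) X M →
        PlusSolves a b (K3 A s) (fun z => Complex.exp (Complex.I * z * L) * X z) Ψ Y →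
        MinusSolves a b (K1 A C s) (fun z => Complex.exp (-Complex.I * z * L) * Y z) Φ X' →
        lineNorm a Φ ≤ ENNReal.ofReal (ratio a b L s) * lineNorm a Φ₀) ∧
      (∀ Ψ₀ P Y Φ X Ψ Y', IsAddSplit a b (fun z => s.K3m z * Ψ₀ z) P Y →
        MinusSolves a b (K1 A C s) (fun z => Complex.exp (-Complex.I * z * L) * Y z) Φ X →
        PlusSolves a b (K3 A s) (fun z => Complex.exp (Complex.I * z * L) * X z) Ψ Y' →
        lineNorm b Ψ ≤ ENNReal.ofReal (ratio a b L s) * lineNorm b Ψ₀) ∧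
      ∀ X Ψ Y Φ X', PlusClass a X →
        PlusSolves a b (K3 A s) (fun z => Complex.exp (Complex.I * z * L) * X z) Ψ Y →
        MinusSolves a b (K1 A C s) (fun z => Complex.exp (-Complex.I * z * L) * Y z) Φ X' →
        lineNorm a X' ≤ ENNReal.ofReal (1 / 2) * lineNorm a X := by
  obtain ⟨R, hR⟩ := hs.exists_ratio_bound
  obtain ⟨M₁, hM₁⟩ := hs.K1p_mul.bdd
  obtain ⟨M₃, hM₃⟩ := hs.K3m_mul.bdd
  -- Small enough to absorb the suprema of K₁⁺ and K₃⁻, which enter on passing from Φ₀ to (K₁⁺Φ₀)⁺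
  -- and from Ψ₀ to (K₃⁻Ψ₀)⁻. Also m ≤ 1/2, as the last clause needs.
  set m : ℝ := 1 / (2 + |M₁| + |M₃|) with hm
  have hm0 : 0 < m := by positivity
  have hm2 : m ≤ 1 / 2 := one_div_le_one_div_of_le (by norm_num) (by
    linarith [abs_nonneg M₁, abs_nonneg M₃])
  have hmM : ∀ M, M ≤ |M₁| + |M₃| → m * M ≤ 1 := fun M hM => by
    rw [hm, one_div_mul_eq_div, div_le_one (by positivity)]
    linarith
  obtain ⟨L₁, hL₁, H₁⟩ := exists_contraction_minus hab hs.K1_fac hs.K3_fac hm0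
  obtain ⟨L₃, hL₃, H₃⟩ := exists_contraction_plus hab hs.K1_fac hs.K3_fac hm0
  have hlim : Tendsto (fun L : ℝ => R * Real.exp ((a - b) * L)) atTop (𝓝 (R * 0)) :=
    (Real.tendsto_exp_atBot.comp
      (tendsto_id.const_mul_atTop_of_neg (sub_neg.2 hab))).const_mul R
  rw [mul_zero] at hlim
  obtain ⟨L₂, hL₂⟩ := (hlim.eventually (gt_mem_nhds one_pos)).exists_forall_of_atTop
  refine ⟨max L₁ (max L₂ L₃), lt_max_of_lt_left hL₁, fun L hL => ?_⟩
  have hLL₁ : L₁ ≤ L := (le_max_left _ _).trans hL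
  have hLL₂ : L₂ ≤ L := (le_max_left _ _).trans ((le_max_right _ _).trans hL)
  have hLL₃ : L₃ ≤ L := (le_max_right _ _).trans ((le_max_right _ _).trans hL)
  obtain ⟨hlow, hup⟩ := hR L
  have hE0 := (Real.exp_pos ((a - b) * L)).le
  have combine : ∀ {u v w : ENNReal} {M : ℝ}, M ≤ |M₁| + |M₃| →
      u ≤ ENNReal.ofReal (m * Real.exp ((a - b) * L)) * v → v ≤ ENNReal.ofReal M * w →
      u ≤ ENNReal.ofReal (ratio a b L s) * w := by
    intro u v w M hM hu hv
    refine (hu.trans (mul_le_mul_right hv _)).trans ?_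
    rw [← mul_assoc, ← ENNReal.ofReal_mul (by positivity)]
    refine mul_le_mul_left (ENNReal.ofReal_le_ofReal (le_trans ?_ hlow)) _
    calc m * Real.exp ((a - b) * L) * M = m * M * Real.exp ((a - b) * L) := by ring
      _ ≤ 1 * Real.exp ((a - b) * L) := mul_le_mul_of_nonneg_right (hmM M hM) hE0
      _ = _ := one_mul _
  refine ⟨hE0.trans hlow, hup.trans_lt (hL₂ L hLL₂), ?_, ?_, ?_⟩
  · intro Φ₀ X M Ψ Y Φ X' hX hΨ hΦ
    exact combine (by linarith [le_abs_self M₁, abs_nonneg M₃])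
      (H₁ L hLL₁ X Ψ Y Φ X' hX.plus hΨ hΦ).1
      ((hX.lineNorm_le le_rfl hab.le).1.trans (lineNorm_mul_le_of_bound hM₁ Set.self_mem_Ici))
  · intro Ψ₀ P Y Φ X Ψ Y' hY hΦ hΨ
    exact combine (by linarith [le_abs_self M₃, abs_nonneg M₁])
      (H₃ L hLL₃ Y Φ X Ψ Y' hY.minus hΦ hΨ)
      ((hY.lineNorm_le hab.le le_rfl).2.trans (lineNorm_mul_le_of_bound hM₃ Set.self_mem_Iic))
  · intro X Ψ Y Φ X' hX hΨ hΦ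
    refine (H₁ L hLL₁ X Ψ Y Φ X' hX hΨ hΦ).2.trans
      (mul_le_mul_left (ENNReal.ofReal_le_ofReal ?_) _)
    have : Real.exp ((a - b) * L) ≤ 1 := Real.exp_le_one_iff.2
      (mul_nonpos_of_nonpos_of_nonneg (by linarith) (hL₁.le.trans hLL₁))
    calc m * Real.exp ((a - b) * L) ≤ 1 / 2 * 1 := by gcongr
      _ = 1 / 2 := mul_one _

/-- The a priori error estimate of a contraction. -/
theorem error_le_of_contraction {q : ℝ} (hq0 : 0 ≤ q) (hq1 : q < 1) {e : ℕ → ENNReal}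
    {d : ENNReal} (he0 : e 0 ≠ ⊤) (h : ∀ n, e (n + 1) ≤ ENNReal.ofReal q * e n)
    (hd : e 0 ≤ d + e 1) :
    Tendsto e atTop (𝓝 0) ∧ ∀ n, e n ≤ ENNReal.ofReal (q ^ n / (1 - q)) * d := by
  have hpow : ∀ n, e n ≤ ENNReal.ofReal (q ^ n) * e 0 := by
    intro n
    induction n with
    | zero => simp
    | succ n ih =>
      refine (h n).trans ((mul_le_mul_right ih _).trans_eq ?_)
      rw [← mul_assoc, ← ENNReal.ofReal_mul hq0, pow_succ']
  have hq : 0 < 1 - q := sub_pos.2 hq1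
  -- From e₀ ≤ d + e₁ ≤ d + q e₀; finiteness of e₀ is what allows the cancellation.
  have h0 : ENNReal.ofReal (1 - q) * e 0 ≤ d := by
    have hfin : ENNReal.ofReal q * e 0 ≠ ⊤ := ENNReal.mul_ne_top ENNReal.ofReal_ne_top he0
    refine (ENNReal.add_le_add_iff_right hfin).1 ?_
    rw [← add_mul, ← ENNReal.ofReal_add hq.le hq0, sub_add_cancel, ENNReal.ofReal_one, one_mul]
    exact hd.trans (add_le_add_right (h 0) _)
  refine ⟨?_, fun n => ?_⟩
  · have t := ENNReal.Tendsto.mul_const (b := e 0)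
      (ENNReal.tendsto_ofReal (tendsto_pow_atTop_nhds_zero_of_lt_one hq0 hq1)) (Or.inr he0)
    rw [ENNReal.ofReal_zero, zero_mul] at t
    exact tendsto_of_tendsto_of_tendsto_of_le_of_le tendsto_const_nhds t (fun _ => zero_le) hpow
  · refine (hpow n).trans (le_trans (le_of_eq ?_) (mul_le_mul_right h0 _))
    rw [← mul_assoc, ← ENNReal.ofReal_mul (by positivity), div_mul_cancel₀ _ hq.ne']

variable {f1 f2 D D' E E' M M' P P' Φ Φ' Φ₁ Φ₁' Ψ Ψ' Ψ₁ Ψ₁' : ℂ → ℂ}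

theorem PhiStep.sub (h : PhiStep a b L A C s g E Φ D) (h' : PhiStep a b L A C s g E' Φ' D') :
    MinusSolves a b (K1 A C s) (fun z => Complex.exp (-Complex.I * z * L) * (E z - E' z))
      (fun z => Φ z - Φ' z) fun z => D z - D' z :=
  (MinusSolves.sub h h').congr fun z _ _ => by ring

theorem PsiStep.sub (h : PsiStep a b L A s g D Ψ E) (h' : PsiStep a b L A s g D' Ψ' E') :
    PlusSolves a b (K3 A s) (fun z => Complex.exp (Complex.I * z * L) * (D z - D' z))
      (fun z => Ψ z - Ψ' z) fun z => E z - E' z :=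
  (PlusSolves.sub h h').congr fun z _ _ => by ring

end

end WienerHopf

/-! ### The main theorem. -/

open WienerHopf

theorem theorem3 (a b : ℝ) (ha : a < 0) (hb : 0 < b) (A B C : ℂ → ℂ)
    (hA : WienerHopf.Coefficient a b A) (hB : WienerHopf.Coefficient a b B)
    (hC : WienerHopf.Coefficient a b C) :
    ∃ s : WienerHopf.Parts, WienerHopf.IsParts a b A B C s ∧
      ∃ L₀ : ℝ, 0 < L₀ ∧ ∀ L : ℝ, L₀ ≤ L →
        WienerHopf.ratio a b L s < 1 ∧
        ∀ f1 f2 : ℂ → ℂ, WienerHopf.StripClass a b f1 → WienerHopf.StripClass a b f2 →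
          ∃ g : WienerHopf.Forcing, WienerHopf.IsForcing a b L A C f1 f2 s g ∧
            -- the exact solution exists
            (∃ Φ0 ΦL Ψ0 ΨL : ℂ → ℂ,
              WienerHopf.IsExactSolution a b L A B C f1 f2 Φ0 ΦL Ψ0 ΨL) ∧
            -- the first approximation exists, and the scheme can be run from any initial function
            (∃ Φ : ℂ → ℂ, WienerHopf.MinusClass b Φ ∧ WienerHopf.FirstApprox a b s g Φ) ∧
            (∀ Φinit : ℂ → ℂ, WienerHopf.MinusClass b Φinit →
              ∃ Φ Ψ : ℕ → ℂ → ℂ, Φ 0 = Φinit ∧ WienerHopf.IsIteration a b L s g Φ Ψ) ∧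
            -- every run contracts, and converges to the exact solution
            ∀ Φ Ψ : ℕ → ℂ → ℂ, WienerHopf.IsIteration a b L s g Φ Ψ →
              (∀ n : ℕ, WienerHopf.lineNorm a (Φ (n + 2) - Φ (n + 1))
                ≤ ENNReal.ofReal (WienerHopf.ratio a b L s)
                  * WienerHopf.lineNorm a (Φ (n + 1) - Φ n)) ∧
              (∀ n : ℕ, WienerHopf.lineNorm b (Ψ (n + 3) - Ψ (n + 2))
                ≤ ENNReal.ofReal (WienerHopf.ratio a b L s)
                  * WienerHopf.lineNorm b (Ψ (n + 2) - Ψ (n + 1))) ∧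
              ∀ Φ0 ΦL Ψ0 ΨL : ℂ → ℂ,
                WienerHopf.IsExactSolution a b L A B C f1 f2 Φ0 ΦL Ψ0 ΨL →
                Tendsto (fun n => WienerHopf.lineNorm a (Φ n - ΦL)) atTop (𝓝 0) ∧
                Tendsto (fun n => WienerHopf.lineNorm b (Ψ n - Ψ0)) atTop (𝓝 0) ∧
                (∀ n : ℕ, WienerHopf.lineNorm a (Φ n - ΦL)
                  ≤ ENNReal.ofReal (WienerHopf.ratio a b L s ^ n
                      / (1 - WienerHopf.ratio a b L s))
                    * WienerHopf.lineNorm a (Φ 0 - Φ 1)) ∧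
                (∀ n : ℕ, WienerHopf.lineNorm b (Ψ (n + 1) - Ψ0)
                  ≤ ENNReal.ofReal (WienerHopf.ratio a b L s ^ n
                      / (1 - WienerHopf.ratio a b L s))
                    * WienerHopf.lineNorm b (Ψ 1 - Ψ 2)) := by
  have hab : a < b := ha.trans hb
  obtain ⟨s, hs⟩ := exists_goodParts ha hb hA hB hC
  obtain ⟨L₀, hL₀, H⟩ := hs.exists_threshold hab
  refine ⟨s, hs.toIsParts, L₀, hL₀, fun L hL => ?_⟩
  have hL0 : 0 ≤ L := hL₀.le.trans hL
  obtain ⟨hq0, hq1, hΦc, hΨc, hhalf⟩ := H L hL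
  refine ⟨hq1, fun f1 f2 hf1 hf2 => ?_⟩
  obtain ⟨g, hg⟩ := hs.exists_forcing hab hL0 hf1 hf2
  refine ⟨g, hg, hs.exists_exactSolution hg hab hL0 hA.ne hC.ne hhalf,
    hs.exists_firstApprox hg hab, fun Φ₀ hΦ₀ => hs.exists_iteration hg hab hL0 hΦ₀,
    fun Φ Ψ hit => ?_⟩
  choose Dp Dm hD using fun n => hs.exists_split_phi hab (hit.Φ_mem n)
  -- Index shift: these are the parts of K₃⁻ Ψ (n + 1), since Ψ 0 is arbitrary.
  choose Ep Em hE using fun n => hs.exists_split_psi hab (hit.Ψ_mem n)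
  have hψ : ∀ n, PsiStep a b L A s g (Dp n) (Ψ (n + 1)) (Em n) := fun n =>
    hs.psiStep hg hab hL0 (hit.Ψ_mem n) (hD n) (hE n) (hit.Ψ_step n)
  have hφ : ∀ n, PhiStep a b L A C s g (Em n) (Φ (n + 1)) (Dp (n + 1)) := fun n =>
    hs.phiStep hg hab hL0 (hit.Φ_mem (n + 1)) (hD (n + 1)) (hE n) (hit.Φ_step n)
  refine ⟨fun n => ?_, fun n => ?_, fun Φ0 ΦL Ψ0 ΨL hex => ?_⟩
  · exact hΦc (Φ (n + 1) - Φ n) _ _ _ _ _ _ (((hD (n + 1)).sub (hD n)).congr fun z _ _ => by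
      simp only [Pi.sub_apply]; ring) ((hψ (n + 1)).sub (hψ n)) ((hφ (n + 1)).sub (hφ n))
  · exact hΨc (Ψ (n + 2) - Ψ (n + 1)) _ _ _ _ _ _ (((hE (n + 1)).sub (hE n)).congr fun z _ _ => by
      simp only [Pi.sub_apply]; ring) ((hφ (n + 1)).sub (hφ n)) ((hψ (n + 2)).sub (hψ (n + 1)))
  -- The exact solution satisfies the same half-step equations as the iterates, so the forcing
  -- cancels in the errors and the homogeneous contraction applies to them directly.
  · obtain ⟨D, E, hψ', hφ'⟩ := hs.exact_steps hg hC.ne hex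
    have hN1 := hg.f3.minus.add ((hψ'.minus.add hg.f4.minus).mul (multiplier_exp_minus b hL0))
    have hN2 := hg.f4.plus.neg.add ((hφ'.plus.sub hg.f3.plus).mul (multiplier_exp_plus a hL0))
    have hDL := MinusSolves.isAddSplit hφ' hN1 hs.K1m_mul hs.K1_eq
    have hEL := PlusSolves.isAddSplit hψ' hN2 hs.K3p_mul hs.K3_eq
    have mΦ : ∀ n, AEStronglyMeasurable (onLine a (Φ n)) volume := fun n =>
      ((hit.Φ_mem n).nice.lines a hab.le).1.1
    have mΨ : ∀ n, AEStronglyMeasurable (onLine b (Ψ (n + 1))) volume := fun n =>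
      ((hit.Ψ_mem n).nice.lines b hab.le).1.1
    obtain ⟨t1, b1⟩ := error_le_of_contraction hq0 hq1
      (e := fun n => lineNorm a (Φ n - ΦL)) (d := lineNorm a (Φ 0 - Φ 1))
      (((hit.Φ_mem 0).sub hex.ΦL_mem).nice.lines a hab.le).1.2.ne
      (fun n => hΦc (Φ n - ΦL) _ _ _ _ _ _ (((hD n).sub hDL).congr fun z _ _ => by
        simp only [Pi.sub_apply]; ring) ((hψ n).sub hψ') ((hφ n).sub hφ'))
      (lineNorm_sub_le (mΦ 0) (mΦ 1) (hex.ΦL_mem.nice.lines a hab.le).1.1)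
    obtain ⟨t2, b2⟩ := error_le_of_contraction hq0 hq1
      (e := fun n => lineNorm b (Ψ (n + 1) - Ψ0)) (d := lineNorm b (Ψ 1 - Ψ 2))
      (((hit.Ψ_mem 0).sub hex.Ψ0_mem).nice.lines b hab.le).1.2.ne
      (fun n => hΨc (Ψ (n + 1) - Ψ0) _ _ _ _ _ _ (((hE n).sub hEL).congr fun z _ _ => by
        simp only [Pi.sub_apply]; ring) ((hφ n).sub hφ') ((hψ (n + 1)).sub hψ'))
      (lineNorm_sub_le (mΨ 0) (mΨ 1) (hex.Ψ0_mem.nice.lines b hab.le).1.1)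
    -- The error estimate for Ψ starts at index 1; dropping the first term does not affect the
    -- limit.
    exact ⟨t1, (tendsto_add_atTop_iff_nat 1).1 t2, b1, b2⟩
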